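/- **Proposition (Edge scaling asymptotics).** Let $g\in H^2_0(\mathbf R)$ be real valued and compactly supported (identified with its continuous representative), let $0<a<2/3$, $E=2$, and for $N\in\mathbf N$, $N\ge 1$, set $f(x):=g(N^a(x-2))$. Write $$\langle f\rangle_{\rm sc}:=\int_{-2}^2 f(x)\frac{\sqrt{4-x^2}}{2\pi}\,dx,\qquad \langle f\rangle_{1/\rm sc}:=\int_{-2}^2\frac{f(x)}{\pi\sqrt{4-x^2}}\,dx,$$ $$m(z):=\int_{-2}^2\frac{\sqrt{4-x^2}}{2\pi(x-z)}\,dx,\qquad \rho(z):=\tfrac1\pi|\Im m(z)|,\qquad C_N:=\frac{N^a}{\rho(2+\mathrm iN^{-a})},$$ $$V^1_{\rm tr}(f):=\frac1{4\pi^2}\iint_{-2}^2\Bigl(\frac{f(x)-f(y)}{x-y}\Bigr)^2\frac{4-xy}{\sqrt{(4-x^2)(4-y^2)}}\,dx\,dy,\qquad V^1_{\rm d}(f):=\langle f^2\rangle_{\rm sc}-\langle f\rangle_{\rm sc}^2,$$ and, for $|\sigma|<1$, $$V^2_{\rm tr}(f,\sigma):=\frac1{4\pi^2}\iint_{-2}^2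 f(x)f(y)\,\partial_x\partial_y\log\left[\frac{(x-\sigma y)^2+(\sqrt{4-x^2}+\sigma\sqrt{4-y^2})^2}{(x-\sigma y)^2+(\sqrt{4-x^2}-\sigma\sqrt{4-y^2})^2}\right]dx\,dy,$$ $$V^2_{\rm d}(f,\sigma):=\frac1{4\pi^2}\iint_{-2}^2 f(x)f(y)\frac{(1-\sigma^2)\sqrt{(4-x^2)(4-y^2)}}{\sigma^2(x^2+y^2)+(1-\sigma^2)^2-xy\sigma(1+\sigma^2)}\,dx\,dy-\langle f\rangle_{\rm sc}^2,$$ $$E_{\rm tr}(f,\sigma):=\Bigl\langle f\Bigl(1-\frac{1-\sigma^2}{(1+\sigma)^2-\sigma x^2}\Bigr)\Bigr\rangle_{1/\rm sc}.$$ The limits of $V^2_{\rm tr}(f,\sigma)$, $V^2_{\rm d}(f,\sigma)$, $E_{\rm tr}(f,\sigma)$ as $\sigma\to\pm1$ (from within $(-1,1)$) exist, and define these functionals at $\sigma=\pm1$. Let $\|h\|_{L^2}^2:=\int_{\mathbf R}h^2$, $\|h\|_{\dot H^{1/2}}^2:=\iint_{\mathbf R^2}\bigl(\frac{h(x)-h(y)}{x-y}\bigr)^2dx\,dy$,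 and let $g(-x^2)$, $g(-x^2)x$ denote the functions $x\mapsto g(-x^2)$, $x\mapsto g(-x^2)x$. Then, for $\sigma\in[-1,1]$, $$\begin{aligned} V^1_{\rm tr}(f)&=\frac{\|g(-x^2)\|^2_{\dot H^{1/2}}}{8\pi^2}+O(N^{-a/2}),\\ V^2_{\rm tr}(f,\sigma)&=\mathbf 1(\sigma=1)\frac{\|g(-x^2)\|^2_{\dot H^{1/2}}}{8\pi^2}+O(N^{-a/2}),\\ C_NV^1_{\rm d}(f)&=\sqrt2\,\|g(-x^2)x\|^2_{L^2}+O(N^{-a/2}),\\ C_NV^2_{\rm d}(f,\sigma)&=\mathbf 1(\sigma=1)\sqrt2\,\|g(-x^2)x\|^2_{L^2}+O(N^{-a/2}),\\ -\tfrac12E_{\rm tr}(f,\sigma)&=\mathbf 1(\sigma=1)\frac{g(0)}4+O(N^{-a/2}), \end{aligned}$$ and, with the explicit normalisation $N^{3a/2}$ in place of $C_N$, $$N^{3a/2}V^1_{\rm d}(f)=\frac{\|g(-x^2)x\|_{L^2}^2}{\pi}+O(N^{-a/2}),\qquad N^{3a/2}V^2_{\rm d}(f,\sigma)=\mathbf 1(\sigma=1)\frac{\|g(-x^2)x\|_{L^2}^2}{\pi}+O(N^{-a/2}).$$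 For any fixed $\epsilon>0$ and $L,M$, the implicit constants can be chosen to depend only on $a,\epsilon,L,M$, uniformly over all $N\ge1$, all $g$ with $\operatorname{supp}g\subset[-L,L]$ and $\|g\|_{H^2}\le M$, and all $\sigma\in[-1,1-\epsilon]\cup\{1\}$. -/

import Mathlib

open MeasureTheory Filter Set
open scoped Topology ContDiff

namespace EdgeScaling

noncomputable section

/-- `v` is the weak derivative of `u` on the real line. -/
def HasWeakDeriv (u v : ℝ → ℝ) : Prop :=
  LocallyIntegrable u ∧ LocallyIntegrable v ∧
    ∀ φ : ℝ → ℝ, ContDiff ℝ ∞ φ → HasCompactSupport φ →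
      ∫ x, u x * deriv φ x = -∫ x, v x * φ x

/-- `g` lies in `H²(ℝ)` (it is square integrable together with its first two weak derivatives)
and its `H²` norm is at most `M`.  On the whole line `H²₀(ℝ) = H²(ℝ)`. -/
def MemH2NormLE (g : ℝ → ℝ) (M : ℝ) : Prop :=
  ∃ g₁ g₂ : ℝ → ℝ, HasWeakDeriv g g₁ ∧ HasWeakDeriv g₁ g₂ ∧
    MemLp g 2 volume ∧ MemLp g₁ 2 volume ∧ MemLp g₂ 2 volume ∧
    Real.sqrt ((∫ x, g x ^ 2) + (∫ x, g₁ x ^ 2) + ∫ x, g₂ x ^ 2) ≤ M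

/-- The test function `g` rescaled to the scale `N^{-a}` around the energy `E`. -/
def rescale (g : ℝ → ℝ) (a E : ℝ) (N : ℕ) (x : ℝ) : ℝ :=
  g ((N : ℝ) ^ a * (x - E))

/-- The semicircle density (used on `[-2, 2]`). -/
def rhoSc (x : ℝ) : ℝ := Real.sqrt (4 - x ^ 2) / (2 * Real.pi)

/-- Expectation with respect to the semicircle density. -/
def meanSc (f : ℝ → ℝ) : ℝ := ∫ x in (-2 : ℝ)..2, f x * rhoSc x

/-- Expectation with respect to the inverse semicircle (arcsine) density. -/
def meanInvSc (f : ℝ → ℝ) : ℝ :=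
  ∫ x in (-2 : ℝ)..2, f x / (Real.pi * Real.sqrt (4 - x ^ 2))

/-- The Stieltjes transform of the semicircle law. -/
def mSc (z : ℂ) : ℂ := ∫ x in (-2 : ℝ)..2, (rhoSc x : ℂ) / ((x : ℂ) - z)

/-- The density `ρ(z) = |Im m(z)| / π`, for `z` off the real line. -/
def rhoC (z : ℂ) : ℝ := |(mSc z).im| / Real.pi

/-- The density factor `ρ_N^{a,E}`. -/
def rhoN (a E : ℝ) (N : ℕ) : ℝ :=
  if 0 < a then rhoC ((E : ℂ) + Complex.I * (((N : ℝ) ^ (-a) : ℝ) : ℂ)) else 1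

/-- The scaling factor `C_N^{a,E} = N^a / ρ_N^{a,E}`. -/
def scaleC (a E : ℝ) (N : ℕ) : ℝ := (N : ℝ) ^ a / rhoN a E N

/-- The first tracial variance functional. -/
def Vtr1 (f : ℝ → ℝ) : ℝ :=
  1 / (4 * Real.pi ^ 2) *
    ∫ x in (-2 : ℝ)..2, ∫ y in (-2 : ℝ)..2,
      ((f x - f y) / (x - y)) ^ 2 *
        ((4 - x * y) / Real.sqrt ((4 - x ^ 2) * (4 - y ^ 2)))

/-- The logarithmic kernel whose mixed derivative defines the second tracial variance. -/
def logKernel (σ x y : ℝ) : ℝ :=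
  Real.log
    (((x - σ * y) ^ 2 + (Real.sqrt (4 - x ^ 2) + σ * Real.sqrt (4 - y ^ 2)) ^ 2) /
      ((x - σ * y) ^ 2 + (Real.sqrt (4 - x ^ 2) - σ * Real.sqrt (4 - y ^ 2)) ^ 2))

/-- The second tracial variance functional, as given by the explicit formula for `|σ| < 1`. -/
def Vtr2Formula (f : ℝ → ℝ) (σ : ℝ) : ℝ :=
  1 / (4 * Real.pi ^ 2) *
    ∫ x in (-2 : ℝ)..2, ∫ y in (-2 : ℝ)..2,
      f x * f y * deriv (fun s : ℝ => deriv (fun t : ℝ => logKernel σ s t) y) x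

/-- The first diagonal variance functional. -/
def Vd1 (f : ℝ → ℝ) : ℝ := meanSc (fun x => f x ^ 2) - meanSc f ^ 2

/-- The second diagonal variance functional, as given by the explicit formula for `|σ| < 1`. -/
def Vd2Formula (f : ℝ → ℝ) (σ : ℝ) : ℝ :=
  1 / (4 * Real.pi ^ 2) *
    (∫ x in (-2 : ℝ)..2, ∫ y in (-2 : ℝ)..2,
      f x * f y *
        ((1 - σ ^ 2) * Real.sqrt ((4 - x ^ 2) * (4 - y ^ 2)) /
          (σ ^ 2 * (x ^ 2 + y ^ 2) + (1 - σ ^ 2) ^ 2 - x * y * σ * (1 + σ ^ 2))))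
    - meanSc f ^ 2

/-- The functional `E_tr`, as given by the explicit formula for `|σ| < 1`. -/
def EtrFormula (f : ℝ → ℝ) (σ : ℝ) : ℝ :=
  meanInvSc (fun x => f x * (1 - (1 - σ ^ 2) / ((1 + σ) ^ 2 - σ * x ^ 2)))

/-- Extension of a function on `(-1, 1)` to the endpoints `±1` by its limits there. -/
def extendByLimit (F : ℝ → ℝ) (σ : ℝ) : ℝ :=
  if |σ| < 1 then F σ else limUnder (𝓝[Ioo (-1 : ℝ) 1] σ) F

/-- `V_tr²(f, σ)` for `σ ∈ [-1, 1]`. -/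
def Vtr2 (f : ℝ → ℝ) (σ : ℝ) : ℝ := extendByLimit (Vtr2Formula f) σ

/-- `V_d²(f, σ)` for `σ ∈ [-1, 1]`. -/
def Vd2 (f : ℝ → ℝ) (σ : ℝ) : ℝ := extendByLimit (Vd2Formula f) σ

/-- `E_tr(f, σ)` for `σ ∈ [-1, 1]`. -/
def Etr (f : ℝ → ℝ) (σ : ℝ) : ℝ := extendByLimit (EtrFormula f) σ

/-- The squared homogeneous `H^{1/2}` norm. -/
def hHalfNormSq (h : ℝ → ℝ) : ℝ := ∫ x, ∫ y, ((h x - h y) / (x - y)) ^ 2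

/-- The squared `L²` norm. -/
def l2NormSq (h : ℝ → ℝ) : ℝ := ∫ x, h x ^ 2

/-- The indicator of `σ = 1`. -/
def indOne (σ : ℝ) : ℝ := ({1} : Set ℝ).indicator 1 σ

end

end EdgeScaling

/-! Put s = N^{-a/2}, so that f(x) = g((x - 2)/s²); every claim becomes an O(s) estimate for 0 < s ≤
1. The profile g enters only through constants B, R with |g| ≤ B, g B-Lipschitz and g = 0 outside
[-R², R²] (`IsProfile`). An H² bound and a support bound supply these (`MemH2NormLE.isProfile`),
which gives the uniformity in g.

In the angle x = 2 cos θ all σ-dependent kernels are built from D(t) = |1 - σ e^{it}|². The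
logarithmic kernel is log D(θ+φ) - log D(θ-φ), the denominator of the diagonal variance is D(θ+φ)
D(θ-φ), and E_tr integrates f against 1 minus the Poisson kernel at 2θ.

At σ = 1 the variance kernels become singular on θ = φ, but their integrals in φ do not depend on σ:
they are 0 and 8π sin²θ (`integral_trKer`, `integral_dgKer`). Polarization rewrites each form as a
mass term minus half an integral of products of differences. Since (cos θ - cos φ)² = (1 -
cos(θ+φ))(1 - cos(θ-φ)), these differences absorb the singularity uniformly in σ, and dominated
convergence gives the limits V_tr¹ and V_d¹ (`tendsto_integral_bilinear`). The Poisson kernel puts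
equal masses at x = 2 and x = -2, which produces g(0)/4. At σ = -1 the substitution φ ↦ π - φ
reduces the variances to the same argument, while the Poisson kernel concentrates at x = 0.

For σ ≤ 1 - ε, f lives on angles O(s). There D is bounded below, even near σ = -1 once s is small,
so the functionals are controlled by ∫|f| = O(s) and ∫|f| sin² = O(s³). If s is not small, bounds
valid for every f near σ = -1 suffice (`IsProfile.exists_bound_of_le`).

The leading terms come from x = 2 - s²u², where f(x) = g(-u²) and √(4 - x²) = s u √(4 - s²u²). This
gives ⟨f²⟩ ≈ s³‖g(-x²)x‖²/π. It also gives ρ(2 + is²) ≈ s/(√2 π), hence C_N ≈ √2 π/s³. In V_tr¹ the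
limiting kernel is 2(u² + v²)/(u² - v²)² = 1/(u-v)² + 1/(u+v)², the Ḣ^{1/2} kernel of an even
function folded onto the quadrant (`IsProfile.hHalfNormSq_eq`). -/

namespace EdgeScaling

/-! ### Weak derivatives: an H² function of compact support is bounded and Lipschitz. -/

/-- A smooth compactly supported function with vanishing integral has a smooth compactly
supported primitive. -/
theorem exists_testFunction_deriv_eq {φ : ℝ → ℝ} (hφ : ContDiff ℝ ∞ φ) (hs : HasCompactSupport φ)
    (h0 : ∫ x, φ x = 0) :
    ∃ χ : ℝ → ℝ, ContDiff ℝ ∞ χ ∧ HasCompactSupport χ ∧ deriv χ = φ := by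
  obtain ⟨b, hb⟩ := hs.isCompact.isBounded.subset_closedBall 0
  have hz : ∀ x, b < |x| → φ x = 0 := fun x hx => by
    by_contra h
    have := hb (subset_tsupport _ h)
    rw [Metric.mem_closedBall, dist_zero_right, Real.norm_eq_abs] at this
    linarith
  have hd : ∀ x, HasDerivAt (fun x => ∫ t in (-b)..x, φ t) (φ x) x := fun x =>
    intervalIntegral.integral_hasDerivAt_right (hφ.continuous.intervalIntegrable _ _)
      hφ.continuous.aestronglyMeasurable.stronglyMeasurableAtFilter hφ.continuous.continuousAt
  have hde : deriv (fun x => ∫ t in (-b)..x, φ t) = φ := funext fun x => (hd x).deriv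
  refine ⟨fun x => ∫ t in (-b)..x, φ t, ?_, ?_, hde⟩
  · rw [contDiff_infty_iff_deriv, hde]
    exact ⟨fun x => (hd x).differentiableAt, hφ⟩
  · refine HasCompactSupport.intro (isCompact_Icc (a := -b) (b := b)) fun x hx => ?_
    by_cases h1 : x < -b
    · refine (intervalIntegral.integral_congr_ae (g := fun _ => 0) ?_).trans (by simp)
      have : ∀ᵐ t : ℝ, t ≠ -b := by simp [ae_iff, measure_singleton]
      filter_upwards [this] with t ht ht'
      rw [uIoc_of_ge h1.le] at ht'
      have h2 : t < -b := lt_of_le_of_ne ht'.2 ht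
      exact hz t (by have := neg_le_abs t; linarith)
    · have h2 : b < x := by
        by_contra h3; exact hx ⟨not_lt.1 h1, not_lt.1 h3⟩
      by_cases h4 : -b ≤ x
      · rw [intervalIntegral.integral_of_le h4, setIntegral_eq_integral_of_ae_compl_eq_zero, h0]
        have : ∀ᵐ t : ℝ, t ≠ -b := by simp [ae_iff, measure_singleton]
        filter_upwards [this] with t ht ht'
        rcases lt_or_gt_of_ne ht with h5 | h5
        · exact hz t (by have := neg_le_abs t; linarith)
        · have h6 : x < t := by
            by_contra h7; exact ht' ⟨h5, not_lt.1 h7⟩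
          exact hz t (by have := le_abs_self t; linarith)
      · exact absurd (not_le.1 h4) h1

/-- The du Bois-Reymond lemma. -/
theorem ae_eq_const_of_integral_mul_deriv_eq_zero {u : ℝ → ℝ} (hu : LocallyIntegrable u)
    (h : ∀ φ : ℝ → ℝ, ContDiff ℝ ∞ φ → HasCompactSupport φ → ∫ x, u x * deriv φ x = 0) :
    ∃ c : ℝ, ∀ᵐ x, u x = c := by
  let ψb : ContDiffBump (0 : ℝ) := ⟨1, 2, one_pos, one_lt_two⟩
  set ψ : ℝ → ℝ := ψb.normed volume with hψ
  have hψ1 : ContDiff ℝ ∞ ψ := ψb.contDiff_normed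
  have hψ2 : HasCompactSupport ψ := ψb.hasCompactSupport_normed
  have hψ3 : ∫ x, ψ x = 1 := ψb.integral_normed
  refine ⟨∫ x, u x * ψ x, ?_⟩
  refine ae_eq_of_integral_contDiff_smul_eq hu (locallyIntegrable_const _) fun φ h1 h2 => ?_
  have hI : ∀ χ : ℝ → ℝ, ContDiff ℝ ∞ χ → HasCompactSupport χ → Integrable (fun x => u x * χ x) :=
    fun χ h1 h2 => by
      simpa [smul_eq_mul, mul_comm] using
        hu.integrable_smul_left_of_hasCompactSupport h1.continuous h2
  have hφi : Integrable φ := h1.continuous.integrable_of_hasCompactSupport h2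
  have hψi : Integrable ψ := hψ1.continuous.integrable_of_hasCompactSupport hψ2
  -- Subtracting the multiple of the bump ψ that carries the same integral leaves a mean-zero test
  -- function, hence a derivative.
  obtain ⟨χ, h3, h4, h5⟩ := exists_testFunction_deriv_eq
    (φ := fun x => φ x - (∫ y, φ y) * ψ x) (h1.sub (contDiff_const.mul hψ1))
    (h2.sub (hψ2.mul_left (f := fun _ => ∫ y, φ y)))
    (by rw [integral_sub hφi (hψi.const_mul _), integral_const_mul, hψ3]; simp)
  have h6 := h χ h3 h4
  rw [h5] at h6
  have h7 : ∫ x, u x * (φ x - (∫ y, φ y) * ψ x) = (∫ x, u x * φ x) - (∫ y, φ y) * ∫ x, u x * ψ x := by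
    rw [← integral_const_mul, ← integral_sub (hI φ h1 h2) ((hI ψ hψ1 hψ2).const_mul _)]
    exact integral_congr_ae (Eventually.of_forall fun x => by simp only; ring)
  simp only [smul_eq_mul, integral_mul_const]
  rw [h7] at h6
  rw [← sub_eq_zero, ← h6]
  simp only [mul_comm]

/-- Integration by parts of a primitive of a locally integrable function against a test function. -/
theorem integral_primitive_mul_deriv {v φ : ℝ → ℝ} (hv : LocallyIntegrable v)
    (hφ : ContDiff ℝ ∞ φ) (hs : HasCompactSupport φ) :
    ∫ x, (∫ t in (0 : ℝ)..x, v t) * deriv φ x = -∫ x, v x * φ x := by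
  obtain ⟨b, hb0, hb⟩ := hs.isCompact.isBounded.subset_closedBall_lt 0 0
  have hz : ∀ x, b < |x| → φ x = 0 ∧ deriv φ x = 0 := fun x hx => by
    have h1 : x ∉ tsupport φ := fun h => by
      have := hb h
      rw [Metric.mem_closedBall, dist_zero_right, Real.norm_eq_abs] at this
      linarith
    exact ⟨image_eq_zero_of_notMem_tsupport h1,
      image_eq_zero_of_notMem_tsupport fun h => h1 (tsupport_deriv_subset h)⟩
  have hvi : ∀ x y : ℝ, IntervalIntegrable v volume x y := fun x y =>
    intervalIntegrable_iff.mpr <|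
      (hv.integrableOn_isCompact isCompact_uIcc).mono_set uIoc_subset_uIcc
  -- The margin 1 makes φ vanish at the endpoints ±c, so integration by parts on [-c, c] has no
  -- boundary terms.
  set c := b + 1
  have hcc : -c ≤ c := by simp only [c]; linarith
  have hr : ∀ F : ℝ → ℝ, (∀ x, b < |x| → F x = 0) → ∫ x in (-c)..c, F x = ∫ x, F x := by
    intro F hF
    rw [intervalIntegral.integral_of_le hcc, setIntegral_eq_integral_of_forall_compl_eq_zero]
    intro x hx
    refine hF x ?_
    by_contra h
    have := abs_le.1 (not_lt.1 h)
    exact hx ⟨by simp only [c]; linarith, by simp only [c]; linarith⟩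
  have hac : AbsolutelyContinuousOnInterval (fun x => ∫ t in (0 : ℝ)..x, v t) (-c) c :=
    (hvi (-c) c).absolutelyContinuousOnInterval_intervalIntegral
      (by rw [uIcc_of_le hcc]; constructor <;> simp only [c] <;> linarith)
  have hφac : AbsolutelyContinuousOnInterval φ (-c) c :=
    ((hφ.of_le (by exact_mod_cast le_top)).contDiffOn (s := _)).absolutelyContinuousOnInterval
  have hp := hac.integral_mul_deriv_eq_deriv_mul hφac
  rw [hr _ fun x hx => by rw [(hz x hx).2, mul_zero],
    (hz c (by rw [abs_of_pos] <;> simp only [c] <;> linarith)).1,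
    (hz (-c) (by rw [abs_neg, abs_of_pos] <;> simp only [c] <;> linarith)).1] at hp
  rw [hp, mul_zero, mul_zero, sub_zero, zero_sub,
    ← hr (fun x => v x * φ x) fun x hx => by rw [(hz x hx).1, mul_zero]]
  congr 1
  refine intervalIntegral.integral_congr_ae ?_
  filter_upwards [_root_.LocallyIntegrable.ae_hasDerivAt_integral hv] with x hx _
  rw [(hx 0).deriv]

/-- A function with a weak derivative is almost everywhere a primitive of it. -/
theorem HasWeakDeriv.exists_ae_eq_primitive {u v : ℝ → ℝ} (h : HasWeakDeriv u v) :
    ∃ c : ℝ, ∀ᵐ x, u x = c + ∫ t in (0 : ℝ)..x, v t := by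
  obtain ⟨hu, hv, hw⟩ := h
  have hvi : ∀ x y : ℝ, IntervalIntegrable v volume x y := fun x y =>
    intervalIntegrable_iff.mpr <|
      (hv.integrableOn_isCompact isCompact_uIcc).mono_set uIoc_subset_uIcc
  have hc : Continuous fun x => ∫ t in (0 : ℝ)..x, v t :=
    intervalIntegral.continuous_primitive hvi 0
  have hI : ∀ w χ : ℝ → ℝ, LocallyIntegrable w → Continuous χ → HasCompactSupport χ →
      Integrable (fun x => w x * χ x) :=
    fun w χ h0 h1 h2 => by
      simpa [smul_eq_mul, mul_comm] using
        h0.integrable_smul_left_of_hasCompactSupport h1 h2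
  obtain ⟨c, h⟩ := ae_eq_const_of_integral_mul_deriv_eq_zero
    (u := fun x => u x - ∫ t in (0 : ℝ)..x, v t) (hu.sub hc.locallyIntegrable)
    fun φ h1 h2 => by
      have h3 : Continuous (deriv φ) := h1.continuous_deriv (by simp)
      simp only [sub_mul]
      rw [integral_sub (hI _ _ hu h3 h2.deriv) (hI _ _ hc.locallyIntegrable h3 h2.deriv),
        hw φ h1 h2, integral_primitive_mul_deriv hv h1 h2, sub_self]
  refine ⟨c, ?_⟩
  filter_upwards [h] with x hx
  linarith

/-- Bounded Lipschitz functions vanishing outside `[-R², R²]`, with explicit constants. -/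
structure IsProfile (g : ℝ → ℝ) (B R : ℝ) : Prop where
  abs_le : ∀ x, |g x| ≤ B
  lip : ∀ x y, |g x - g y| ≤ B * |x - y|
  eq_zero : ∀ x, R ^ 2 ≤ |x| → g x = 0
  one_le : 1 ≤ R

/-- Integrating twice, g is a C¹ function whose derivative W is a primitive of g₂. As W vanishes at
-b with b = |L| + 1, its supremum is controlled by the L² norm of g₂ on [-b, b]. Since b ≥ 1,
vanishing for |x| ≥ b implies vanishing for |x| ≥ b². -/
theorem MemH2NormLE.isProfile {g : ℝ → ℝ} {L M : ℝ} (hc : Continuous g) (hg : MemH2NormLE g M)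
    (hL : tsupport g ⊆ Icc (-L) L) :
    IsProfile g ((1 + 2 * (|L| + 1)) * ((|L| + 1) + M ^ 2 / 2)) (|L| + 1) := by
  obtain ⟨g₁, g₂, h01, h12, -, -, hm2, hM⟩ := hg
  obtain ⟨c₁, hc₁⟩ := h12.exists_ae_eq_primitive
  obtain ⟨c₀, hc₀⟩ := h01.exists_ae_eq_primitive
  set b := |L| + 1 with hb
  have hb1 : 1 ≤ b := by have := abs_nonneg L; linarith
  have hvi : ∀ x y : ℝ, IntervalIntegrable g₂ volume x y := fun x y =>
    intervalIntegrable_iff.mpr <|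
      (h12.2.1.integrableOn_isCompact isCompact_uIcc).mono_set uIoc_subset_uIcc
  set W : ℝ → ℝ := fun x => c₁ + ∫ t in (0 : ℝ)..x, g₂ t with hW
  have hWc : Continuous W := continuous_const.add (intervalIntegral.continuous_primitive hvi 0)
  have hWi : Continuous fun x => c₀ + ∫ t in (0 : ℝ)..x, W t :=
    continuous_const.add (intervalIntegral.continuous_primitive
      (fun x y => hWc.intervalIntegrable x y) 0)
  -- Both sides are continuous, so the almost everywhere identity holds at every point.
  have hgW : g = fun x => c₀ + ∫ t in (0 : ℝ)..x, W t := by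
    refine (Continuous.ae_eq_iff_eq volume hc hWi).1 ?_
    filter_upwards [hc₀] with x hx
    rw [hx]
    congr 1
    exact intervalIntegral.integral_congr_ae (by filter_upwards [hc₁] with t ht _ using ht)
  have hd : ∀ x, HasDerivAt g (W x) x := fun x => by
    rw [hgW]
    exact (intervalIntegral.integral_hasDerivAt_right (hWc.intervalIntegrable _ _)
      hWc.aestronglyMeasurable.stronglyMeasurableAtFilter hWc.continuousAt).const_add _
  have hz : ∀ x, b ≤ |x| → g x = 0 ∧ W x = 0 := by
    intro x hx
    have h1 : x ∉ tsupport g := fun h => by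
      have h2 := hL h
      have h3 := abs_le.2 h2
      have := le_abs_self L
      linarith
    refine ⟨image_eq_zero_of_notMem_tsupport h1, ?_⟩
    rw [← (hd x).deriv]
    exact image_eq_zero_of_notMem_tsupport fun h => h1 (tsupport_deriv_subset h)
  have hi2 : Integrable fun x => g₂ x ^ 2 := hm2.integrable_sq
  have hM2 : ∫ x, g₂ x ^ 2 ≤ M ^ 2 := by
    have h1 : 0 ≤ ∫ x, g x ^ 2 := integral_nonneg fun x => sq_nonneg _
    have h2 : 0 ≤ ∫ x, g₁ x ^ 2 := integral_nonneg fun x => sq_nonneg _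
    have h3 : 0 ≤ M := (Real.sqrt_nonneg _).trans hM
    have := (Real.sqrt_le_left h3).1 hM
    linarith
  have hWb : ∀ x, |W x| ≤ b + M ^ 2 / 2 := by
    intro x
    rcases le_or_gt b |x| with h | h
    · rw [(hz x h).2, abs_zero]; positivity
    · have hx := abs_lt.1 h
      have h1 : W x = ∫ t in (-b)..x, g₂ t := by
        have h2 : W (-b) = 0 := (hz (-b) (by rw [abs_neg]; exact le_abs_self b)).2
        rw [← sub_zero (W x), ← h2, hW]
        simp only [add_sub_add_left_eq_sub]
        rw [intervalIntegral.integral_interval_sub_left (hvi _ _) (hvi _ _)]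
      -- The inequality |y| ≤ (1 + y²)/2 replaces Cauchy-Schwarz and yields the bound b + M²/2
      -- without square roots.
      have h4 : IntervalIntegrable (fun t => (1 + g₂ t ^ 2) / 2) volume (-b) x :=
        ((intervalIntegrable_const (c := (1 : ℝ))).add hi2.intervalIntegrable).div_const 2
      have h5 : |∫ t in (-b)..x, g₂ t| ≤ ∫ t in (-b)..x, (1 + g₂ t ^ 2) / 2 := by
        rw [← Real.norm_eq_abs]
        refine intervalIntegral.norm_integral_le_of_norm_le hx.1.le
          (Eventually.of_forall fun t _ => ?_) h4
        rw [Real.norm_eq_abs]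
        nlinarith [sq_nonneg (|g₂ t| - 1), sq_abs (g₂ t)]
      rw [h1]
      refine h5.trans ?_
      rw [intervalIntegral.integral_div, intervalIntegral.integral_add
        (intervalIntegrable_const (c := (1 : ℝ))) hi2.intervalIntegrable]
      have h6 : ∫ t in (-b)..x, g₂ t ^ 2 ≤ ∫ t, g₂ t ^ 2 := by
        rw [intervalIntegral.integral_of_le hx.1.le]
        exact setIntegral_le_integral hi2 (Eventually.of_forall fun t => sq_nonneg _)
      simp only [intervalIntegral.integral_const, smul_eq_mul, mul_one]
      linarith
  set K := b + M ^ 2 / 2 with hK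
  have hK0 : 0 ≤ K := by positivity
  have hlip : ∀ x y, |g x - g y| ≤ K * |x - y| := fun x y =>
    Convex.norm_image_sub_le_of_norm_hasDerivWithin_le (𝕜 := ℝ)
      (s := univ) (f := g) (f' := W) (x := y) (y := x) (C := K)
      (fun x _ => (hd x).hasDerivWithinAt) (fun x _ => hWb x) convex_univ trivial trivial
  -- The Lipschitz constant K serves for the slope and 2bK for the size, because g(b) = 0; the
  -- constant (1 + 2b)K covers both.
  refine ⟨fun x => ?_, fun x y => (hlip x y).trans ?_, fun x hx => (hz x ?_).1, hb1⟩
  · rcases le_or_gt b |x| with h | h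
    · rw [(hz x h).1, abs_zero]; positivity
    · have h2 := hlip x b
      rw [(hz b (le_abs_self b)).1, sub_zero] at h2
      have hx := abs_lt.1 h
      have h3 : |x - b| ≤ 2 * b := abs_le.2 ⟨by linarith, by linarith⟩
      nlinarith [mul_le_mul_of_nonneg_left h3 hK0]
  · refine mul_le_mul_of_nonneg_right ?_ (abs_nonneg _)
    nlinarith
  · nlinarith

/-! ### The angular variable x = 2 cos θ. -/

noncomputable section

/-- Lebesgue measure on `(0, π)`, the range of the angle `θ` in `x = 2 cos θ`. -/
def angleMeasure : Measure ℝ := volume.restrict (Ioo 0 Real.pi)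

instance : IsFiniteMeasure angleMeasure := by
  unfold angleMeasure; infer_instance

theorem angleMeasure_ae {p : ℝ → Prop} (h : ∀ θ ∈ Ioo 0 Real.pi, p θ) : ∀ᵐ θ ∂angleMeasure, p θ :=
  (ae_restrict_iff' measurableSet_Ioo).2 (Eventually.of_forall h)

theorem integral_angleMeasure_congr {F G : ℝ → ℝ} (h : ∀ θ ∈ Ioo 0 Real.pi, F θ = G θ) :
    ∫ θ, F θ ∂angleMeasure = ∫ θ, G θ ∂angleMeasure :=
  integral_congr_ae (angleMeasure_ae h)

theorem integral_angleMeasure (F : ℝ → ℝ) :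
    ∫ θ, F θ ∂angleMeasure = ∫ θ in (0 : ℝ)..Real.pi, F θ := by
  rw [intervalIntegral.integral_of_le Real.pi_pos.le, integral_Ioc_eq_integral_Ioo, angleMeasure]

/-- The substitution `x = 2 cos θ`. -/
theorem integral_two_mul_cos (G : ℝ → ℝ) :
    ∫ x in (-2 : ℝ)..2, G x = ∫ θ, 2 * Real.sin θ * G (2 * Real.cos θ) ∂angleMeasure := by
  have himg : (fun θ => 2 * Real.cos θ) '' Ioo 0 Real.pi = Ioo (-2) 2 := by
    ext x
    constructor
    · rintro ⟨θ, hθ, rfl⟩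
      have h1 := Real.cos_lt_cos_of_nonneg_of_le_pi le_rfl hθ.2.le hθ.1
      have h2 := Real.cos_lt_cos_of_nonneg_of_le_pi hθ.1.le le_rfl hθ.2
      rw [Real.cos_zero] at h1
      rw [Real.cos_pi] at h2
      constructor <;> simp only <;> linarith
    · rintro ⟨h1, h2⟩
      refine ⟨Real.arccos (x / 2), ⟨Real.arccos_pos.2 (by linarith), ?_⟩, ?_⟩
      · exact lt_of_le_of_ne (Real.arccos_le_pi _) fun h => by
          rw [Real.arccos_eq_pi] at h; linarith
      · simp only
        rw [Real.cos_arccos (by linarith) (by linarith)]; ring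
  have hinj : InjOn (fun θ => 2 * Real.cos θ) (Ioo 0 Real.pi) := fun a ha b hb hab =>
    Real.injOn_cos ⟨ha.1.le, ha.2.le⟩ ⟨hb.1.le, hb.2.le⟩ (by simpa using hab)
  have hd : ∀ θ ∈ Ioo 0 Real.pi, HasDerivWithinAt (fun θ => 2 * Real.cos θ)
      (2 * -Real.sin θ) (Ioo 0 Real.pi) θ := fun θ _ =>
    ((Real.hasDerivAt_cos θ).const_mul 2).hasDerivWithinAt
  rw [intervalIntegral.integral_of_le (by norm_num), integral_Ioc_eq_integral_Ioo, ← himg,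
    integral_image_eq_integral_abs_deriv_smul measurableSet_Ioo hd hinj]
  refine integral_angleMeasure_congr fun θ hθ => ?_
  have := Real.sin_pos_of_mem_Ioo hθ
  rw [mul_neg, abs_neg, abs_of_pos (by positivity), smul_eq_mul]

theorem sqrt_four_sub_two_mul_cos_sq {θ : ℝ} (hθ : θ ∈ Icc 0 Real.pi) :
    Real.sqrt (4 - (2 * Real.cos θ) ^ 2) = 2 * Real.sin θ := by
  rw [show 4 - (2 * Real.cos θ) ^ 2 = (2 * Real.sin θ) ^ 2 by
    rw [mul_pow, mul_pow, Real.sin_sq]; ring,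
    Real.sqrt_sq (mul_nonneg zero_le_two (Real.sin_nonneg_of_mem_Icc hθ))]

theorem sqrt_mul_four_sub_two_mul_cos_sq {θ φ : ℝ} (hθ : θ ∈ Icc 0 Real.pi)
    (hφ : φ ∈ Icc 0 Real.pi) :
    Real.sqrt ((4 - (2 * Real.cos θ) ^ 2) * (4 - (2 * Real.cos φ) ^ 2)) =
      4 * (Real.sin θ * Real.sin φ) := by
  rw [Real.sqrt_mul' , sqrt_four_sub_two_mul_cos_sq hθ, sqrt_four_sub_two_mul_cos_sq hφ]
  · ring
  · nlinarith [Real.cos_sq_le_one φ]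

/-! ### The kernels, and the functionals in angular form. -/

/-- The denominator `|1 - σ e^{it}|²`. -/
def dker (σ t : ℝ) : ℝ := 1 + σ ^ 2 - 2 * σ * Real.cos t

/-- The derivative of `log (dker σ t)` in `t`. -/
def logDerivKer (σ t : ℝ) : ℝ := 2 * σ * Real.sin t / dker σ t

/-- The second derivative of `log (dker σ t)` in `t`. -/
def logDerivKer' (σ t : ℝ) : ℝ :=
  (2 * σ * (1 + σ ^ 2) * Real.cos t - 4 * σ ^ 2) / dker σ t ^ 2

/-- The Poisson kernel. -/
def poissonKer (σ t : ℝ) : ℝ := (1 - σ ^ 2) / dker σ t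

/-- The kernel of the second tracial variance in angular coordinates. -/
def trKer (σ θ φ : ℝ) : ℝ := logDerivKer' σ (θ + φ) + logDerivKer' σ (θ - φ)

/-- The kernel of the second diagonal variance in angular coordinates. -/
def dgKer (σ θ φ : ℝ) : ℝ :=
  16 * (1 - σ ^ 2) * (Real.sin θ ^ 2 * Real.sin φ ^ 2) / (dker σ (θ + φ) * dker σ (θ - φ))

theorem dker_ge (σ t : ℝ) : (1 - |σ|) ^ 2 ≤ dker σ t := by
  have h1 := Real.abs_cos_le_one t
  have h2 : σ * Real.cos t ≤ |σ| * 1 := by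
    rw [← abs_of_nonneg (abs_nonneg σ)]
    refine (le_abs_self _).trans ?_
    rw [abs_mul, abs_abs]
    exact mul_le_mul_of_nonneg_left h1 (abs_nonneg _)
  rw [dker, ← sq_abs σ]
  linarith

theorem dker_pos {σ : ℝ} (hσ : |σ| < 1) (t : ℝ) : 0 < dker σ t :=
  lt_of_lt_of_le (by have : 0 < 1 - |σ| := by linarith
                     positivity) (dker_ge σ t)

theorem hasDerivAt_dker (σ t : ℝ) : HasDerivAt (dker σ) (2 * σ * Real.sin t) t := by
  have := ((Real.hasDerivAt_cos t).const_mul (2 * σ)).const_sub (1 + σ ^ 2)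
  exact this.congr_deriv (by ring)

theorem hasDerivAt_log_dker {σ : ℝ} (hσ : |σ| < 1) (t : ℝ) :
    HasDerivAt (fun t => Real.log (dker σ t)) (logDerivKer σ t) t :=
  (hasDerivAt_dker σ t).log (dker_pos hσ t).ne'

theorem hasDerivAt_logDerivKer {σ : ℝ} (hσ : |σ| < 1) (t : ℝ) :
    HasDerivAt (logDerivKer σ) (logDerivKer' σ t) t := by
  have := ((Real.hasDerivAt_sin t).const_mul (2 * σ)).div (hasDerivAt_dker σ t) (dker_pos hσ t).ne'
  refine this.congr_deriv ?_
  rw [logDerivKer']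
  congr 1
  rw [dker]
  linear_combination (-4 * σ ^ 2) * Real.sin_sq_add_cos_sq t

/-- Numerator and denominator are |2e^{iθ} - 2σe^{∓iφ}|², that is, 4 times `dker` at the sum and at
the difference of the angles. -/
theorem logKernel_two_mul_cos {σ θ φ : ℝ} (hσ : |σ| < 1) (hθ : θ ∈ Icc 0 Real.pi)
    (hφ : φ ∈ Icc 0 Real.pi) :
    logKernel σ (2 * Real.cos θ) (2 * Real.cos φ) =
      Real.log (dker σ (θ + φ)) - Real.log (dker σ (θ - φ)) := by
  rw [logKernel, sqrt_four_sub_two_mul_cos_sq hθ, sqrt_four_sub_two_mul_cos_sq hφ,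
    ← Real.log_div (dker_pos hσ _).ne' (dker_pos hσ _).ne',
    ← mul_div_mul_left (dker σ (θ + φ)) _ (four_ne_zero (α := ℝ))]
  congr 2
  · rw [dker, Real.cos_add]
    linear_combination 4 * Real.sin_sq_add_cos_sq θ + 4 * σ ^ 2 * Real.sin_sq_add_cos_sq φ
  · rw [dker, Real.cos_sub]
    linear_combination 4 * Real.sin_sq_add_cos_sq θ + 4 * σ ^ 2 * Real.sin_sq_add_cos_sq φ

theorem hasDerivAt_arccos_half {θ : ℝ} (hθ : θ ∈ Ioo 0 Real.pi) :
    HasDerivAt (fun x => Real.arccos (x / 2)) (-(1 / (2 * Real.sin θ))) (2 * Real.cos θ) := by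
  have h1 := Real.cos_lt_cos_of_nonneg_of_le_pi le_rfl hθ.2.le hθ.1
  have h2 := Real.cos_lt_cos_of_nonneg_of_le_pi hθ.1.le le_rfl hθ.2
  rw [Real.cos_zero] at h1
  rw [Real.cos_pi] at h2
  have h3 : 2 * Real.cos θ / 2 = Real.cos θ := by ring
  have h4 : HasDerivAt Real.arccos (-(1 / Real.sqrt (1 - (2 * Real.cos θ / 2) ^ 2)))
      (2 * Real.cos θ / 2) :=
    Real.hasDerivAt_arccos (by rw [h3]; linarith) (by rw [h3]; linarith)
  have h5 := h4.comp (2 * Real.cos θ) ((hasDerivAt_id (2 * Real.cos θ)).div_const 2)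
  refine h5.congr_deriv ?_
  rw [h3, ← Real.sin_sq, Real.sqrt_sq (Real.sin_pos_of_mem_Ioo hθ).le]
  have := (Real.sin_pos_of_mem_Ioo hθ).ne'
  field_simp

theorem two_mul_cos_mem {θ : ℝ} (hθ : θ ∈ Ioo 0 Real.pi) : 2 * Real.cos θ ∈ Ioo (-2 : ℝ) 2 := by
  have h1 := Real.cos_lt_cos_of_nonneg_of_le_pi le_rfl hθ.2.le hθ.1
  have h2 := Real.cos_lt_cos_of_nonneg_of_le_pi hθ.1.le le_rfl hθ.2
  rw [Real.cos_zero] at h1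
  rw [Real.cos_pi] at h2
  constructor <;> linarith

theorem two_mul_cos_arccos_half {x : ℝ} (hx : x ∈ Ioo (-2 : ℝ) 2) :
    2 * Real.cos (Real.arccos (x / 2)) = x := by
  rw [Real.cos_arccos (by linarith [hx.1]) (by linarith [hx.2])]; ring

theorem arccos_half_two_mul_cos {θ : ℝ} (hθ : θ ∈ Ioo 0 Real.pi) :
    Real.arccos (2 * Real.cos θ / 2) = θ := by
  rw [show 2 * Real.cos θ / 2 = Real.cos θ by ring, Real.arccos_cos hθ.1.le hθ.2.le]

theorem deriv_logKernel {σ x φ : ℝ} (hσ : |σ| < 1) (hx : x ∈ Ioo (-2 : ℝ) 2)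
    (hφ : φ ∈ Ioo 0 Real.pi) :
    deriv (fun t => logKernel σ x t) (2 * Real.cos φ) =
      -(1 / (2 * Real.sin φ)) * (logDerivKer σ (Real.arccos (x / 2) + φ) +
        logDerivKer σ (Real.arccos (x / 2) - φ)) := by
  set a := Real.arccos (x / 2)
  have h1 : (fun t => logKernel σ x t) =ᶠ[𝓝 (2 * Real.cos φ)] fun t =>
      Real.log (dker σ (a + Real.arccos (t / 2))) - Real.log (dker σ (a - Real.arccos (t / 2))) := by
    filter_upwards [isOpen_Ioo.mem_nhds (two_mul_cos_mem hφ)] with t ht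
    rw [← logKernel_two_mul_cos hσ ⟨Real.arccos_nonneg _, Real.arccos_le_pi _⟩
      ⟨Real.arccos_nonneg _, Real.arccos_le_pi _⟩, two_mul_cos_arccos_half hx,
      two_mul_cos_arccos_half ht]
  have h2 := hasDerivAt_arccos_half hφ
  have h3 := (hasDerivAt_log_dker hσ (a + Real.arccos (2 * Real.cos φ / 2))).comp
    (2 * Real.cos φ) (h2.const_add a)
  have h4 := (hasDerivAt_log_dker hσ (a - Real.arccos (2 * Real.cos φ / 2))).comp
    (2 * Real.cos φ) (h2.const_sub a)
  have h5 := (h3.sub h4).congr_of_eventuallyEq h1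
  rw [h5.deriv, arccos_half_two_mul_cos hφ]
  ring

/-- The kernel is a function of θ ± φ, so both derivatives fall on `dker`. The two arccos factors
1/(2 sin) cancel against the Jacobian in `Vtr2Formula_eq`. -/
theorem deriv_deriv_logKernel {σ θ φ : ℝ} (hσ : |σ| < 1) (hθ : θ ∈ Ioo 0 Real.pi)
    (hφ : φ ∈ Ioo 0 Real.pi) :
    deriv (fun s => deriv (fun t => logKernel σ s t) (2 * Real.cos φ)) (2 * Real.cos θ) =
      1 / (2 * Real.sin θ) * (1 / (2 * Real.sin φ)) * trKer σ θ φ := by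
  have h1 : (fun s => deriv (fun t => logKernel σ s t) (2 * Real.cos φ)) =ᶠ[𝓝 (2 * Real.cos θ)]
      fun s => -(1 / (2 * Real.sin φ)) * (logDerivKer σ (Real.arccos (s / 2) + φ) +
        logDerivKer σ (Real.arccos (s / 2) - φ)) := by
    filter_upwards [isOpen_Ioo.mem_nhds (two_mul_cos_mem hθ)] with s hs
    exact deriv_logKernel hσ hs hφ
  have h2 := hasDerivAt_arccos_half hθ
  have h3 := (hasDerivAt_logDerivKer hσ (Real.arccos (2 * Real.cos θ / 2) + φ)).comp
    (2 * Real.cos θ) (h2.add_const φ)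
  have h4 := (hasDerivAt_logDerivKer hσ (Real.arccos (2 * Real.cos θ / 2) - φ)).comp
    (2 * Real.cos θ) (h2.sub_const φ)
  have h5 := ((h3.add h4).const_mul (-(1 / (2 * Real.sin φ)))).congr_of_eventuallyEq h1
  rw [h5.deriv, arccos_half_two_mul_cos hθ, trKer]
  ring

theorem Vtr2Formula_eq {σ : ℝ} (hσ : |σ| < 1) (f : ℝ → ℝ) :
    Vtr2Formula f σ = 1 / (4 * Real.pi ^ 2) * ∫ θ, ∫ φ,
      f (2 * Real.cos θ) * f (2 * Real.cos φ) * trKer σ θ φ ∂angleMeasure ∂angleMeasure := by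
  rw [Vtr2Formula, integral_two_mul_cos]
  congr 1
  refine integral_angleMeasure_congr fun θ hθ => ?_
  rw [integral_two_mul_cos, ← integral_const_mul]
  refine integral_angleMeasure_congr fun φ hφ => ?_
  rw [deriv_deriv_logKernel hσ hθ hφ]
  have h1 := (Real.sin_pos_of_mem_Ioo hθ).ne'
  have h2 := (Real.sin_pos_of_mem_Ioo hφ).ne'
  field_simp

theorem meanSc_eq (f : ℝ → ℝ) :
    meanSc f = 2 / Real.pi * ∫ θ, f (2 * Real.cos θ) * Real.sin θ ^ 2 ∂angleMeasure := by
  rw [meanSc, integral_two_mul_cos, ← integral_const_mul]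
  refine integral_angleMeasure_congr fun θ hθ => ?_
  rw [rhoSc, sqrt_four_sub_two_mul_cos_sq ⟨hθ.1.le, hθ.2.le⟩]
  field_simp

theorem meanInvSc_eq (f : ℝ → ℝ) :
    meanInvSc f = 1 / Real.pi * ∫ θ, f (2 * Real.cos θ) ∂angleMeasure := by
  rw [meanInvSc, integral_two_mul_cos, ← integral_const_mul]
  refine integral_angleMeasure_congr fun θ hθ => ?_
  rw [sqrt_four_sub_two_mul_cos_sq ⟨hθ.1.le, hθ.2.le⟩]
  have h1 := (Real.sin_pos_of_mem_Ioo hθ).ne'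
  field_simp

theorem dker_mul_dker (σ θ φ : ℝ) : dker σ (θ + φ) * dker σ (θ - φ) =
    σ ^ 2 * ((2 * Real.cos θ) ^ 2 + (2 * Real.cos φ) ^ 2) + (1 - σ ^ 2) ^ 2 -
      2 * Real.cos θ * (2 * Real.cos φ) * σ * (1 + σ ^ 2) := by
  rw [dker, dker, Real.cos_add, Real.cos_sub]
  linear_combination 4 * σ ^ 2 * (Real.cos φ ^ 2 - 1) * Real.sin_sq_add_cos_sq θ
    - 4 * σ ^ 2 * Real.sin θ ^ 2 * Real.sin_sq_add_cos_sq φ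

theorem Vd2Formula_eq (f : ℝ → ℝ) (σ : ℝ) :
    Vd2Formula f σ = 1 / (4 * Real.pi ^ 2) * (∫ θ, ∫ φ,
      f (2 * Real.cos θ) * f (2 * Real.cos φ) * dgKer σ θ φ ∂angleMeasure ∂angleMeasure)
      - meanSc f ^ 2 := by
  rw [Vd2Formula, integral_two_mul_cos]
  congr 2
  refine integral_angleMeasure_congr fun θ hθ => ?_
  rw [integral_two_mul_cos, ← integral_const_mul]
  refine integral_angleMeasure_congr fun φ hφ => ?_
  rw [sqrt_mul_four_sub_two_mul_cos_sq ⟨hθ.1.le, hθ.2.le⟩ ⟨hφ.1.le, hφ.2.le⟩, ← dker_mul_dker,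
    dgKer]
  ring

/-- With x = 2 cos θ the denominator (1 + σ)² - σx² equals 1 + σ² - 2σ cos 2θ. -/
theorem EtrFormula_eq (f : ℝ → ℝ) (σ : ℝ) :
    EtrFormula f σ = 1 / Real.pi * ∫ θ, f (2 * Real.cos θ) * (1 - poissonKer σ (2 * θ))
      ∂angleMeasure := by
  rw [EtrFormula, meanInvSc_eq]
  congr 1
  refine integral_angleMeasure_congr fun θ hθ => ?_
  rw [poissonKer, dker, Real.cos_two_mul]
  congr 3
  ring

theorem Vtr1_eq (f : ℝ → ℝ) :
    Vtr1 f = 1 / (4 * Real.pi ^ 2) * ∫ θ, ∫ φ,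
      (f (2 * Real.cos θ) - f (2 * Real.cos φ)) ^ 2 * ((1 - Real.cos θ * Real.cos φ) /
        (Real.cos θ - Real.cos φ) ^ 2) ∂angleMeasure ∂angleMeasure := by
  rw [Vtr1, integral_two_mul_cos]
  congr 1
  refine integral_angleMeasure_congr fun θ hθ => ?_
  rw [integral_two_mul_cos, ← integral_const_mul]
  refine integral_angleMeasure_congr fun φ hφ => ?_
  rw [sqrt_mul_four_sub_two_mul_cos_sq ⟨hθ.1.le, hθ.2.le⟩ ⟨hφ.1.le, hφ.2.le⟩]
  have h1 := (Real.sin_pos_of_mem_Ioo hθ).ne'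
  have h2 := (Real.sin_pos_of_mem_Ioo hφ).ne'
  rw [div_pow, ← mul_sub, mul_pow]
  by_cases h : Real.cos θ - Real.cos φ = 0
  · simp [h]
  · field_simp
    ring


/-! ### Symmetries, continuity and total masses of the kernels. -/

theorem dker_add_two_pi (σ t : ℝ) : dker σ (t + 2 * Real.pi) = dker σ t := by
  rw [dker, dker, Real.cos_add_two_pi]

theorem dker_add_pi_eq_sub_pi (σ θ : ℝ) : dker σ (θ + Real.pi) = dker σ (θ - Real.pi) := by
  rw [dker, dker, Real.cos_add_pi, Real.cos_sub_pi]

theorem dker_neg_arg (σ t : ℝ) : dker σ (-t) = dker σ t := by rw [dker, dker, Real.cos_neg]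

theorem logDerivKer'_neg_arg (σ t : ℝ) : logDerivKer' σ (-t) = logDerivKer' σ t := by
  rw [logDerivKer', logDerivKer', dker_neg_arg, Real.cos_neg]

theorem trKer_comm (σ θ φ : ℝ) : trKer σ θ φ = trKer σ φ θ := by
  rw [trKer, trKer, add_comm θ φ, ← logDerivKer'_neg_arg σ (θ - φ), neg_sub]

theorem dgKer_comm (σ θ φ : ℝ) : dgKer σ θ φ = dgKer σ φ θ := by
  rw [dgKer, dgKer, add_comm θ φ, ← dker_neg_arg σ (θ - φ), neg_sub,
    mul_comm (Real.sin θ ^ 2)]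

theorem continuous_dker (σ : ℝ) : Continuous (dker σ) := by unfold dker; fun_prop

theorem continuous_logDerivKer' {σ : ℝ} (hσ : |σ| < 1) : Continuous (logDerivKer' σ) := by
  unfold logDerivKer'
  have := continuous_dker σ
  exact Continuous.div (by fun_prop) (by fun_prop) fun t => (pow_pos (dker_pos hσ t) 2).ne'

theorem continuous_trKer {σ : ℝ} (hσ : |σ| < 1) :
    Continuous fun p : ℝ × ℝ => trKer σ p.1 p.2 := by
  have := continuous_logDerivKer' hσ
  unfold trKer
  fun_prop

theorem continuous_dgKer {σ : ℝ} (hσ : |σ| < 1) :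
    Continuous fun p : ℝ × ℝ => dgKer σ p.1 p.2 := by
  have := continuous_dker σ
  unfold dgKer
  exact Continuous.div (by fun_prop) (by fun_prop) fun p =>
    (mul_pos (dker_pos hσ _) (dker_pos hσ _)).ne'

theorem continuous_poissonKer {σ : ℝ} (hσ : |σ| < 1) : Continuous (poissonKer σ) := by
  have := continuous_dker σ
  unfold poissonKer
  exact Continuous.div (by fun_prop) (by fun_prop) fun p => (dker_pos hσ _).ne'

/-- In φ the kernel is the derivative of `logDerivKer σ (θ + φ) - logDerivKer σ (θ - φ)`, which
vanishes at 0 trivially and at π by periodicity. -/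
theorem integral_trKer {σ : ℝ} (hσ : |σ| < 1) (θ : ℝ) :
    ∫ φ, trKer σ θ φ ∂angleMeasure = 0 := by
  rw [integral_angleMeasure, intervalIntegral.integral_eq_sub_of_hasDerivAt
    (f := fun φ => logDerivKer σ (θ + φ) - logDerivKer σ (θ - φ))]
  · simp only [logDerivKer, dker_add_pi_eq_sub_pi, Real.sin_add_pi, Real.sin_sub_pi]
    simp
  · intro φ _
    have h1 := (hasDerivAt_logDerivKer hσ (θ + φ)).comp φ ((hasDerivAt_id φ).const_add θ)
    have h2 := (hasDerivAt_logDerivKer hσ (θ - φ)).comp φ ((hasDerivAt_id φ).const_sub θ)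
    refine (h1.sub h2).congr_deriv ?_
    rw [trKer]; ring
  · exact ((continuous_trKer hσ).comp (by fun_prop : Continuous fun φ : ℝ => (θ, φ))).intervalIntegrable
      _ _

/-- A primitive of the Poisson kernel. -/
def poissonPrim (σ t : ℝ) : ℝ := t + 2 * Real.arctan (σ * Real.sin t / (1 - σ * Real.cos t))

theorem one_sub_mul_cos_pos {σ : ℝ} (hσ : |σ| < 1) (t : ℝ) : 0 < 1 - σ * Real.cos t := by
  have h1 := Real.abs_cos_le_one t
  have h2 : |σ * Real.cos t| < 1 := by
    rw [abs_mul]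
    exact lt_of_le_of_lt (mul_le_of_le_one_right (abs_nonneg _) h1) hσ
  linarith [le_abs_self (σ * Real.cos t)]

theorem hasDerivAt_poissonPrim {σ : ℝ} (hσ : |σ| < 1) (t : ℝ) :
    HasDerivAt (poissonPrim σ) (poissonKer σ t) t := by
  have h0 := (one_sub_mul_cos_pos hσ t).ne'
  have h1 := ((Real.hasDerivAt_sin t).const_mul σ).div
    (((Real.hasDerivAt_cos t).const_mul σ).const_sub 1) h0
  have h2 := (hasDerivAt_id t).add (h1.arctan.const_mul 2)
  refine h2.congr_deriv ?_
  have h3 := (dker_pos hσ t).ne'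
  have h4 : 1 + (σ * Real.sin t / (1 - σ * Real.cos t)) ^ 2 =
      dker σ t / (1 - σ * Real.cos t) ^ 2 := by
    rw [div_pow, eq_div_iff (pow_ne_zero 2 h0), add_mul, div_mul_cancel₀ _ (pow_ne_zero 2 h0), dker]
    linear_combination σ ^ 2 * Real.sin_sq_add_cos_sq t
  simp only [Pi.div_apply]
  rw [h4, poissonKer]
  field_simp
  rw [dker]
  linear_combination (-2 * σ ^ 2) * Real.sin_sq_add_cos_sq t

theorem integral_poissonKer {σ : ℝ} (hσ : |σ| < 1) :
    ∫ θ, poissonKer σ (2 * θ) ∂angleMeasure = Real.pi := by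
  rw [integral_angleMeasure, intervalIntegral.integral_eq_sub_of_hasDerivAt
    (f := fun θ => poissonPrim σ (2 * θ) / 2)]
  · simp [poissonPrim]
  · intro θ _
    refine (((hasDerivAt_poissonPrim hσ (2 * θ)).comp θ
      ((hasDerivAt_id θ).const_mul 2)).div_const 2).congr_deriv ?_
    ring
  · have := continuous_poissonKer hσ
    exact Continuous.intervalIntegrable (by fun_prop) _ _

theorem integral_cos_mul_poissonKer (σ : ℝ) :
    ∫ θ, Real.cos θ * poissonKer σ (2 * θ) ∂angleMeasure = 0 := by
  have h := intervalIntegral.integral_comp_sub_left (a := 0) (b := Real.pi)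
    (fun θ => Real.cos θ * poissonKer σ (2 * θ)) Real.pi
  have h2 : ∀ θ, Real.cos (Real.pi - θ) * poissonKer σ (2 * (Real.pi - θ)) =
      -(Real.cos θ * poissonKer σ (2 * θ)) := fun θ => by
    have : dker σ (2 * (Real.pi - θ)) = dker σ (2 * θ) := by
      rw [show 2 * (Real.pi - θ) = -(2 * θ) + 2 * Real.pi by ring, dker_add_two_pi, dker_neg_arg]
    rw [poissonKer, this, Real.cos_pi_sub, poissonKer]
    ring
  simp only [h2, intervalIntegral.integral_neg, sub_self, sub_zero] at h
  rw [integral_angleMeasure]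
  linarith

theorem integral_sin_sq_angleMeasure : ∫ θ, Real.sin θ ^ 2 ∂angleMeasure = Real.pi / 2 := by
  rw [integral_angleMeasure, integral_sin_sq]
  simp

/-- Only the linear part t of the Poisson primitive grows over the period from θ - π to θ + π; the
arctangent and logarithm contributions cancel. The mass is therefore independent of σ. -/
theorem integral_dgKer {σ : ℝ} (hσ : |σ| < 1) (θ : ℝ) :
    ∫ φ, dgKer σ θ φ ∂angleMeasure = 8 * Real.pi * Real.sin θ ^ 2 := by
  rcases eq_or_ne σ 0 with rfl | h0
  · have : ∀ φ, dgKer 0 θ φ = 16 * Real.sin θ ^ 2 * Real.sin φ ^ 2 := fun φ => by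
      simp [dgKer, dker]; ring
    simp only [this, integral_const_mul, integral_sin_sq_angleMeasure]
    ring
  -- Z is a primitive of (4/σ) sin θ sin(θ - t) times the Poisson kernel, from cos t · P = ((1 +
  -- σ²)P - (1 - σ²))/(2σ) and sin t · P = (1 - σ²)/(2σ) · (log D)'. The division by σ is why σ = 0
  -- is separate.
  · let Z : ℝ → ℝ := fun t => 4 / σ * Real.sin θ *
      (Real.sin θ * (((1 + σ ^ 2) * poissonPrim σ t - (1 - σ ^ 2) * t) / (2 * σ)) -
        Real.cos θ * ((1 - σ ^ 2) / (2 * σ) * Real.log (dker σ t)))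
    have hZ : ∀ t, HasDerivAt Z (4 / σ * Real.sin θ * (Real.sin θ * (Real.cos t * poissonKer σ t) -
        Real.cos θ * (Real.sin t * poissonKer σ t))) t := fun t => by
      have h1 := (((((hasDerivAt_poissonPrim hσ t).const_mul (1 + σ ^ 2)).sub
        ((hasDerivAt_id t).const_mul (1 - σ ^ 2))).div_const (2 * σ)).const_mul (Real.sin θ))
      have h2 := ((hasDerivAt_log_dker hσ t).const_mul ((1 - σ ^ 2) / (2 * σ))).const_mul
        (Real.cos θ)
      refine ((h1.sub h2).const_mul (4 / σ * Real.sin θ)).congr_deriv ?_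
      have h3 := (dker_pos hσ t).ne'
      have h4 : ((1 + σ ^ 2) * poissonKer σ t - (1 - σ ^ 2) * 1) / (2 * σ) =
          Real.cos t * poissonKer σ t := by
        rw [poissonKer]; field_simp; rw [dker]; ring
      rw [h4, logDerivKer, poissonKer]
      field_simp
    -- Partial fractions, using D(θ+φ) - D(θ-φ) = 4σ sin θ sin φ.
    have hk : ∀ φ, dgKer σ θ φ = 4 / σ * Real.sin θ * Real.sin φ *
        (poissonKer σ (θ - φ) - poissonKer σ (θ + φ)) := fun φ => by
      have h3 := (dker_pos hσ (θ + φ)).ne'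
      have h4 := (dker_pos hσ (θ - φ)).ne'
      have h5 : dker σ (θ + φ) - dker σ (θ - φ) = 4 * σ * (Real.sin θ * Real.sin φ) := by
        rw [dker, dker, Real.cos_add, Real.cos_sub]; ring
      have h6 : poissonKer σ (θ - φ) - poissonKer σ (θ + φ) = (1 - σ ^ 2) *
          (4 * σ * (Real.sin θ * Real.sin φ)) / (dker σ (θ + φ) * dker σ (θ - φ)) := by
        rw [← h5, poissonKer, poissonKer]; field_simp
      rw [h6, dgKer]
      field_simp
      ring
    have hd : ∀ φ, HasDerivAt (fun φ => Z (θ + φ) - Z (θ - φ)) (dgKer σ θ φ) φ := fun φ => by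
      have h1 := (hZ (θ + φ)).comp φ ((hasDerivAt_id φ).const_add θ)
      have h2 := (hZ (θ - φ)).comp φ ((hasDerivAt_id φ).const_sub θ)
      refine (h1.sub h2).congr_deriv ?_
      rw [hk, Real.cos_add, Real.sin_add, Real.cos_sub, Real.sin_sub]
      linear_combination (-(4 / σ * Real.sin θ * Real.sin φ *
        (poissonKer σ (θ - φ) - poissonKer σ (θ + φ)))) * -Real.sin_sq_add_cos_sq θ
    rw [integral_angleMeasure, intervalIntegral.integral_eq_sub_of_hasDerivAt (fun φ _ => hd φ)
      (((continuous_dgKer hσ).comp (by fun_prop : Continuous fun φ : ℝ => (θ, φ))).intervalIntegrable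
        _ _)]
    simp only [Z, poissonPrim, dker_add_pi_eq_sub_pi, Real.sin_add_pi, Real.sin_sub_pi,
      Real.cos_add_pi, Real.cos_sub_pi, add_zero, sub_zero, sub_self]
    field_simp
    ring

/-! ### Polarization, and limits of bilinear forms with diagonal singularities. -/

theorem integrable_angleMeasure_prod {G : ℝ × ℝ → ℝ} (h : Continuous G) :
    Integrable G (angleMeasure.prod angleMeasure) := by
  rw [angleMeasure, Measure.prod_restrict]
  exact (h.continuousOn.integrableOn_compact (isCompact_Icc.prod isCompact_Icc)).mono_set
    (prod_mono Ioo_subset_Icc_self Ioo_subset_Icc_self)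

theorem integrable_angleMeasure {G : ℝ → ℝ} (h : Continuous G) : Integrable G angleMeasure := by
  rw [angleMeasure]
  exact (h.continuousOn.integrableOn_compact isCompact_Icc).mono_set Ioo_subset_Icc_self

/-- Polarization of a bilinear form with symmetric kernel. -/
theorem integral_bilinear_eq {k : ℝ → ℝ → ℝ} {w F H : ℝ → ℝ}
    (hk : Continuous fun p : ℝ × ℝ => k p.1 p.2) (hs : ∀ θ φ, k θ φ = k φ θ)
    (hw : ∀ θ, ∫ φ, k θ φ ∂angleMeasure = w θ) (hF : Continuous F) (hH : Continuous H) :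
    ∫ θ, ∫ φ, F θ * H φ * k θ φ ∂angleMeasure ∂angleMeasure =
      ∫ θ, F θ * H θ * w θ ∂angleMeasure -
        1 / 2 * ∫ θ, ∫ φ, (F θ - F φ) * (H θ - H φ) * k θ φ ∂angleMeasure ∂angleMeasure := by
  have hi : ∀ G : ℝ × ℝ → ℝ, Continuous G → Integrable G (angleMeasure.prod angleMeasure) :=
    fun G => integrable_angleMeasure_prod
  have h1 := hi (fun p => F p.1 * H p.2 * k p.1 p.2) (by fun_prop)
  have h2 := hi (fun p => F p.2 * H p.1 * k p.1 p.2) (by fun_prop)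
  have h3 := hi (fun p => F p.1 * H p.1 * k p.1 p.2) (by fun_prop)
  have h4 := hi (fun p => F p.2 * H p.2 * k p.1 p.2) (by fun_prop)
  have h5 := hi (fun p => (F p.1 - F p.2) * (H p.1 - H p.2) * k p.1 p.2) (by fun_prop)
  have e3 : ∫ p, F p.1 * H p.1 * k p.1 p.2 ∂(angleMeasure.prod angleMeasure) =
      ∫ θ, F θ * H θ * w θ ∂angleMeasure := by
    rw [integral_prod _ h3]
    simp only [integral_const_mul, hw]
  have e4 : ∫ p, F p.2 * H p.2 * k p.1 p.2 ∂(angleMeasure.prod angleMeasure) =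
      ∫ θ, F θ * H θ * w θ ∂angleMeasure := by
    rw [← e3, ← integral_prod_swap]
    simp only [Prod.fst_swap, Prod.snd_swap]
    refine integral_congr_ae (Eventually.of_forall fun p => ?_)
    simp only
    rw [hs]
  have e2 : ∫ p, F p.2 * H p.1 * k p.1 p.2 ∂(angleMeasure.prod angleMeasure) =
      ∫ p, F p.1 * H p.2 * k p.1 p.2 ∂(angleMeasure.prod angleMeasure) := by
    rw [← integral_prod_swap]
    simp only [Prod.fst_swap, Prod.snd_swap]
    refine integral_congr_ae (Eventually.of_forall fun p => ?_)
    simp only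
    rw [hs]
  have e5 : ∫ p, (F p.1 - F p.2) * (H p.1 - H p.2) * k p.1 p.2 ∂(angleMeasure.prod angleMeasure) =
      2 * (∫ θ, F θ * H θ * w θ ∂angleMeasure) -
        2 * ∫ p, F p.1 * H p.2 * k p.1 p.2 ∂(angleMeasure.prod angleMeasure) := by
    rw [show (fun p : ℝ × ℝ => (F p.1 - F p.2) * (H p.1 - H p.2) * k p.1 p.2) = fun p =>
      (F p.1 * H p.1 * k p.1 p.2 + F p.2 * H p.2 * k p.1 p.2) -
        (F p.1 * H p.2 * k p.1 p.2 + F p.2 * H p.1 * k p.1 p.2) from funext fun p => by ring,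
      integral_sub (hi _ (by fun_prop)) (hi _ (by fun_prop)), integral_add h3 h4, integral_add h1 h2, e2, e3, e4]
    ring
  rw [← integral_prod (fun p : ℝ × ℝ => F p.1 * H p.2 * k p.1 p.2) h1,
    ← integral_prod (fun p : ℝ × ℝ => (F p.1 - F p.2) * (H p.1 - H p.2) * k p.1 p.2) h5, e5]
  ring

/-- Functions of the angle that are Lipschitz functions of its cosine. -/
def CosLipschitz (F : ℝ → ℝ) (K : ℝ) : Prop :=
  ∀ θ φ, |F θ - F φ| ≤ K * |Real.cos θ - Real.cos φ|

theorem CosLipschitz.continuous {F : ℝ → ℝ} {K : ℝ} (h : CosLipschitz F K) : Continuous F := by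
  refine continuous_iff_continuousAt.2 fun θ => ?_
  rw [ContinuousAt, tendsto_iff_dist_tendsto_zero]
  have h1 : Tendsto (fun φ => K * |Real.cos φ - Real.cos θ|) (𝓝 θ) (𝓝 0) := by
    have : Continuous fun φ => K * |Real.cos φ - Real.cos θ| := by fun_prop
    simpa using this.tendsto θ
  exact squeeze_zero (fun _ => dist_nonneg) (fun φ => h φ θ) h1

theorem CosLipschitz.pi_sub {F : ℝ → ℝ} {K : ℝ} (h : CosLipschitz F K) :
    CosLipschitz (fun θ => F (Real.pi - θ)) K := fun θ φ => by
  have := h (Real.pi - θ) (Real.pi - φ)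
  rw [Real.cos_pi_sub, Real.cos_pi_sub, neg_sub_neg, abs_sub_comm (Real.cos φ)] at this
  exact this

/-- Two difference factors supply exactly the (cos θ - cos φ)² needed to compensate a kernel
singular on the diagonal. -/
theorem CosLipschitz.abs_mul_mul_le {F H : ℝ → ℝ} {K C κ θ φ : ℝ} (hF : CosLipschitz F K)
    (hH : CosLipschitz H K) (hκ : |κ| * (Real.cos θ - Real.cos φ) ^ 2 ≤ C) :
    |(F θ - F φ) * (H θ - H φ) * κ| ≤ K ^ 2 * C := by
  rw [abs_mul, abs_mul]
  calc |F θ - F φ| * |H θ - H φ| * |κ|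
      ≤ (K * |Real.cos θ - Real.cos φ|) * (K * |Real.cos θ - Real.cos φ|) * |κ| :=
        mul_le_mul_of_nonneg_right (mul_le_mul (hF θ φ) (hH θ φ) (abs_nonneg _)
          ((abs_nonneg _).trans (hF θ φ))) (abs_nonneg _)
    _ = K ^ 2 * (|κ| * (Real.cos θ - Real.cos φ) ^ 2) := by
        rw [← sq_abs (Real.cos θ - Real.cos φ)]; ring
    _ ≤ K ^ 2 * C := mul_le_mul_of_nonneg_left hκ (sq_nonneg _)

/-- Convergence of bilinear forms whose kernels are dominated off the diagonal. -/
theorem tendsto_integral_bilinear {k : ℝ → ℝ → ℝ → ℝ} {w F H : ℝ → ℝ} {C K : ℝ}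
    (hF : CosLipschitz F K) (hH : CosLipschitz H K)
    (hk : ∀ τ ∈ Ico (1 / 2 : ℝ) 1, Continuous fun p : ℝ × ℝ => k τ p.1 p.2)
    (hk1 : Measurable fun p : ℝ × ℝ => k 1 p.1 p.2)
    (hs : ∀ τ θ φ, k τ θ φ = k τ φ θ)
    (hw : ∀ τ ∈ Ico (1 / 2 : ℝ) 1, ∀ θ, ∫ φ, k τ θ φ ∂angleMeasure = w θ)
    (hb : ∀ τ ∈ Icc (1 / 2 : ℝ) 1, ∀ θ φ, |k τ θ φ| * (Real.cos θ - Real.cos φ) ^ 2 ≤ C)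
    (hc : ∀ θ φ, Real.cos θ ≠ Real.cos φ → ContinuousAt (fun τ => k τ θ φ) 1) :
    Tendsto (fun τ => ∫ θ, ∫ φ, F θ * H φ * k τ θ φ ∂angleMeasure ∂angleMeasure) (𝓝[<] 1)
      (𝓝 (∫ θ, F θ * H θ * w θ ∂angleMeasure -
        1 / 2 * ∫ θ, ∫ φ, (F θ - F φ) * (H θ - H φ) * k 1 θ φ ∂angleMeasure ∂angleMeasure)) := by
  have hmem : Ico (1 / 2 : ℝ) 1 ∈ 𝓝[<] (1 : ℝ) := Ico_mem_nhdsLT (by norm_num)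
  have hFc := hF.continuous
  have hHc := hH.continuous
  have hle : ∀ τ ∈ Icc (1 / 2 : ℝ) 1, ∀ θ φ,
      ‖(F θ - F φ) * (H θ - H φ) * k τ θ φ‖ ≤ K ^ 2 * C := fun τ hτ θ φ =>
    hF.abs_mul_mul_le hH (hb τ hτ θ φ)
  have hi1 : Integrable (fun p : ℝ × ℝ => (F p.1 - F p.2) * (H p.1 - H p.2) * k 1 p.1 p.2)
      (angleMeasure.prod angleMeasure) := by
    refine Integrable.of_bound (C := K ^ 2 * C) ?_ (Eventually.of_forall fun p =>
      hle 1 ⟨by norm_num, le_rfl⟩ _ _)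
    have : Continuous fun p : ℝ × ℝ => (F p.1 - F p.2) * (H p.1 - H p.2) := by fun_prop
    exact (this.measurable.mul hk1).aestronglyMeasurable
  have key : Tendsto (fun τ => ∫ p, (F p.1 - F p.2) * (H p.1 - H p.2) * k τ p.1 p.2
      ∂(angleMeasure.prod angleMeasure)) (𝓝[<] 1)
      (𝓝 (∫ p, (F p.1 - F p.2) * (H p.1 - H p.2) * k 1 p.1 p.2
        ∂(angleMeasure.prod angleMeasure))) := by
    refine tendsto_integral_filter_of_dominated_convergence (fun _ => K ^ 2 * C) ?_ ?_
      (integrable_const _) (Eventually.of_forall fun p => ?_)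
    · filter_upwards [hmem] with τ hτ
      have := hk τ hτ
      exact Continuous.aestronglyMeasurable (by fun_prop)
    · filter_upwards [hmem] with τ hτ
      exact Eventually.of_forall fun p => hle τ ⟨hτ.1, hτ.2.le⟩ _ _
    -- On the diagonal the kernels need not converge, but there the difference factor vanishes.
    · by_cases h : Real.cos p.1 = Real.cos p.2
      · have h0 : F p.1 - F p.2 = 0 := by
          have := hF p.1 p.2
          rw [h, sub_self, abs_zero, mul_zero] at this
          exact abs_nonpos_iff.1 this
        simp only [h0, zero_mul]
        exact tendsto_const_nhds
      · exact ((hc _ _ h).tendsto.mono_left nhdsWithin_le_nhds).const_mul _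
  rw [← integral_prod (fun p : ℝ × ℝ => (F p.1 - F p.2) * (H p.1 - H p.2) * k 1 p.1 p.2) hi1]
  refine ((key.const_mul (1 / 2)).const_sub (∫ θ, F θ * H θ * w θ ∂angleMeasure)).congr' ?_
  filter_upwards [hmem] with τ hτ
  have hkτ := hk τ hτ
  rw [integral_bilinear_eq hkτ (hs τ) (hw τ hτ) hFc hHc, integral_prod]
  exact integrable_angleMeasure_prod (by fun_prop)


/-! ### Kernel bounds uniform for τ in [1/2, 1]. -/

theorem cos_sub_cos_sq (θ φ : ℝ) : (Real.cos θ - Real.cos φ) ^ 2 =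
    (1 - Real.cos (θ + φ)) * (1 - Real.cos (θ - φ)) := by
  rw [Real.cos_add, Real.cos_sub]
  linear_combination (Real.sin φ ^ 2 - 1) * Real.sin_sq_add_cos_sq θ
    - (Real.cos θ ^ 2) * Real.sin_sq_add_cos_sq φ + Real.sin_sq_add_cos_sq θ
    + Real.sin_sq_add_cos_sq φ

theorem dker_eq (τ t : ℝ) : dker τ t = (1 - τ) ^ 2 + 2 * τ * (1 - Real.cos t) := by
  rw [dker]; ring

theorem one_sub_cos_le_dker {τ : ℝ} (hτ : 1 / 2 ≤ τ) (t : ℝ) : 1 - Real.cos t ≤ dker τ t := by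
  rw [dker_eq]
  nlinarith [Real.cos_le_one t, sq_nonneg (1 - τ)]

/-- The numerator is at most 2 `dker τ t` in absolute value, and one more factor of `dker τ t`
dominates 1 - cos t. -/
theorem abs_logDerivKer'_mul_le {τ : ℝ} (hτ : τ ∈ Icc (1 / 2 : ℝ) 1) (t : ℝ) :
    |logDerivKer' τ t| * (1 - Real.cos t) ≤ 2 := by
  have h0 : 0 ≤ 1 - Real.cos t := by linarith [Real.cos_le_one t]
  have h1 := one_sub_cos_le_dker hτ.1 t
  rcases h0.eq_or_lt with h | h
  · rw [← h, mul_zero]; norm_num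
  · have hD : 0 < dker τ t := h.trans_le h1
    have h2 : |2 * τ * (1 + τ ^ 2) * Real.cos t - 4 * τ ^ 2| ≤ 2 * dker τ t := by
      -- Expanding in (1 - τ)² and 1 - cos t, the same two quantities that make up `dker`, allows a
      -- termwise comparison.
      have e : 2 * τ * (1 + τ ^ 2) * Real.cos t - 4 * τ ^ 2 =
          2 * τ * ((1 - τ) ^ 2 - (1 + τ ^ 2) * (1 - Real.cos t)) := by ring
      rw [e, dker_eq, abs_le]
      obtain ⟨h3, h4⟩ := hτ
      have h5 : 0 ≤ τ * (1 - Real.cos t) := by nlinarith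
      have h6 : 0 ≤ (1 - τ) * (1 - τ) ^ 2 := mul_nonneg (by linarith) (sq_nonneg _)
      have h7 : 0 ≤ (1 - τ ^ 2) * (τ * (1 - Real.cos t)) := mul_nonneg (by nlinarith) h5
      have h8 : 0 ≤ τ * (1 - τ) ^ 2 := mul_nonneg (by linarith) (sq_nonneg _)
      have h9 : 0 ≤ τ ^ 2 * (τ * (1 - Real.cos t)) := mul_nonneg (sq_nonneg _) h5
      constructor <;> nlinarith
    rw [logDerivKer', abs_div, abs_of_pos (pow_pos hD 2), div_mul_eq_mul_div,
      div_le_iff₀ (pow_pos hD 2)]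
    calc _ ≤ 2 * dker τ t * dker τ t := mul_le_mul h2 h1 h0 (by positivity)
      _ = _ := by ring

/-- After factoring (cos θ - cos φ)², each summand uses the factor with its own argument; the other
factor is at most 2. -/
theorem abs_trKer_mul_le {τ : ℝ} (hτ : τ ∈ Icc (1 / 2 : ℝ) 1) (θ φ : ℝ) :
    |trKer τ θ φ| * (Real.cos θ - Real.cos φ) ^ 2 ≤ 8 := by
  have h1 := abs_logDerivKer'_mul_le hτ (θ + φ)
  have h2 := abs_logDerivKer'_mul_le hτ (θ - φ)
  have h3 := Real.cos_le_one (θ + φ)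
  have h4 := Real.cos_le_one (θ - φ)
  have h5 := Real.neg_one_le_cos (θ + φ)
  have h6 := Real.neg_one_le_cos (θ - φ)
  rw [cos_sub_cos_sq, trKer]
  calc |logDerivKer' τ (θ + φ) + logDerivKer' τ (θ - φ)| *
        ((1 - Real.cos (θ + φ)) * (1 - Real.cos (θ - φ)))
      ≤ (|logDerivKer' τ (θ + φ)| + |logDerivKer' τ (θ - φ)|) *
        ((1 - Real.cos (θ + φ)) * (1 - Real.cos (θ - φ))) :=
        mul_le_mul_of_nonneg_right (abs_add_le _ _)
          (mul_nonneg (by linarith) (by linarith))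
    _ = |logDerivKer' τ (θ + φ)| * (1 - Real.cos (θ + φ)) * (1 - Real.cos (θ - φ)) +
        |logDerivKer' τ (θ - φ)| * (1 - Real.cos (θ - φ)) * (1 - Real.cos (θ + φ)) := by ring
    _ ≤ 2 * 2 + 2 * 2 := by
        refine add_le_add ?_ ?_ <;>
          exact mul_le_mul (by assumption) (by linarith) (by linarith) (by norm_num)
    _ = 8 := by norm_num

theorem dgKer_nonneg {σ : ℝ} (hσ : |σ| < 1) (θ φ : ℝ) : 0 ≤ dgKer σ θ φ := by
  have h1 := dker_pos hσ (θ + φ)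
  have h2 := dker_pos hσ (θ - φ)
  have h3 : 0 ≤ 1 - σ ^ 2 := by
    have := (sq_lt_one_iff_abs_lt_one σ).2 hσ
    linarith
  unfold dgKer
  positivity

theorem abs_dgKer_mul_le {τ : ℝ} (hτ : τ ∈ Icc (1 / 2 : ℝ) 1) (θ φ : ℝ) :
    |dgKer τ θ φ| * (Real.cos θ - Real.cos φ) ^ 2 ≤ 16 := by
  have h1 := one_sub_cos_le_dker hτ.1 (θ + φ)
  have h2 := one_sub_cos_le_dker hτ.1 (θ - φ)
  have h3 : 0 ≤ 1 - Real.cos (θ + φ) := by linarith [Real.cos_le_one (θ + φ)]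
  have h4 : 0 ≤ 1 - Real.cos (θ - φ) := by linarith [Real.cos_le_one (θ - φ)]
  have h5 : (Real.cos θ - Real.cos φ) ^ 2 ≤ dker τ (θ + φ) * dker τ (θ - φ) := by
    rw [cos_sub_cos_sq]
    exact mul_le_mul h1 h2 h4 (h3.trans h1)
  rcases (sq_nonneg (Real.cos θ - Real.cos φ)).eq_or_lt with h | h
  · rw [← h, mul_zero]; norm_num
  have hD := h.trans_le h5
  have h6 : 0 ≤ 1 - τ ^ 2 := by nlinarith [hτ.1, hτ.2]
  rw [dgKer, abs_div, abs_of_pos hD, div_mul_eq_mul_div, div_le_iff₀ hD, abs_of_nonneg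
    (by positivity)]
  refine mul_le_mul ?_ h5 h.le (by norm_num)
  have h7 : Real.sin θ ^ 2 * Real.sin φ ^ 2 ≤ 1 * 1 :=
    mul_le_mul (Real.sin_sq_le_one θ) (Real.sin_sq_le_one φ) (sq_nonneg _) zero_le_one
  have h8 : (1 - τ ^ 2) * (Real.sin θ ^ 2 * Real.sin φ ^ 2) ≤ 1 * (1 * 1) :=
    mul_le_mul (by nlinarith) h7 (by positivity) zero_le_one
  linarith

theorem continuousAt_dker_one (t : ℝ) : ContinuousAt (fun τ => dker τ t) 1 := by
  unfold dker; fun_prop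

theorem dker_one_mul_ne_zero {θ φ : ℝ} (h : Real.cos θ ≠ Real.cos φ) :
    dker 1 (θ + φ) ≠ 0 ∧ dker 1 (θ - φ) ≠ 0 := by
  have h1 : (Real.cos θ - Real.cos φ) ^ 2 ≠ 0 := pow_ne_zero 2 (sub_ne_zero.2 h)
  rw [cos_sub_cos_sq] at h1
  have h2 := mul_ne_zero_iff.1 h1
  have h3 : ∀ t, dker 1 t = 2 * (1 - Real.cos t) := fun t => by rw [dker]; ring
  rw [h3, h3]
  exact ⟨mul_ne_zero two_ne_zero h2.1, mul_ne_zero two_ne_zero h2.2⟩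

theorem continuousAt_trKer {θ φ : ℝ} (h : Real.cos θ ≠ Real.cos φ) :
    ContinuousAt (fun τ => trKer τ θ φ) 1 := by
  obtain ⟨h1, h2⟩ := dker_one_mul_ne_zero h
  unfold trKer logDerivKer'
  refine ContinuousAt.add ?_ ?_
  · exact ContinuousAt.div (by fun_prop) ((continuousAt_dker_one _).pow 2) (pow_ne_zero 2 h1)
  · exact ContinuousAt.div (by fun_prop) ((continuousAt_dker_one _).pow 2) (pow_ne_zero 2 h2)

theorem continuousAt_dgKer {θ φ : ℝ} (h : Real.cos θ ≠ Real.cos φ) :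
    ContinuousAt (fun τ => dgKer τ θ φ) 1 := by
  obtain ⟨h1, h2⟩ := dker_one_mul_ne_zero h
  unfold dgKer
  exact ContinuousAt.div (by fun_prop)
    ((continuousAt_dker_one _).mul (continuousAt_dker_one _)) (mul_ne_zero h1 h2)

theorem measurable_trKer (τ : ℝ) : Measurable fun p : ℝ × ℝ => trKer τ p.1 p.2 := by
  have h := (continuous_dker τ).measurable
  unfold trKer logDerivKer'
  fun_prop

theorem measurable_dgKer (τ : ℝ) : Measurable fun p : ℝ × ℝ => dgKer τ p.1 p.2 := by
  have h := (continuous_dker τ).measurable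
  unfold dgKer
  fun_prop

/-! ### Reflection σ ↦ -σ. -/

theorem dker_neg_add (σ θ φ : ℝ) : dker (-σ) (θ + φ) = dker σ (θ - (Real.pi - φ)) := by
  rw [show θ - (Real.pi - φ) = θ + φ - Real.pi by ring, dker, dker, Real.cos_sub_pi]; ring

theorem dker_neg_sub (σ θ φ : ℝ) : dker (-σ) (θ - φ) = dker σ (θ + (Real.pi - φ)) := by
  rw [show θ + (Real.pi - φ) = θ - φ + Real.pi by ring, dker, dker, Real.cos_add_pi]; ring

/-- Changing the sign of σ shifts t by π in `dker`, so it amounts to reflecting one of the two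
functions, φ ↦ π - φ. This transfers results near σ = 1 to σ = -1. -/
theorem trKer_neg (σ θ φ : ℝ) : trKer (-σ) θ φ = trKer σ θ (Real.pi - φ) := by
  rw [trKer, trKer, logDerivKer', logDerivKer', dker_neg_add, dker_neg_sub, logDerivKer',
    logDerivKer', add_comm, show θ - (Real.pi - φ) = θ + φ - Real.pi by ring,
    show θ + (Real.pi - φ) = θ - φ + Real.pi by ring, Real.cos_sub_pi, Real.cos_add_pi]
  congr 2 <;> ring

theorem dgKer_neg (σ θ φ : ℝ) : dgKer (-σ) θ φ = dgKer σ θ (Real.pi - φ) := by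
  rw [dgKer, dgKer, dker_neg_add, dker_neg_sub, Real.sin_pi_sub, neg_sq,
    mul_comm (dker σ (θ - (Real.pi - φ)))]

theorem integral_angleMeasure_pi_sub (G : ℝ → ℝ) :
    ∫ φ, G (Real.pi - φ) ∂angleMeasure = ∫ φ, G φ ∂angleMeasure := by
  rw [integral_angleMeasure, integral_angleMeasure, intervalIntegral.integral_comp_sub_left]
  simp

theorem Vtr2Formula_neg_eq {σ : ℝ} (hσ : |σ| < 1) (f : ℝ → ℝ) :
    Vtr2Formula f (-σ) = 1 / (4 * Real.pi ^ 2) * ∫ θ, ∫ φ,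
      f (2 * Real.cos θ) * f (2 * Real.cos (Real.pi - φ)) * trKer σ θ φ
        ∂angleMeasure ∂angleMeasure := by
  rw [Vtr2Formula_eq (by rwa [abs_neg])]
  congr 1
  refine integral_angleMeasure_congr fun θ _ => ?_
  rw [← integral_angleMeasure_pi_sub]
  simp only [trKer_neg, sub_sub_cancel]

theorem Vd2Formula_neg_eq (f : ℝ → ℝ) (σ : ℝ) :
    Vd2Formula f (-σ) = 1 / (4 * Real.pi ^ 2) * (∫ θ, ∫ φ,
      f (2 * Real.cos θ) * f (2 * Real.cos (Real.pi - φ)) * dgKer σ θ φ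
        ∂angleMeasure ∂angleMeasure) - meanSc f ^ 2 := by
  rw [Vd2Formula_eq]
  congr 2
  refine integral_angleMeasure_congr fun θ _ => ?_
  rw [← integral_angleMeasure_pi_sub]
  simp only [dgKer_neg, sub_sub_cancel]

theorem cosLipschitz_comp {f : ℝ → ℝ} {K : ℝ} (hf : ∀ x y, |f x - f y| ≤ K * |x - y|) :
    CosLipschitz (fun θ => f (2 * Real.cos θ)) (2 * K) := fun θ φ => by
  have := hf (2 * Real.cos θ) (2 * Real.cos φ)
  rw [← mul_sub, abs_mul, abs_two] at this
  linarith

theorem abs_lt_one_of_mem_Ico {τ : ℝ} (hτ : τ ∈ Ico (1 / 2 : ℝ) 1) : |τ| < 1 :=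
  abs_lt.2 ⟨by linarith [hτ.1], hτ.2⟩

theorem tendsto_integral_trKer {F H : ℝ → ℝ} {K : ℝ} (hF : CosLipschitz F K)
    (hH : CosLipschitz H K) :
    Tendsto (fun τ => ∫ θ, ∫ φ, F θ * H φ * trKer τ θ φ ∂angleMeasure ∂angleMeasure) (𝓝[<] 1)
      (𝓝 (-(1 / 2 * ∫ θ, ∫ φ, (F θ - F φ) * (H θ - H φ) * trKer 1 θ φ
        ∂angleMeasure ∂angleMeasure))) := by
  have := tendsto_integral_bilinear (k := trKer) (w := fun _ => 0) hF hH
    (fun τ hτ => continuous_trKer (abs_lt_one_of_mem_Ico hτ)) (measurable_trKer 1) trKer_comm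
    (fun τ hτ => integral_trKer (abs_lt_one_of_mem_Ico hτ))
    (fun τ hτ => abs_trKer_mul_le hτ) (fun θ φ h => continuousAt_trKer h)
  simpa using this

theorem tendsto_integral_dgKer {F H : ℝ → ℝ} {K : ℝ} (hF : CosLipschitz F K)
    (hH : CosLipschitz H K) :
    Tendsto (fun τ => ∫ θ, ∫ φ, F θ * H φ * dgKer τ θ φ ∂angleMeasure ∂angleMeasure) (𝓝[<] 1)
      (𝓝 (∫ θ, F θ * H θ * (8 * Real.pi * Real.sin θ ^ 2) ∂angleMeasure)) := by
  have := tendsto_integral_bilinear (k := dgKer) (w := fun θ => 8 * Real.pi * Real.sin θ ^ 2) hF hH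
    (fun τ hτ => continuous_dgKer (abs_lt_one_of_mem_Ico hτ)) (measurable_dgKer 1) dgKer_comm
    (fun τ hτ => integral_dgKer (abs_lt_one_of_mem_Ico hτ))
    (fun τ hτ => abs_dgKer_mul_le hτ) (fun θ φ h => continuousAt_dgKer h)
  -- At τ = 1 the factor 1 - τ² makes `dgKer` identically zero, so only the mass term survives: the
  -- kernel concentrates on the diagonal.
  simpa [dgKer] using this

/-! ### Limits of the functionals as σ → ±1. -/

theorem nhdsWithin_Ioo_one : 𝓝[Ioo (-1 : ℝ) 1] 1 = 𝓝[<] 1 :=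
  nhdsWithin_Ioo_eq_nhdsLT (by norm_num)

theorem tendsto_neg_Ioo : Tendsto (fun σ : ℝ => -σ) (𝓝[Ioo (-1 : ℝ) 1] (-1)) (𝓝[<] 1) := by
  rw [nhdsWithin_Ioo_eq_nhdsGT (by norm_num)]
  simpa using tendsto_neg_nhdsGT (a := (-1 : ℝ))

theorem eventually_abs_lt_one (s : ℝ) : ∀ᶠ σ in 𝓝[Ioo (-1 : ℝ) 1] s, |σ| < 1 := by
  filter_upwards [self_mem_nhdsWithin] with σ hσ
  exact abs_lt.2 hσ

section Limits

variable {f : ℝ → ℝ} {K : ℝ}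

/-- The mass term is zero, and -1/2 times the limiting kernel is (1 - cos θ cos φ)/(cos θ - cos φ)²,
the kernel of `Vtr1`. -/
theorem tendsto_Vtr2Formula_one (hf : ∀ x y, |f x - f y| ≤ K * |x - y|) :
    Tendsto (Vtr2Formula f) (𝓝[Ioo (-1 : ℝ) 1] 1) (𝓝 (Vtr1 f)) := by
  have hF := cosLipschitz_comp hf
  have h1 := (tendsto_integral_trKer hF hF).const_mul (1 / (4 * Real.pi ^ 2))
  rw [← nhdsWithin_Ioo_one] at h1
  have h2 : Vtr1 f = 1 / (4 * Real.pi ^ 2) * -(1 / 2 * ∫ θ, ∫ φ,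
      (f (2 * Real.cos θ) - f (2 * Real.cos φ)) * (f (2 * Real.cos θ) - f (2 * Real.cos φ)) *
        trKer 1 θ φ ∂angleMeasure ∂angleMeasure) := by
    rw [Vtr1_eq, ← neg_mul]
    congr 1
    rw [← integral_const_mul]
    refine integral_angleMeasure_congr fun θ _ => ?_
    rw [← integral_const_mul]
    refine integral_angleMeasure_congr fun φ _ => ?_
    by_cases h : Real.cos θ = Real.cos φ
    · simp [h]
    · have h3 : (Real.cos θ - Real.cos φ) ^ 2 ≠ 0 := pow_ne_zero 2 (sub_ne_zero.2 h)
      rw [cos_sub_cos_sq] at h3 ⊢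
      obtain ⟨h4, h5⟩ := mul_ne_zero_iff.1 h3
      -- At σ = 1 the second derivative is -1/(1 - cos t), left uncancelled so that the identity
      -- also holds where 1 - cos t = 0.
      have h6 : ∀ t, logDerivKer' 1 t = -(1 - Real.cos t) / (1 - Real.cos t) ^ 2 := fun t => by
        rw [logDerivKer', dker, show 1 + (1 : ℝ) ^ 2 - 2 * 1 * Real.cos t =
          2 * (1 - Real.cos t) by ring, mul_pow, show 2 * 1 * (1 + 1 ^ 2) * Real.cos t - 4 * 1 ^ 2 =
          2 ^ 2 * -(1 - Real.cos t) by ring, mul_div_mul_left _ _ (by norm_num)]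
      have h7 : 2 * (1 - Real.cos θ * Real.cos φ) =
          (1 - Real.cos (θ + φ)) + (1 - Real.cos (θ - φ)) := by
        rw [Real.cos_add, Real.cos_sub]; ring
      have h8 : 1 - Real.cos θ * Real.cos φ =
          ((1 - Real.cos (θ + φ)) + (1 - Real.cos (θ - φ))) / 2 := by rw [← h7]; ring
      rw [trKer, h6, h6, h8]
      field_simp
      ring
  rw [h2]
  refine h1.congr' ?_
  filter_upwards [eventually_abs_lt_one 1] with σ hσ
  rw [Vtr2Formula_eq hσ]

theorem exists_tendsto_Vtr2Formula_neg_one (hf : ∀ x y, |f x - f y| ≤ K * |x - y|) :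
    ∃ l, Tendsto (Vtr2Formula f) (𝓝[Ioo (-1 : ℝ) 1] (-1)) (𝓝 l) := by
  have hF := cosLipschitz_comp hf
  have h1 := ((tendsto_integral_trKer hF hF.pi_sub).const_mul (1 / (4 * Real.pi ^ 2))).comp
    tendsto_neg_Ioo
  refine ⟨_, h1.congr' ?_⟩
  filter_upwards [eventually_abs_lt_one (-1)] with σ hσ
  simp only [Function.comp_apply]
  rw [← Vtr2Formula_neg_eq (by rwa [abs_neg]), neg_neg]

/-- The mass 8π sin²θ times 1/(4π²) is the semicircle weight (2/π) sin²θ in angular form. -/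
theorem tendsto_Vd2Formula_one (hf : ∀ x y, |f x - f y| ≤ K * |x - y|) :
    Tendsto (Vd2Formula f) (𝓝[Ioo (-1 : ℝ) 1] 1) (𝓝 (Vd1 f)) := by
  have hF := cosLipschitz_comp hf
  have h1 := ((tendsto_integral_dgKer hF hF).const_mul (1 / (4 * Real.pi ^ 2))).sub_const
    (meanSc f ^ 2)
  rw [← nhdsWithin_Ioo_one] at h1
  have h2 : Vd1 f = 1 / (4 * Real.pi ^ 2) * (∫ θ, f (2 * Real.cos θ) * f (2 * Real.cos θ) *
      (8 * Real.pi * Real.sin θ ^ 2) ∂angleMeasure) - meanSc f ^ 2 := by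
    rw [Vd1, meanSc_eq (fun x => f x ^ 2), ← integral_const_mul, ← integral_const_mul]
    congr 1
    refine integral_angleMeasure_congr fun θ _ => ?_
    field_simp
    ring
  rw [h2]
  refine h1.congr' ?_
  filter_upwards with σ
  rw [Vd2Formula_eq]

theorem exists_tendsto_Vd2Formula_neg_one (hf : ∀ x y, |f x - f y| ≤ K * |x - y|) :
    ∃ l, Tendsto (Vd2Formula f) (𝓝[Ioo (-1 : ℝ) 1] (-1)) (𝓝 l) := by
  have hF := cosLipschitz_comp hf
  have h1 := (((tendsto_integral_dgKer hF hF.pi_sub).const_mul (1 / (4 * Real.pi ^ 2))).sub_const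
    (meanSc f ^ 2)).comp tendsto_neg_Ioo
  refine ⟨_, h1.congr' ?_⟩
  filter_upwards with σ
  simp only [Function.comp_apply]
  rw [← Vd2Formula_neg_eq, neg_neg]

/-- The kernels `(1 - τ²) / ((1 - τ)² + 4τw²)` concentrate on the zeros of `w`. -/
theorem tendsto_integral_concentrating {G w : ℝ → ℝ} {C : ℝ} (hG : Continuous G)
    (hw : Continuous w) (hC0 : 0 ≤ C) (hC : ∀ θ, |G θ| ≤ C * |w θ|) :
    Tendsto (fun τ => ∫ θ, G θ * ((1 - τ ^ 2) / ((1 - τ) ^ 2 + 4 * τ * w θ ^ 2)) ∂angleMeasure)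
      (𝓝[<] 1) (𝓝 0) := by
  have hmem : Ico (1 / 2 : ℝ) 1 ∈ 𝓝[<] (1 : ℝ) := Ico_mem_nhdsLT (by norm_num)
  rw [show (0 : ℝ) = ∫ θ, (0 : ℝ) ∂angleMeasure by simp]
  refine tendsto_integral_filter_of_dominated_convergence (fun _ => C) ?_ ?_
    (integrable_const _) (Eventually.of_forall fun θ => ?_)
  · filter_upwards [hmem] with τ hτ
    exact (hG.measurable.mul (by fun_prop)).aestronglyMeasurable
  · filter_upwards [hmem] with τ hτ
    refine Eventually.of_forall fun θ => ?_
    obtain ⟨h1, h2⟩ := hτ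
    have h3 : 0 < (1 - τ) ^ 2 + 4 * τ * w θ ^ 2 := by
      have : 0 < (1 - τ) ^ 2 := pow_pos (by linarith) 2
      have : 0 ≤ 4 * τ * w θ ^ 2 := mul_nonneg (by linarith) (sq_nonneg _)
      linarith
    rw [Real.norm_eq_abs, abs_mul, abs_div, abs_of_pos h3, abs_of_nonneg (by nlinarith : 0 ≤ 1 - τ ^ 2),
      mul_div_assoc', div_le_iff₀ h3]
    -- This is what makes the constant C a majorant: one factor |w| tames the kernel uniformly in τ.
    have h4 : |w θ| * (1 - τ ^ 2) ≤ (1 - τ) ^ 2 + 4 * τ * w θ ^ 2 := by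
      rw [← sq_abs (w θ)]
      have h5 := abs_nonneg (w θ)
      nlinarith [sq_nonneg (|w θ| - (1 - τ)), mul_nonneg h5 (by linarith : 0 ≤ 1 - τ),
        mul_nonneg (mul_nonneg h5 (by linarith : 0 ≤ 1 - τ)) (by linarith : 0 ≤ 1 - τ),
        mul_nonneg (sq_nonneg |w θ|) (by linarith : 0 ≤ τ - 1 / 2)]
    calc |G θ| * (1 - τ ^ 2) ≤ C * |w θ| * (1 - τ ^ 2) :=
          mul_le_mul_of_nonneg_right (hC θ) (by nlinarith)
      _ = C * (|w θ| * (1 - τ ^ 2)) := by ring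
      _ ≤ _ := mul_le_mul_of_nonneg_left h4 hC0
  · by_cases h : w θ = 0
    · have : G θ = 0 := by
        have := hC θ
        rw [h, abs_zero, mul_zero] at this
        exact abs_nonpos_iff.1 this
      simp [this]
    · have hc : ContinuousAt (fun τ : ℝ => G θ * ((1 - τ ^ 2) / ((1 - τ) ^ 2 + 4 * τ * w θ ^ 2))) 1 := by
        refine continuousAt_const.mul (ContinuousAt.div (by fun_prop) (by fun_prop) ?_)
        have := pow_ne_zero 2 h
        simpa using this
      have := hc.tendsto.mono_left (nhdsWithin_le_nhds (s := Iio 1))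
      simpa using this

theorem EtrFormula_eq_sub {σ : ℝ} (hσ : |σ| < 1) (hf : Continuous f) :
    EtrFormula f σ = meanInvSc f - 1 / Real.pi *
      ∫ θ, f (2 * Real.cos θ) * poissonKer σ (2 * θ) ∂angleMeasure := by
  have h := continuous_poissonKer hσ
  rw [EtrFormula_eq, meanInvSc_eq, ← mul_sub, ← integral_sub]
  · simp only [mul_sub, mul_one]
  · exact integrable_angleMeasure (by fun_prop)
  · exact integrable_angleMeasure (by fun_prop)

/-- The kernel `poissonKer σ (2 * θ)` has total mass π and concentrates on the zeros 0 and π of the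
sine; by symmetry each receives half. -/
theorem tendsto_EtrFormula_one (hK : 0 ≤ K) (hfc : Continuous f)
    (hf : ∀ x y, |f x - f y| ≤ K * |x - y|) :
    Tendsto (EtrFormula f) (𝓝[Ioo (-1 : ℝ) 1] 1) (𝓝 (meanInvSc f - (f 2 + f (-2)) / 2)) := by
  -- α + β cos θ interpolates f(2 cos θ) at θ = 0 and π, so the remainder G vanishes where the
  -- kernel concentrates. The β part integrates to zero by oddness about π/2.
  set α := (f 2 + f (-2)) / 2
  set β := (f 2 - f (-2)) / 2
  set G : ℝ → ℝ := fun θ => f (2 * Real.cos θ) - (α + β * Real.cos θ) with hGdef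
  have hGc : Continuous G := by fun_prop
  have hG : ∀ θ, |G θ| ≤ (2 * K) * |Real.sin θ| := fun θ => by
    have h1 := hf (2 * Real.cos θ) 2
    have h2 := hf (2 * Real.cos θ) (-2)
    have h3 := Real.cos_le_one θ
    have h4 := Real.neg_one_le_cos θ
    rw [abs_of_nonpos (by linarith : 2 * Real.cos θ - 2 ≤ 0)] at h1
    rw [abs_of_nonneg (by linarith : 0 ≤ 2 * Real.cos θ - -2)] at h2
    have e : G θ = (1 + Real.cos θ) / 2 * (f (2 * Real.cos θ) - f 2) +
        (1 - Real.cos θ) / 2 * (f (2 * Real.cos θ) - f (-2)) := by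
      simp only [hGdef, α, β]; ring
    have h5 : |Real.sin θ| ^ 2 ≤ |Real.sin θ| := by
      have := Real.abs_sin_le_one θ
      nlinarith [abs_nonneg (Real.sin θ)]
    rw [e]
    refine (abs_add_le _ _).trans ?_
    rw [abs_mul, abs_mul, abs_of_nonneg (by linarith : 0 ≤ (1 + Real.cos θ) / 2),
      abs_of_nonneg (by linarith : 0 ≤ (1 - Real.cos θ) / 2)]
    calc _ ≤ (1 + Real.cos θ) / 2 * (K * -(2 * Real.cos θ - 2)) +
          (1 - Real.cos θ) / 2 * (K * (2 * Real.cos θ - -2)) :=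
          add_le_add (mul_le_mul_of_nonneg_left h1 (by linarith))
            (mul_le_mul_of_nonneg_left h2 (by linarith))
      _ = 2 * K * |Real.sin θ| ^ 2 := by
          rw [sq_abs]; linear_combination (-2 * K) * Real.sin_sq_add_cos_sq θ
      _ ≤ _ := mul_le_mul_of_nonneg_left h5 (by linarith)
  have h1 := tendsto_integral_concentrating hGc Real.continuous_sin (by linarith) hG
  have h2 := ((h1.const_mul (1 / Real.pi)).const_sub (meanInvSc f - α))
  rw [mul_zero, sub_zero, ← nhdsWithin_Ioo_one] at h2
  refine h2.congr' ?_
  filter_upwards [eventually_abs_lt_one 1] with σ hσ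
  have hP := continuous_poissonKer hσ
  have e : ∀ θ, (1 - σ ^ 2) / ((1 - σ) ^ 2 + 4 * σ * Real.sin θ ^ 2) = poissonKer σ (2 * θ) :=
    fun θ => by
      rw [poissonKer, dker_eq, Real.cos_two_mul]
      congr 2
      linear_combination 4 * σ * Real.sin_sq_add_cos_sq θ
  have e2 : ∫ θ, G θ * poissonKer σ (2 * θ) ∂angleMeasure =
      ∫ θ, f (2 * Real.cos θ) * poissonKer σ (2 * θ) ∂angleMeasure - α * Real.pi := by
    have i1 : Integrable (fun θ => f (2 * Real.cos θ) * poissonKer σ (2 * θ)) angleMeasure :=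
      integrable_angleMeasure (by fun_prop)
    have i2 : Integrable (fun θ => α * poissonKer σ (2 * θ)) angleMeasure :=
      integrable_angleMeasure (by fun_prop)
    have i3 : Integrable (fun θ => β * (Real.cos θ * poissonKer σ (2 * θ))) angleMeasure :=
      integrable_angleMeasure (by fun_prop)
    rw [show (fun θ => G θ * poissonKer σ (2 * θ)) = fun θ =>
      f (2 * Real.cos θ) * poissonKer σ (2 * θ) - α * poissonKer σ (2 * θ) -
        β * (Real.cos θ * poissonKer σ (2 * θ)) from funext fun θ => by simp only [hGdef]; ring,
      integral_sub (integrable_angleMeasure (by fun_prop)) i3, integral_sub i1 i2,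
      integral_const_mul, integral_const_mul,
      integral_poissonKer hσ, integral_cos_mul_poissonKer]
    ring
  simp only [e]
  rw [e2, EtrFormula_eq_sub hσ hfc]
  field_simp
  ring

/-- Near σ = -1 the kernel is governed by cos²θ and concentrates at θ = π/2, where x = 0; it is
enough to subtract f(0). -/
theorem exists_tendsto_EtrFormula_neg_one (hK : 0 ≤ K) (hfc : Continuous f)
    (hf : ∀ x y, |f x - f y| ≤ K * |x - y|) :
    ∃ l, Tendsto (EtrFormula f) (𝓝[Ioo (-1 : ℝ) 1] (-1)) (𝓝 l) := by
  have hG : ∀ θ, |f (2 * Real.cos θ) - f 0| ≤ (2 * K) * |Real.cos θ| := fun θ => by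
    have := hf (2 * Real.cos θ) 0
    rw [sub_zero, abs_mul, abs_two] at this
    linarith
  have h1 := (tendsto_integral_concentrating (by fun_prop) Real.continuous_cos
    (by linarith) hG).comp tendsto_neg_Ioo
  have h2 := ((h1.const_mul (1 / Real.pi)).const_sub (meanInvSc f - f 0))
  refine ⟨_, h2.congr' ?_⟩
  filter_upwards [eventually_abs_lt_one (-1)] with σ hσ
  have hP := continuous_poissonKer hσ
  have e : ∀ θ, (1 - (-σ) ^ 2) / ((1 - -σ) ^ 2 + 4 * -σ * Real.cos θ ^ 2) =
      poissonKer σ (2 * θ) := fun θ => by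
    rw [poissonKer, dker_eq, Real.cos_two_mul]
    congr 1 <;> ring
  have e2 : ∫ θ, (f (2 * Real.cos θ) - f 0) * poissonKer σ (2 * θ) ∂angleMeasure =
      ∫ θ, f (2 * Real.cos θ) * poissonKer σ (2 * θ) ∂angleMeasure - f 0 * Real.pi := by
    have i1 : Integrable (fun θ => f (2 * Real.cos θ) * poissonKer σ (2 * θ)) angleMeasure :=
      integrable_angleMeasure (by fun_prop)
    have i2 : Integrable (fun θ => f 0 * poissonKer σ (2 * θ)) angleMeasure :=
      integrable_angleMeasure (by fun_prop)
    simp only [sub_mul]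
    rw [integral_sub i1 i2, integral_const_mul, integral_poissonKer hσ]
  simp only [Function.comp_apply, e]
  rw [e2, EtrFormula_eq_sub hσ hfc]
  field_simp
  ring

end Limits


/-! ### The rescaled profile, and kernel bounds away from the singularities. -/

/-- The profile `g` at scale `s²` around the edge `2`. -/
def edgeFn (g : ℝ → ℝ) (s x : ℝ) : ℝ := g ((x - 2) / s ^ 2)

theorem abs_integral_integral_le {k : ℝ → ℝ → ℝ} {A : ℝ → ℝ} {c : ℝ}
    (hA : Integrable A angleMeasure)
    (hk : ∀ θ ∈ Ioo 0 Real.pi, ∀ φ ∈ Ioo 0 Real.pi, |k θ φ| ≤ c * (A θ * A φ)) :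
    |∫ θ, ∫ φ, k θ φ ∂angleMeasure ∂angleMeasure| ≤ c * (∫ θ, A θ ∂angleMeasure) ^ 2 := by
  have h1 : ∀ θ ∈ Ioo 0 Real.pi, ‖∫ φ, k θ φ ∂angleMeasure‖ ≤
      c * (∫ φ, A φ ∂angleMeasure) * A θ := fun θ hθ => by
    have h2 : Integrable (fun φ => c * (A θ * A φ)) angleMeasure :=
      (hA.const_mul (A θ)).const_mul c
    refine (norm_integral_le_of_norm_le h2 (angleMeasure_ae fun φ hφ => hk θ hθ φ hφ)).trans_eq ?_
    rw [integral_const_mul, integral_const_mul]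
    ring
  refine (norm_integral_le_of_norm_le (hA.const_mul _) (angleMeasure_ae h1)).trans_eq ?_
  rw [integral_const_mul]
  ring

theorem abs_logDerivKer'_le {σ c t : ℝ} (hσ : |σ| < 1) (hc : 0 < c) (h : c ≤ dker σ t) :
    |logDerivKer' σ t| ≤ 8 / c ^ 2 := by
  have h2 : c ^ 2 ≤ dker σ t ^ 2 := pow_le_pow_left₀ hc.le h 2
  have h3 : σ ^ 2 ≤ 1 := ((sq_lt_one_iff_abs_lt_one σ).2 hσ).le
  have h4 : |2 * σ * (1 + σ ^ 2) * Real.cos t - 4 * σ ^ 2| ≤ 8 := by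
    refine (abs_sub _ _).trans ?_
    have h5 : |2 * σ * (1 + σ ^ 2) * Real.cos t| ≤ 4 := by
      rw [abs_mul, abs_mul, abs_mul, abs_two, abs_of_nonneg (by positivity : 0 ≤ 1 + σ ^ 2)]
      have h6 := Real.abs_cos_le_one t
      calc 2 * |σ| * (1 + σ ^ 2) * |Real.cos t| ≤ 2 * 1 * (1 + 1) * 1 := by gcongr
        _ = 4 := by norm_num
    rw [abs_of_nonneg (by positivity : 0 ≤ 4 * σ ^ 2)]
    linarith
  rw [logDerivKer', abs_div, abs_of_pos (lt_of_lt_of_le (pow_pos hc 2) h2)]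
  exact div_le_div₀ (by norm_num) h4 (pow_pos hc 2) h2

theorem abs_trKer_le {σ c θ φ : ℝ} (hσ : |σ| < 1) (hc : 0 < c) (h1 : c ≤ dker σ (θ + φ))
    (h2 : c ≤ dker σ (θ - φ)) : |trKer σ θ φ| ≤ 16 / c ^ 2 := by
  refine (abs_add_le _ _).trans ((add_le_add (abs_logDerivKer'_le hσ hc h1)
    (abs_logDerivKer'_le hσ hc h2)).trans_eq ?_)
  ring

theorem abs_dgKer_le {σ c θ φ : ℝ} (hσ : |σ| < 1) (hc : 0 < c) (h1 : c ≤ dker σ (θ + φ))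
    (h2 : c ≤ dker σ (θ - φ)) : |dgKer σ θ φ| ≤ 16 / c ^ 2 * (Real.sin θ ^ 2 * Real.sin φ ^ 2) := by
  rw [abs_of_nonneg (dgKer_nonneg hσ θ φ), dgKer, div_mul_eq_mul_div]
  refine div_le_div₀ (by positivity) ?_ (pow_pos hc 2) ?_
  · exact mul_le_mul_of_nonneg_right (by nlinarith [sq_nonneg σ]) (by positivity)
  · rw [sq]; exact mul_le_mul h1 h2 hc.le (hc.le.trans h1)

theorem poissonKer_nonneg {σ : ℝ} (hσ : |σ| < 1) (t : ℝ) : 0 ≤ poissonKer σ t :=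
  div_nonneg (by have := (sq_lt_one_iff_abs_lt_one σ).2 hσ; linarith) (dker_pos hσ t).le

theorem abs_poissonKer_le {σ c t : ℝ} (hσ : |σ| < 1) (hc : 0 < c) (h : c ≤ dker σ t) :
    |poissonKer σ t| ≤ 1 / c := by
  rw [abs_of_nonneg (poissonKer_nonneg hσ t)]
  exact div_le_div₀ zero_le_one (by nlinarith [sq_nonneg σ]) hc h

section OffDiagonal

/-! Bounds when the denominators stay away from zero on the support. -/

variable {f : ℝ → ℝ} {σ c : ℝ}

theorem abs_Vtr2Formula_le_of_dker_ge (hf : Continuous f) (hσ : |σ| < 1) (hc : 0 < c)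
    (h : ∀ θ ∈ Ioo 0 Real.pi, ∀ φ ∈ Ioo 0 Real.pi, f (2 * Real.cos θ) ≠ 0 →
      f (2 * Real.cos φ) ≠ 0 → c ≤ dker σ (θ + φ) ∧ c ≤ dker σ (θ - φ)) :
    |Vtr2Formula f σ| ≤ 16 / c ^ 2 * (∫ θ, |f (2 * Real.cos θ)| ∂angleMeasure) ^ 2 := by
  have h0 : 1 / (4 * Real.pi ^ 2) ≤ 1 := by
    rw [div_le_one (by positivity)]
    nlinarith [Real.pi_gt_three]
  rw [Vtr2Formula_eq hσ, abs_mul, abs_of_pos (by positivity : 0 < 1 / (4 * Real.pi ^ 2))]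
  refine (mul_le_of_le_one_left (abs_nonneg _) h0).trans
    (abs_integral_integral_le (integrable_angleMeasure (by fun_prop)) fun θ hθ φ hφ => ?_)
  by_cases h1 : f (2 * Real.cos θ) = 0
  · simp [h1]
  by_cases h2 : f (2 * Real.cos φ) = 0
  · simp [h2]
  obtain ⟨h3, h4⟩ := h θ hθ φ hφ h1 h2
  rw [abs_mul, abs_mul, mul_comm]
  exact mul_le_mul_of_nonneg_right (abs_trKer_le hσ hc h3 h4) (by positivity)

theorem abs_meanSc_le : |meanSc f| ≤ ∫ θ, |f (2 * Real.cos θ)| * Real.sin θ ^ 2 ∂angleMeasure := by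
  have h0 : 2 / Real.pi ≤ 1 := by
    rw [div_le_one (by positivity)]
    linarith [Real.pi_gt_three]
  rw [meanSc_eq, abs_mul, abs_of_pos (by positivity : 0 < 2 / Real.pi)]
  refine (mul_le_of_le_one_left (abs_nonneg _) h0).trans ?_
  refine (abs_integral_le_integral_abs).trans_eq ?_
  simp only [abs_mul, abs_pow, sq_abs]

theorem abs_Vd2Formula_le_of_dker_ge (hf : Continuous f) (hσ : |σ| < 1) (hc : 0 < c)
    (h : ∀ θ ∈ Ioo 0 Real.pi, ∀ φ ∈ Ioo 0 Real.pi, f (2 * Real.cos θ) ≠ 0 →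
      f (2 * Real.cos φ) ≠ 0 → c ≤ dker σ (θ + φ) ∧ c ≤ dker σ (θ - φ)) :
    |Vd2Formula f σ| ≤ (16 / c ^ 2 + 1) *
      (∫ θ, |f (2 * Real.cos θ)| * Real.sin θ ^ 2 ∂angleMeasure) ^ 2 := by
  have h0 : 1 / (4 * Real.pi ^ 2) ≤ 1 := by
    rw [div_le_one (by positivity)]
    nlinarith [Real.pi_gt_three]
  rw [Vd2Formula_eq, add_mul, one_mul]
  refine (abs_sub _ _).trans (add_le_add ?_ ?_)
  · rw [abs_mul, abs_of_pos (by positivity : 0 < 1 / (4 * Real.pi ^ 2))]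
    refine (mul_le_of_le_one_left (abs_nonneg _) h0).trans
      (abs_integral_integral_le (integrable_angleMeasure (by fun_prop)) fun θ hθ φ hφ => ?_)
    by_cases h1 : f (2 * Real.cos θ) = 0
    · simp [h1]
    by_cases h2 : f (2 * Real.cos φ) = 0
    · simp [h2]
    obtain ⟨h3, h4⟩ := h θ hθ φ hφ h1 h2
    rw [abs_mul, abs_mul]
    refine (mul_le_mul_of_nonneg_left (abs_dgKer_le hσ hc h3 h4) (by positivity)).trans_eq ?_
    ring
  · rw [abs_pow]
    exact pow_le_pow_left₀ (abs_nonneg _) abs_meanSc_le 2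

theorem abs_EtrFormula_le_of_dker_ge (hf : Continuous f) (hσ : |σ| < 1) (hc : 0 < c)
    (h : ∀ θ ∈ Ioo 0 Real.pi, f (2 * Real.cos θ) ≠ 0 → c ≤ dker σ (2 * θ)) :
    |EtrFormula f σ| ≤ (1 + 1 / c) * ∫ θ, |f (2 * Real.cos θ)| ∂angleMeasure := by
  have h0 : 1 / Real.pi ≤ 1 := by
    rw [div_le_one (by positivity)]
    linarith [Real.pi_gt_three]
  have hi : Integrable (fun θ => (1 + 1 / c) * |f (2 * Real.cos θ)|) angleMeasure :=
    integrable_angleMeasure (by fun_prop)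
  rw [EtrFormula_eq, abs_mul, abs_of_pos (by positivity : 0 < 1 / Real.pi), ← integral_const_mul]
  refine (mul_le_of_le_one_left (abs_nonneg _) h0).trans ?_
  rw [← Real.norm_eq_abs]
  refine norm_integral_le_of_norm_le hi (angleMeasure_ae fun θ hθ => ?_)
  by_cases h1 : f (2 * Real.cos θ) = 0
  · simp [h1]
  rw [norm_mul, mul_comm]
  refine mul_le_mul_of_nonneg_right ?_ (abs_nonneg _)
  refine (abs_sub _ _).trans ?_
  rw [abs_one]
  exact add_le_add le_rfl (abs_poissonKer_le hσ hc (h θ hθ h1))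

end OffDiagonal

section Crude

/-! Bounds near `σ = -1` without information on the support. -/

variable {f : ℝ → ℝ} {K B τ : ℝ}

theorem integral_const_angleMeasure (c : ℝ) : ∫ _, c ∂angleMeasure = Real.pi * c := by
  rw [integral_angleMeasure]; simp

/-- Polarization with one function reflected, and zero mass, leaves a product of differences that
the kernel bound controls up to σ = -1. -/
theorem abs_Vtr2Formula_neg_le (hf : ∀ x y, |f x - f y| ≤ K * |x - y|)
    (hτ : τ ∈ Ico (1 / 2 : ℝ) 1) : |Vtr2Formula f (-τ)| ≤ 4 * K ^ 2 := by
  have hF := cosLipschitz_comp hf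
  have hH := hF.pi_sub
  have hτ1 := abs_lt_one_of_mem_Ico hτ
  rw [Vtr2Formula_neg_eq hτ1, integral_bilinear_eq (F := fun θ => f (2 * Real.cos θ))
    (H := fun φ => f (2 * Real.cos (Real.pi - φ))) (w := fun _ => 0) (continuous_trKer hτ1)
    (trKer_comm τ) (integral_trKer hτ1) hF.continuous hH.continuous]
  have h1 := abs_integral_integral_le (k := fun θ φ => (f (2 * Real.cos θ) - f (2 * Real.cos φ)) *
    (f (2 * Real.cos (Real.pi - θ)) - f (2 * Real.cos (Real.pi - φ))) * trKer τ θ φ)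
    (A := fun _ => 1) (c := (2 * K) ^ 2 * 8) (integrable_const _) fun θ _ φ _ => by
      rw [mul_one, mul_one]
      exact hF.abs_mul_mul_le hH (abs_trKer_mul_le ⟨hτ.1, hτ.2.le⟩ θ φ)
  rw [integral_const_angleMeasure, mul_one] at h1
  simp only [mul_zero, integral_zero, zero_sub]
  rw [abs_mul, abs_neg, abs_mul, abs_of_pos (by positivity : 0 < 1 / (4 * Real.pi ^ 2)),
    abs_of_pos (by norm_num : (0 : ℝ) < 1 / 2)]
  calc _ ≤ 1 / (4 * Real.pi ^ 2) * (1 / 2 * ((2 * K) ^ 2 * 8 * Real.pi ^ 2)) := by gcongr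
    _ = 4 * K ^ 2 := by field_simp; ring

theorem abs_meanSc_le_of_abs_le (hB : ∀ x, |f x| ≤ B) : |meanSc f| ≤ B := by
  have hi : Integrable (fun θ => B * Real.sin θ ^ 2) angleMeasure :=
    integrable_angleMeasure (by fun_prop)
  have h := norm_integral_le_of_norm_le (f := fun θ => f (2 * Real.cos θ) * Real.sin θ ^ 2) hi
    (Eventually.of_forall fun θ => by
      rw [norm_mul, Real.norm_eq_abs, Real.norm_eq_abs, abs_of_nonneg (sq_nonneg (Real.sin θ))]
      exact mul_le_mul_of_nonneg_right (hB _) (sq_nonneg _))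
  rw [integral_const_mul, integral_sin_sq_angleMeasure, Real.norm_eq_abs] at h
  rw [meanSc_eq, abs_mul, abs_of_pos (by positivity : 0 < 2 / Real.pi)]
  calc _ ≤ 2 / Real.pi * (B * (Real.pi / 2)) := by gcongr
    _ = B := by field_simp

/-- The kernel is nonnegative with known mass, so its supremum, which blows up at σ = ±1, is not
needed. -/
theorem abs_Vd2Formula_neg_le (hB : ∀ x, |f x| ≤ B) {σ : ℝ} (hσ : |σ| < 1) :
    |Vd2Formula f σ| ≤ 2 * B ^ 2 := by
  have hB0 : 0 ≤ B := (abs_nonneg _).trans (hB 0)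
  have h1 : ∀ θ, ‖∫ φ, f (2 * Real.cos θ) * f (2 * Real.cos φ) * dgKer σ θ φ ∂angleMeasure‖ ≤
      B ^ 2 * (8 * Real.pi) * Real.sin θ ^ 2 := fun θ => by
    have hc := (continuous_dgKer hσ).comp (by fun_prop : Continuous fun φ : ℝ => (θ, φ))
    have hi : Integrable (fun φ => B ^ 2 * dgKer σ θ φ) angleMeasure :=
      integrable_angleMeasure (continuous_const.mul hc)
    refine (norm_integral_le_of_norm_le hi (Eventually.of_forall fun φ => ?_)).trans_eq ?_
    · rw [norm_mul, norm_mul, Real.norm_eq_abs, Real.norm_eq_abs, Real.norm_eq_abs,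
        abs_of_nonneg (dgKer_nonneg hσ θ φ), sq]
      exact mul_le_mul_of_nonneg_right (mul_le_mul (hB _) (hB _) (abs_nonneg _) hB0)
        (dgKer_nonneg hσ θ φ)
    · rw [integral_const_mul, integral_dgKer hσ]; ring
  have hi : Integrable (fun θ => B ^ 2 * (8 * Real.pi) * Real.sin θ ^ 2) angleMeasure :=
    integrable_angleMeasure (by fun_prop)
  have h2 := norm_integral_le_of_norm_le hi (Eventually.of_forall h1)
  rw [integral_const_mul, integral_sin_sq_angleMeasure, Real.norm_eq_abs] at h2
  rw [Vd2Formula_eq, two_mul]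
  refine (abs_sub _ _).trans (add_le_add ?_ ?_)
  · rw [abs_mul, abs_of_pos (by positivity : 0 < 1 / (4 * Real.pi ^ 2))]
    calc _ ≤ 1 / (4 * Real.pi ^ 2) * (B ^ 2 * (8 * Real.pi) * (Real.pi / 2)) := by gcongr
      _ = B ^ 2 := by field_simp; ring
  · rw [abs_pow]
    exact pow_le_pow_left₀ (abs_nonneg _) (abs_meanSc_le_of_abs_le hB) 2

theorem abs_EtrFormula_le (hB : ∀ x, |f x| ≤ B) {σ : ℝ} (hσ : |σ| < 1) :
    |EtrFormula f σ| ≤ 2 * B := by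
  have hP := continuous_poissonKer hσ
  have hB0 : 0 ≤ B := (abs_nonneg _).trans (hB 0)
  have hi1 : Integrable (fun θ => B * poissonKer σ (2 * θ)) angleMeasure :=
    integrable_angleMeasure (by fun_prop)
  have hi : Integrable (fun θ => B + B * poissonKer σ (2 * θ)) angleMeasure :=
    (integrable_const B).add hi1
  have h := norm_integral_le_of_norm_le
    (f := fun θ => f (2 * Real.cos θ) * (1 - poissonKer σ (2 * θ))) hi
    (Eventually.of_forall fun θ => by
      have h1 := poissonKer_nonneg hσ (2 * θ)
      have h2 : |1 - poissonKer σ (2 * θ)| ≤ 1 + poissonKer σ (2 * θ) :=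
        abs_le.2 ⟨by linarith, by linarith⟩
      rw [norm_mul]
      refine (mul_le_mul (hB _) h2 (abs_nonneg _) hB0).trans_eq (by ring))
  rw [integral_add (integrable_const B) hi1, integral_const_mul, integral_poissonKer hσ,
    integral_const_angleMeasure, Real.norm_eq_abs] at h
  rw [EtrFormula_eq, abs_mul, abs_of_pos (by positivity : 0 < 1 / Real.pi)]
  calc _ ≤ 1 / Real.pi * (Real.pi * B + B * Real.pi) := by gcongr
    _ = 2 * B := by field_simp; norm_num

end Crude

/-! ### Size of the rescaled profile, and bounds for σ away from 1. -/

namespace IsProfile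

variable {g : ℝ → ℝ} {B R s : ℝ}

theorem nonneg (h : IsProfile g B R) : 0 ≤ B := (abs_nonneg _).trans (h.abs_le 0)

theorem edgeFn_lip (h : IsProfile g B R) (hs : 0 < s) (x y : ℝ) :
    |edgeFn g s x - edgeFn g s y| ≤ B / s ^ 2 * |x - y| := by
  refine (h.lip _ _).trans_eq ?_
  rw [← sub_div, sub_sub_sub_cancel_right, abs_div, abs_of_pos (pow_pos hs 2)]
  ring

theorem continuous (h : IsProfile g B R) : Continuous g := by
  refine (LipschitzWith.of_dist_le_mul (K := ⟨B, h.nonneg⟩) fun x y => ?_).continuous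
  exact h.lip x y

theorem edgeFn_continuous (h : IsProfile g B R) : Continuous (edgeFn g s) := by
  have := h.continuous
  unfold edgeFn
  fun_prop

theorem edgeFn_abs_le (h : IsProfile g B R) (x : ℝ) : |edgeFn g s x| ≤ B := h.abs_le _

theorem two_sub_lt_of_edgeFn_ne_zero (h : IsProfile g B R) (hs : 0 < s) {x : ℝ}
    (hx : edgeFn g s x ≠ 0) : 2 - x < s ^ 2 * R ^ 2 := by
  by_contra h1
  refine hx (h.eq_zero _ ?_)
  rw [abs_div, abs_of_pos (pow_pos hs 2), le_div_iff₀ (pow_pos hs 2)]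
  have := neg_abs_le (x - 2)
  linarith [not_lt.1 h1]

/-- Since 2 - 2 cos θ ≥ (4/π²)θ² and π ≤ 4, a distance s²R² from the edge in x is an angle of size
at most 2Rs. -/
theorem angle_lt_of_edgeFn_ne_zero (h : IsProfile g B R) (hs : 0 < s) {θ : ℝ}
    (hθ : θ ∈ Ioo 0 Real.pi) (hx : edgeFn g s (2 * Real.cos θ) ≠ 0) : θ < 2 * R * s := by
  have h1 := h.two_sub_lt_of_edgeFn_ne_zero hs hx
  have h3 : Real.cos θ ≤ 1 - 2 / Real.pi ^ 2 * θ ^ 2 :=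
    Real.cos_le_one_sub_mul_cos_sq (by rw [abs_of_pos hθ.1]; exact hθ.2.le)
  have hR : 0 < R := zero_lt_one.trans_le h.one_le
  have h4 : 4 * θ ^ 2 < Real.pi ^ 2 * (s ^ 2 * R ^ 2) := by
    have h5 : 4 / Real.pi ^ 2 * θ ^ 2 < s ^ 2 * R ^ 2 := by
      have : 4 / Real.pi ^ 2 * θ ^ 2 = 2 * (2 / Real.pi ^ 2 * θ ^ 2) := by ring
      linarith
    rw [div_mul_eq_mul_div, div_lt_iff₀ (by positivity)] at h5
    linarith
  have h6 : Real.pi ^ 2 ≤ 4 ^ 2 := pow_le_pow_left₀ Real.pi_pos.le Real.pi_le_four 2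
  have h7 : θ ^ 2 < (2 * R * s) ^ 2 := by
    have : Real.pi ^ 2 * (s ^ 2 * R ^ 2) ≤ 4 ^ 2 * (s ^ 2 * R ^ 2) :=
      mul_le_mul_of_nonneg_right h6 (by positivity)
    nlinarith
  exact lt_of_pow_lt_pow_left₀ 2 (by positivity) h7

theorem integral_abs_edgeFn_le (h : IsProfile g B R) (hs : 0 < s) :
    ∫ θ, |edgeFn g s (2 * Real.cos θ)| ∂angleMeasure ≤ 2 * B * R * s := by
  have hR : 0 < R := zero_lt_one.trans_le h.one_le
  have h1 : ∫ θ, |edgeFn g s (2 * Real.cos θ)| ∂angleMeasure ≤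
      ∫ θ, (Ioo 0 (2 * R * s)).indicator (fun _ => B) θ ∂angleMeasure := by
    refine integral_mono_of_nonneg (Eventually.of_forall fun θ => abs_nonneg _)
      ((integrable_const B).indicator measurableSet_Ioo) (angleMeasure_ae fun θ hθ => ?_)
    by_cases hx : edgeFn g s (2 * Real.cos θ) = 0
    · simp only [hx, abs_zero]
      exact indicator_nonneg (fun _ _ => h.nonneg) _
    · simp only
      rw [indicator_of_mem (show θ ∈ Ioo 0 (2 * R * s) from
        ⟨hθ.1, h.angle_lt_of_edgeFn_ne_zero hs hθ hx⟩)]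
      exact h.edgeFn_abs_le _
  refine h1.trans ?_
  rw [integral_indicator_const _ measurableSet_Ioo, smul_eq_mul]
  have h2 : angleMeasure.real (Ioo 0 (2 * R * s)) ≤ 2 * R * s := by
    rw [measureReal_def]
    refine ENNReal.toReal_le_of_le_ofReal (by positivity) ?_
    refine (Measure.restrict_apply_le _ _).trans_eq ?_
    rw [Real.volume_Ioo, sub_zero]
  calc _ ≤ 2 * R * s * B := mul_le_mul_of_nonneg_right h2 h.nonneg
    _ = _ := by ring

/-- On the support, sin²θ ≤ 2 - 2 cos θ < s²R², which gains two powers of s over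
`integral_abs_edgeFn_le`. -/
theorem integral_abs_edgeFn_mul_sin_sq_le (h : IsProfile g B R) (hs : 0 < s) :
    ∫ θ, |edgeFn g s (2 * Real.cos θ)| * Real.sin θ ^ 2 ∂angleMeasure ≤ 2 * B * R ^ 3 * s ^ 3 := by
  have hc := h.edgeFn_continuous (s := s)
  have h1 : ∫ θ, |edgeFn g s (2 * Real.cos θ)| * Real.sin θ ^ 2 ∂angleMeasure ≤
      ∫ θ, |edgeFn g s (2 * Real.cos θ)| * (s ^ 2 * R ^ 2) ∂angleMeasure := by
    refine integral_mono (integrable_angleMeasure (by fun_prop))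
      (integrable_angleMeasure (by fun_prop)) fun θ => ?_
    by_cases hx : edgeFn g s (2 * Real.cos θ) = 0
    · simp [hx]
    · refine mul_le_mul_of_nonneg_left ?_ (abs_nonneg _)
      have h2 := h.two_sub_lt_of_edgeFn_ne_zero hs hx
      rw [Real.sin_sq]
      nlinarith [Real.cos_le_one θ, Real.neg_one_le_cos θ]
  refine h1.trans ?_
  rw [integral_mul_const]
  calc _ ≤ 2 * B * R * s * (s ^ 2 * R ^ 2) :=
        mul_le_mul_of_nonneg_right (h.integral_abs_edgeFn_le hs) (by positivity)
    _ = _ := by ring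

theorem abs_meanInvSc_edgeFn_le (h : IsProfile g B R) (hs : 0 < s) :
    |meanInvSc (edgeFn g s)| ≤ 2 * B * R * s := by
  have h0 : 1 / Real.pi ≤ 1 := by
    rw [div_le_one (by positivity)]
    linarith [Real.pi_gt_three]
  rw [meanInvSc_eq, abs_mul, abs_of_pos (by positivity : 0 < 1 / Real.pi)]
  exact (mul_le_of_le_one_left (abs_nonneg _) h0).trans
    (abs_integral_le_integral_abs.trans (h.integral_abs_edgeFn_le hs))

/-- Both angles are close to 0, so cos(θ ± φ) ≥ 0 and the cross term of `dker` is nonnegative for σ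
≤ 0. This is why σ = -1 is harmless at the edge. -/
theorem dker_ge_of_edgeFn_ne_zero (h : IsProfile g B R) (hs : 0 < s) (hsR : s ^ 2 * R ^ 2 ≤ 1 / 2)
    {σ θ φ : ℝ} (hσ : σ ≤ 0) (hθ : edgeFn g s (2 * Real.cos θ) ≠ 0)
    (hφ : edgeFn g s (2 * Real.cos φ) ≠ 0) : 1 ≤ dker σ (θ + φ) ∧ 1 ≤ dker σ (θ - φ) := by
  have h1 := h.two_sub_lt_of_edgeFn_ne_zero hs hθ
  have h2 := h.two_sub_lt_of_edgeFn_ne_zero hs hφ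
  have h3 : 3 / 4 ≤ Real.cos θ := by linarith
  have h4 : 3 / 4 ≤ Real.cos φ := by linarith
  have h5 : Real.sin θ ^ 2 ≤ 1 - (3 / 4) ^ 2 := by rw [Real.sin_sq]; nlinarith
  have h6 : Real.sin φ ^ 2 ≤ 1 - (3 / 4) ^ 2 := by rw [Real.sin_sq]; nlinarith
  have h7 : |Real.sin θ * Real.sin φ| ≤ 7 / 16 := by
    rw [_root_.abs_le]
    constructor <;> nlinarith [sq_nonneg (Real.sin θ + Real.sin φ),
      sq_nonneg (Real.sin θ - Real.sin φ)]
  have h8 := _root_.abs_le.1 h7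
  have h9 : 9 / 16 ≤ Real.cos θ * Real.cos φ := by nlinarith
  rw [dker, dker, Real.cos_add, Real.cos_sub]
  constructor <;> nlinarith [sq_nonneg σ]

/-- Bounds on the `σ`-dependent functionals, uniform away from `σ = 1`. -/
theorem exists_bound_of_le (B R : ℝ) {ε : ℝ} (hε : 0 < ε) :
    ∃ C : ℝ, 0 ≤ C ∧ ∀ g : ℝ → ℝ, IsProfile g B R → ∀ s ∈ Ioc (0 : ℝ) 1, ∀ σ : ℝ, |σ| < 1 →
      σ ≤ 1 - ε → |Vtr2Formula (edgeFn g s) σ| ≤ C * s ∧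
        |Vd2Formula (edgeFn g s) σ| ≤ C * s ^ 4 ∧ |EtrFormula (edgeFn g s) σ| ≤ C * s := by
  -- For -1/2 ≤ σ ≤ 1 - ε one has |σ| ≤ 1 - min(ε, 1/2), so `dker` is at least c everywhere.
  set c : ℝ := min ε (1 / 2) ^ 2 with hcdef
  have hm : 0 < min ε (1 / 2) := lt_min hε (by norm_num)
  have hc : 0 < c := pow_pos hm 2
  have hc1 : c ≤ 1 := by
    have : min ε (1 / 2) ≤ 1 / 2 := min_le_right _ _
    rw [hcdef]; nlinarith
  refine ⟨16 / c ^ 2 * (4 * B ^ 2 * R ^ 2) + 32 * B ^ 2 * |R| ^ 5 +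
    (16 / c ^ 2 + 1) * (4 * B ^ 2 * R ^ 6) + 8 * B ^ 2 * R ^ 4 + (1 + 1 / c) * (2 * |B| * |R|) +
      4 * |B| * |R|, by positivity, fun g hg s ⟨hs0, hs1⟩ σ hσ hσε => ?_⟩
  have hB := hg.nonneg
  have hR : 1 ≤ R := hg.one_le
  have hR0 : 0 < R := zero_lt_one.trans_le hR
  rw [abs_of_nonneg hB, abs_of_pos hR0]
  have p1 : 0 ≤ 16 / c ^ 2 * (4 * B ^ 2 * R ^ 2) := by positivity
  have p2 : 0 ≤ 32 * B ^ 2 * R ^ 5 := by positivity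
  have p3 : 0 ≤ (16 / c ^ 2 + 1) * (4 * B ^ 2 * R ^ 6) := by positivity
  have p4 : 0 ≤ 8 * B ^ 2 * R ^ 4 := by positivity
  have p5 : 0 ≤ (1 + 1 / c) * (2 * B * R) := by positivity
  have p6 : 0 ≤ 4 * B * R := by positivity
  have s2 : s ^ 2 ≤ s := by nlinarith
  have s6 : s ^ 6 ≤ s ^ 4 := pow_le_pow_of_le_one hs0.le hs1 (by norm_num)
  by_cases hcase : ∀ θ ∈ Ioo 0 Real.pi, ∀ φ ∈ Ioo 0 Real.pi, edgeFn g s (2 * Real.cos θ) ≠ 0 →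
      edgeFn g s (2 * Real.cos φ) ≠ 0 → c ≤ dker σ (θ + φ) ∧ c ≤ dker σ (θ - φ)
  · have hi := hg.integral_abs_edgeFn_le hs0
    have hi0 : 0 ≤ ∫ θ, |edgeFn g s (2 * Real.cos θ)| ∂angleMeasure :=
      integral_nonneg fun θ => abs_nonneg _
    have hj := hg.integral_abs_edgeFn_mul_sin_sq_le hs0
    have hj0 : 0 ≤ ∫ θ, |edgeFn g s (2 * Real.cos θ)| * Real.sin θ ^ 2 ∂angleMeasure :=
      integral_nonneg fun θ => by positivity
    refine ⟨?_, ?_, ?_⟩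
    · calc _ ≤ 16 / c ^ 2 * (∫ θ, |edgeFn g s (2 * Real.cos θ)| ∂angleMeasure) ^ 2 :=
            abs_Vtr2Formula_le_of_dker_ge hg.edgeFn_continuous hσ hc hcase
        _ ≤ 16 / c ^ 2 * (2 * B * R * s) ^ 2 := by gcongr
        _ = 16 / c ^ 2 * (4 * B ^ 2 * R ^ 2) * s ^ 2 := by ring
        _ ≤ 16 / c ^ 2 * (4 * B ^ 2 * R ^ 2) * s := mul_le_mul_of_nonneg_left s2 p1
        _ ≤ _ := mul_le_mul_of_nonneg_right (by linarith) hs0.le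
    · calc _ ≤ (16 / c ^ 2 + 1) *
              (∫ θ, |edgeFn g s (2 * Real.cos θ)| * Real.sin θ ^ 2 ∂angleMeasure) ^ 2 :=
            abs_Vd2Formula_le_of_dker_ge hg.edgeFn_continuous hσ hc hcase
        _ ≤ (16 / c ^ 2 + 1) * (2 * B * R ^ 3 * s ^ 3) ^ 2 := by gcongr
        _ = (16 / c ^ 2 + 1) * (4 * B ^ 2 * R ^ 6) * s ^ 6 := by ring
        _ ≤ (16 / c ^ 2 + 1) * (4 * B ^ 2 * R ^ 6) * s ^ 4 := mul_le_mul_of_nonneg_left s6 p3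
        _ ≤ _ := mul_le_mul_of_nonneg_right (by linarith) (by positivity)
    · calc _ ≤ (1 + 1 / c) * ∫ θ, |edgeFn g s (2 * Real.cos θ)| ∂angleMeasure :=
            abs_EtrFormula_le_of_dker_ge hg.edgeFn_continuous hσ hc fun θ hθ h => by
              have := (hcase θ hθ θ hθ h h).1
              rwa [← two_mul] at this
        _ ≤ (1 + 1 / c) * (2 * B * R * s) := by gcongr
        _ = (1 + 1 / c) * (2 * B * R) * s := by ring
        _ ≤ _ := mul_le_mul_of_nonneg_right (by linarith) hs0.le
  -- The lower bound can fail only if σ is near -1 and s is bounded below. Then 1 ≤ 2Rs, and the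
  -- crude O(1) bounds can be multiplied by powers of 2Rs.
  · have hσ2 : σ < -(1 / 2) := by
      by_contra h
      refine hcase fun θ _ φ _ _ _ => ?_
      have h1 : c ≤ (1 - |σ|) ^ 2 := by
        refine pow_le_pow_left₀ hm.le ?_ 2
        have h3 : min ε (1 / 2) ≤ ε := min_le_left _ _
        have h4 : min ε (1 / 2) ≤ 1 / 2 := min_le_right _ _
        have : |σ| ≤ 1 - min ε (1 / 2) := _root_.abs_le.2 ⟨by linarith, by linarith⟩
        linarith
      exact ⟨h1.trans (dker_ge _ _), h1.trans (dker_ge _ _)⟩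
    have hsR : 1 / 2 < s ^ 2 * R ^ 2 := by
      by_contra h
      refine hcase fun θ _ φ _ h1 h2 => ?_
      obtain ⟨h3, h4⟩ := hg.dker_ge_of_edgeFn_ne_zero hs0 (not_lt.1 h)
        (by linarith : σ ≤ 0) h1 h2
      exact ⟨hc1.trans h3, hc1.trans h4⟩
    have h1s : 1 ≤ 2 * R * s := by
      by_contra h
      have : 0 < 2 * R * s := by positivity
      nlinarith
    have h1t : 1 ≤ 2 * R ^ 2 * s ^ 2 := by linarith
    refine ⟨?_, ?_, ?_⟩
    · have h1 := abs_Vtr2Formula_neg_le (τ := -σ) (hg.edgeFn_lip hs0)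
        ⟨by linarith, by linarith [(abs_lt.1 hσ).1]⟩
      rw [neg_neg] at h1
      have h2 : B / s ^ 2 ≤ B * (2 * R ^ 2) := by
        rw [div_le_iff₀ (pow_pos hs0 2)]
        nlinarith
      calc _ ≤ 4 * (B / s ^ 2) ^ 2 := h1
        _ ≤ 4 * (B * (2 * R ^ 2)) ^ 2 := by gcongr
        _ = 16 * B ^ 2 * R ^ 4 * 1 := by ring
        _ ≤ 16 * B ^ 2 * R ^ 4 * (2 * R * s) := mul_le_mul_of_nonneg_left h1s (by positivity)
        _ = 32 * B ^ 2 * R ^ 5 * s := by ring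
        _ ≤ _ := mul_le_mul_of_nonneg_right (by linarith) hs0.le
    · calc _ ≤ 2 * B ^ 2 := abs_Vd2Formula_neg_le hg.edgeFn_abs_le hσ
        _ = 2 * B ^ 2 * 1 ^ 2 := by ring
        _ ≤ 2 * B ^ 2 * (2 * R ^ 2 * s ^ 2) ^ 2 := by gcongr
        _ = 8 * B ^ 2 * R ^ 4 * s ^ 4 := by ring
        _ ≤ _ := mul_le_mul_of_nonneg_right (by linarith) (by positivity)
    · calc _ ≤ 2 * B := abs_EtrFormula_le hg.edgeFn_abs_le hσ
        _ = 2 * B * 1 := by ring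
        _ ≤ 2 * B * (2 * R * s) := mul_le_mul_of_nonneg_left h1s (by positivity)
        _ = 4 * B * R * s := by ring
        _ ≤ _ := mul_le_mul_of_nonneg_right (by linarith) hs0.le

end IsProfile


/-! ### The edge variable `u` in `x = 2 - s²u²` -/

section EdgeVariable

variable {s : ℝ}

theorem integral_edge_subst (hs : 0 < s) (G : ℝ → ℝ) :
    ∫ x in (-2 : ℝ)..2, G x = ∫ u in Ioo 0 (2 / s), 2 * s ^ 2 * u * G (2 - s ^ 2 * u ^ 2) := by
  have hs2 : 0 < s ^ 2 := pow_pos hs 2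
  have himg : (fun u => 2 - s ^ 2 * u ^ 2) '' Ioo 0 (2 / s) = Ioo (-2) 2 := by
    ext x
    constructor
    · rintro ⟨u, ⟨h1, h2⟩, rfl⟩
      rw [lt_div_iff₀ hs] at h2
      have h3 : 0 < u * s := mul_pos h1 hs
      constructor <;> simp only <;> nlinarith
    · rintro ⟨h1, h2⟩
      have h3 : 0 < Real.sqrt (2 - x) := Real.sqrt_pos.2 (by linarith)
      have h4 : Real.sqrt (2 - x) < 2 := (Real.sqrt_lt' two_pos).2 (by linarith)
      refine ⟨Real.sqrt (2 - x) / s, ⟨div_pos h3 hs, div_lt_div_of_pos_right h4 hs⟩, ?_⟩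
      simp only
      rw [div_pow, Real.sq_sqrt (by linarith), mul_div_cancel₀ _ hs2.ne']
      ring
  have hinj : InjOn (fun u => 2 - s ^ 2 * u ^ 2) (Ioo 0 (2 / s)) := fun a ha b hb hab => by
    have h1 : s ^ 2 * a ^ 2 = s ^ 2 * b ^ 2 := by
      simp only at hab; linarith
    exact (pow_left_inj₀ ha.1.le hb.1.le two_ne_zero).1 (mul_left_cancel₀ hs2.ne' h1)
  have hd : ∀ u ∈ Ioo 0 (2 / s), HasDerivWithinAt (fun u => 2 - s ^ 2 * u ^ 2)
      (-(2 * s ^ 2 * u)) (Ioo 0 (2 / s)) u := fun u _ => by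
    refine ((((hasDerivAt_id u).pow 2).const_mul (s ^ 2)).const_sub 2).hasDerivWithinAt.congr_deriv ?_
    simp; ring
  rw [intervalIntegral.integral_of_le (by norm_num), integral_Ioc_eq_integral_Ioo, ← himg,
    integral_image_eq_integral_abs_deriv_smul measurableSet_Ioo hd hinj]
  refine setIntegral_congr_fun measurableSet_Ioo fun u hu => ?_
  have := hu.1
  simp only [smul_eq_mul]
  rw [abs_neg, abs_of_pos (by positivity)]

/-- `Real.sqrt` of a negative number is 0, so integrands on (0, 2/s) extend by zero to the half-line
without an explicit cutoff. -/
theorem sqrt_four_sub_eq_zero (hs : 0 < s) {u : ℝ} (hu : 2 / s ≤ u) :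
    Real.sqrt (4 - s ^ 2 * u ^ 2) = 0 := by
  rw [div_le_iff₀ hs] at hu
  exact Real.sqrt_eq_zero_of_nonpos (by nlinarith)

theorem setIntegral_Ioo_eq_Ioi {F : ℝ → ℝ} {T : ℝ} (h : ∀ u, T ≤ u → F u = 0) :
    ∫ u in Ioo 0 T, F u = ∫ u in Ioi 0, F u := by
  refine (setIntegral_eq_of_subset_of_forall_sdiff_eq_zero measurableSet_Ioi
    Ioo_subset_Ioi_self fun u hu => h u ?_).symm
  by_contra h1
  exact hu.2 ⟨hu.1, not_le.1 h1⟩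

theorem sqrt_four_sub_edge_sq (hs : 0 < s) {u : ℝ} (hu : 0 < u) :
    Real.sqrt (4 - (2 - s ^ 2 * u ^ 2) ^ 2) = s * u * Real.sqrt (4 - s ^ 2 * u ^ 2) := by
  rw [show 4 - (2 - s ^ 2 * u ^ 2) ^ 2 = (s * u) ^ 2 * (4 - s ^ 2 * u ^ 2) by ring,
    Real.sqrt_mul (sq_nonneg _), Real.sqrt_sq (mul_pos hs hu).le]

theorem edgeFn_edge (hs : 0 < s) (g : ℝ → ℝ) (u : ℝ) :
    edgeFn g s (2 - s ^ 2 * u ^ 2) = g (-u ^ 2) := by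
  rw [edgeFn]
  congr 1
  field_simp
  ring

theorem sqrt_four_sub_le_two (p : ℝ) (hp : 0 ≤ p) : Real.sqrt (4 - p) ≤ 2 :=
  (Real.sqrt_le_left two_pos.le).2 (by linarith)

theorem abs_sqrt_four_sub_sub_two_le {p : ℝ} (hp : 0 ≤ p) :
    |Real.sqrt (4 - p) - 2| ≤ p / 2 := by
  have h1 := sqrt_four_sub_le_two p hp
  have h0 := Real.sqrt_nonneg (4 - p)
  rw [abs_of_nonpos (by linarith)]
  rcases le_or_gt p 4 with h | h
  · have h2 := Real.sq_sqrt (by linarith : 0 ≤ 4 - p)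
    nlinarith
  · linarith

/-- Unlike p/2, this majorant stays bounded for large p; with p = s²u² it is u² times an integrable
function whose integral is πs. -/
theorem abs_sqrt_four_sub_sub_two_le' {p : ℝ} (hp : 0 ≤ p) :
    |Real.sqrt (4 - p) - 2| ≤ 4 * p / (4 + p) := by
  have h1 := sqrt_four_sub_le_two p hp
  have h0 := Real.sqrt_nonneg (4 - p)
  rw [le_div_iff₀ (by linarith)]
  rcases le_or_gt p 4 with h | h
  · have h3 := abs_sqrt_four_sub_sub_two_le hp
    nlinarith
  · rw [Real.sqrt_eq_zero_of_nonpos (by linarith), zero_sub, abs_neg, abs_two]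
    linarith

theorem integrableOn_and_integral_four_mul_sq_div (hs : 0 < s) :
    IntegrableOn (fun u : ℝ => 4 * s ^ 2 / (4 + s ^ 2 * u ^ 2)) (Ioi 0) ∧
      ∫ u in Ioi (0 : ℝ), 4 * s ^ 2 / (4 + s ^ 2 * u ^ 2) = Real.pi * s := by
  have hd : ∀ u ∈ Ici (0 : ℝ), HasDerivAt (fun u => 2 * s * Real.arctan (s / 2 * u))
      (4 * s ^ 2 / (4 + s ^ 2 * u ^ 2)) u := fun u _ => by
    refine ((((hasDerivAt_id u).const_mul (s / 2)).arctan).const_mul (2 * s)).congr_deriv ?_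
    have h1 : 4 + s ^ 2 * u ^ 2 ≠ 0 := by positivity
    simp only [id]
    rw [show 1 + (s / 2 * u) ^ 2 = (4 + s ^ 2 * u ^ 2) / 4 by ring]
    field_simp
  have hp : ∀ u ∈ Ioi (0 : ℝ), 0 ≤ 4 * s ^ 2 / (4 + s ^ 2 * u ^ 2) := fun u _ => by positivity
  have ht : Tendsto (fun u => 2 * s * Real.arctan (s / 2 * u)) atTop (𝓝 (Real.pi * s)) := by
    have h1 : Tendsto (fun u => s / 2 * u) atTop atTop :=
      tendsto_id.const_mul_atTop (by positivity)
    have h2 := ((tendsto_nhds_of_tendsto_nhdsWithin Real.tendsto_arctan_atTop).comp h1).const_mul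
      (2 * s)
    rw [show 2 * s * (Real.pi / 2) = Real.pi * s by ring] at h2
    exact h2
  refine ⟨integrableOn_Ioi_deriv_of_nonneg' hd hp ht, ?_⟩
  rw [integral_Ioi_of_hasDerivAt_of_nonneg' hd hp ht]
  simp

end EdgeVariable

/-! ### The first diagonal variance -/

theorem l2NormSq_even {h : ℝ → ℝ} (he : ∀ x, h (-x) ^ 2 = h x ^ 2) :
    l2NormSq h = 2 * ∫ x in Ioi 0, h x ^ 2 := by
  rw [l2NormSq, ← integral_comp_abs]
  refine integral_congr_ae (Eventually.of_forall fun x => ?_)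
  rcases abs_choice x with h | h <;> simp only [h, he]

namespace IsProfile

variable {g : ℝ → ℝ} {B R s : ℝ}

theorem comp_neg_sq_eq_zero (h : IsProfile g B R) {u : ℝ} (hu : R ≤ u) : g (-u ^ 2) = 0 :=
  h.eq_zero _ (by
    rw [abs_neg, abs_of_nonneg (sq_nonneg u)]
    exact pow_le_pow_left₀ (zero_le_one.trans h.one_le) hu 2)

theorem integrableOn_Ioi (h : IsProfile g B R) {F : ℝ → ℝ} (hF : Continuous F)
    (h0 : ∀ u, R ≤ u → F u = 0) : IntegrableOn F (Ioi 0) := by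
  have h1 : IntegrableOn F (Ioc 0 R) :=
    (hF.continuousOn.integrableOn_compact isCompact_Icc).mono_set Ioc_subset_Icc_self
  have h2 : IntegrableOn F (Ioi R) :=
    integrableOn_zero.congr_fun (fun u hu => (h0 u (le_of_lt hu)).symm) measurableSet_Ioi
  rw [← Ioc_union_Ioi_eq_Ioi (zero_le_one.trans h.one_le)]
  exact h1.union h2

theorem abs_setIntegral_Ioi_le (h : IsProfile g B R) {F : ℝ → ℝ} {c : ℝ}
    (h0 : ∀ u, R ≤ u → F u = 0) (hc : ∀ u ∈ Ioo 0 R, |F u| ≤ c) :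
    |∫ u in Ioi 0, F u| ≤ c * R := by
  have hR := zero_le_one.trans h.one_le
  rw [← setIntegral_Ioo_eq_Ioi h0]
  have := norm_setIntegral_le_of_norm_le_const (μ := volume) (s := Ioo 0 R) (f := F) (C := c)
    measure_Ioo_lt_top hc
  simpa [measureReal_def, Real.volume_Ioo, ENNReal.toReal_ofReal hR] using this

/-- The integral in u is exact except for √(4 - s²u²), which is replaced by 2; on u ≤ R this costs a
relative s². -/
theorem abs_meanSc_edgeFn_sq_sub_le (h : IsProfile g B R) (hs : 0 < s) :
    |meanSc (fun x => edgeFn g s x ^ 2) - s ^ 3 * (l2NormSq (fun x => g (-x ^ 2) * x) / Real.pi)| ≤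
      B ^ 2 * R ^ 5 * s ^ 5 := by
  have hg := h.continuous
  have hB := h.nonneg
  have hR := zero_le_one.trans h.one_le
  have e1 : meanSc (fun x => edgeFn g s x ^ 2) = s ^ 3 / Real.pi *
      ∫ u in Ioi 0, g (-u ^ 2) ^ 2 * u ^ 2 * Real.sqrt (4 - s ^ 2 * u ^ 2) := by
    rw [meanSc, integral_edge_subst hs, ← setIntegral_Ioo_eq_Ioi (T := 2 / s)
      (fun u hu => by rw [sqrt_four_sub_eq_zero hs hu, mul_zero]), ← integral_const_mul]
    refine setIntegral_congr_fun measurableSet_Ioo fun u hu => ?_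
    rw [edgeFn_edge hs, rhoSc, sqrt_four_sub_edge_sq hs hu.1]
    field_simp
  have e2 : l2NormSq (fun x => g (-x ^ 2) * x) = ∫ u in Ioi 0, g (-u ^ 2) ^ 2 * u ^ 2 * 2 := by
    rw [l2NormSq_even (fun x => by simp only [neg_sq]; ring), integral_mul_const, mul_comm]
    simp only [mul_pow]
  have hz : ∀ (F : ℝ → ℝ) u, R ≤ u → g (-u ^ 2) ^ 2 * u ^ 2 * F u = 0 := fun F u hu => by
    rw [h.comp_neg_sq_eq_zero hu]; ring
  have e3 : meanSc (fun x => edgeFn g s x ^ 2) -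
      s ^ 3 * (l2NormSq (fun x => g (-x ^ 2) * x) / Real.pi) = s ^ 3 / Real.pi *
        ∫ u in Ioi 0, g (-u ^ 2) ^ 2 * u ^ 2 * (Real.sqrt (4 - s ^ 2 * u ^ 2) - 2) := by
    simp only [mul_sub]
    rw [integral_sub (h.integrableOn_Ioi (by fun_prop) (hz _))
      (h.integrableOn_Ioi (by fun_prop) (hz _)), ← e2, e1]
    ring
  have h1 : |∫ u in Ioi 0, g (-u ^ 2) ^ 2 * u ^ 2 * (Real.sqrt (4 - s ^ 2 * u ^ 2) - 2)| ≤
      B ^ 2 * R ^ 2 * (s ^ 2 * R ^ 2 / 2) * R := by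
    refine h.abs_setIntegral_Ioi_le (hz _) fun u hu => ?_
    have hu2 : u ^ 2 ≤ R ^ 2 := pow_le_pow_left₀ hu.1.le hu.2.le 2
    have hb : |g (-u ^ 2)| ≤ B := h.abs_le _
    rw [abs_mul, abs_mul, abs_pow, abs_of_nonneg (sq_nonneg u)]
    have h2 := abs_sqrt_four_sub_sub_two_le (p := s ^ 2 * u ^ 2) (by positivity)
    calc _ ≤ B ^ 2 * R ^ 2 * (s ^ 2 * u ^ 2 / 2) := by gcongr
      _ ≤ B ^ 2 * R ^ 2 * (s ^ 2 * R ^ 2 / 2) := by gcongr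
  have hpi : 1 ≤ 2 * Real.pi := by linarith [Real.pi_gt_three]
  rw [e3, abs_mul, abs_of_pos (by positivity : 0 < s ^ 3 / Real.pi)]
  calc _ ≤ s ^ 3 / Real.pi * (B ^ 2 * R ^ 2 * (s ^ 2 * R ^ 2 / 2) * R) := by gcongr
    _ = B ^ 2 * R ^ 5 * s ^ 5 / (2 * Real.pi) := by field_simp
    _ ≤ _ := div_le_self (by positivity) hpi

theorem l2NormSq_le (h : IsProfile g B R) :
    l2NormSq (fun x => g (-x ^ 2) * x) ≤ 2 * B ^ 2 * R ^ 3 := by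
  have hB := h.nonneg
  rw [l2NormSq_even (fun x => by simp only [neg_sq]; ring)]
  have h1 : |∫ u in Ioi 0, (g (-u ^ 2) * u) ^ 2| ≤ B ^ 2 * R ^ 2 * R := by
    refine h.abs_setIntegral_Ioi_le (fun u hu => by rw [h.comp_neg_sq_eq_zero hu]; ring)
      fun u hu => ?_
    have hu2 : u ^ 2 ≤ R ^ 2 := pow_le_pow_left₀ hu.1.le hu.2.le 2
    have hb : |g (-u ^ 2)| ≤ B := h.abs_le _
    rw [mul_pow, abs_mul, abs_pow, abs_of_nonneg (sq_nonneg u)]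
    gcongr
  have := (le_abs_self _).trans h1
  linarith

/-- Asymptotics of the first diagonal variance at the edge. -/
theorem abs_Vd1_edgeFn_sub_le (h : IsProfile g B R) (hs : 0 < s) (hs1 : s ≤ 1) :
    |Vd1 (edgeFn g s) - s ^ 3 * (l2NormSq (fun x => g (-x ^ 2) * x) / Real.pi)| ≤
      (B ^ 2 * R ^ 5 + 4 * B ^ 2 * R ^ 6) * s ^ 4 := by
  have hB := h.nonneg
  have hR := zero_le_one.trans h.one_le
  have h1 := h.abs_meanSc_edgeFn_sq_sub_le hs
  have h2 : |meanSc (edgeFn g s)| ≤ 2 * B * R ^ 3 * s ^ 3 :=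
    abs_meanSc_le.trans (h.integral_abs_edgeFn_mul_sin_sq_le hs)
  have h3 : |meanSc (edgeFn g s) ^ 2| ≤ (2 * B * R ^ 3 * s ^ 3) ^ 2 := by
    rw [abs_pow]; exact pow_le_pow_left₀ (abs_nonneg _) h2 2
  have s5 : s ^ 5 ≤ s ^ 4 := pow_le_pow_of_le_one hs.le hs1 (by norm_num)
  have s6 : s ^ 6 ≤ s ^ 4 := pow_le_pow_of_le_one hs.le hs1 (by norm_num)
  rw [Vd1, sub_right_comm]
  refine (abs_sub _ _).trans ((add_le_add h1 h3).trans ?_)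
  calc B ^ 2 * R ^ 5 * s ^ 5 + (2 * B * R ^ 3 * s ^ 3) ^ 2
      = B ^ 2 * R ^ 5 * s ^ 5 + 4 * B ^ 2 * R ^ 6 * s ^ 6 := by ring
    _ ≤ B ^ 2 * R ^ 5 * s ^ 4 + 4 * B ^ 2 * R ^ 6 * s ^ 4 := by gcongr
    _ = _ := by ring

end IsProfile

/-! ### The density factor -/

/-- The imaginary part of 1/(x - z) is s²/((x - 2)² + s⁴), and x - 2 = -s²u² makes its denominator
s⁴(1 + u⁴). -/
theorem rhoC_edge {s : ℝ} (hs : 0 < s) :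
    rhoC ((2 : ℝ) + Complex.I * ((s ^ 2 : ℝ) : ℂ)) = s / Real.pi ^ 2 *
      ∫ u in Ioi 0, u ^ 2 / (1 + u ^ 4) * Real.sqrt (4 - s ^ 2 * u ^ 2) := by
  have hs2 : 0 < s ^ 2 := pow_pos hs 2
  set z : ℂ := (2 : ℝ) + Complex.I * ((s ^ 2 : ℝ) : ℂ) with hz
  have hre : ∀ x : ℝ, ((x : ℂ) - z).re = x - 2 := fun x => by
    simp only [hz, Complex.sub_re, Complex.add_re, Complex.mul_re, Complex.ofReal_im,
      Complex.I_re, Complex.I_im, Complex.ofReal_re]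
    ring
  have him : ∀ x : ℝ, ((x : ℂ) - z).im = -s ^ 2 := fun x => by
    simp only [hz, Complex.sub_im, Complex.add_im, Complex.mul_im, Complex.ofReal_im,
      Complex.I_re, Complex.I_im, Complex.ofReal_re]
    ring
  have hne : ∀ x : ℝ, (x : ℂ) - z ≠ 0 := fun x h => by
    have := him x
    rw [h, Complex.zero_im] at this
    linarith
  have hcont : Continuous fun x : ℝ => (rhoSc x : ℂ) / ((x : ℂ) - z) := by
    refine Continuous.div ?_ (by fun_prop) hne
    unfold rhoSc
    fun_prop
  have e1 : (mSc z).im = ∫ x in (-2 : ℝ)..2, rhoSc x * (s ^ 2 / ((x - 2) ^ 2 + s ^ 4)) := by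
    rw [mSc, intervalIntegral.integral_of_le (by norm_num), intervalIntegral.integral_of_le
      (by norm_num)]
    have hi : IntegrableOn (fun x : ℝ => (rhoSc x : ℂ) / ((x : ℂ) - z)) (Ioc (-2) 2) :=
      (hcont.continuousOn.integrableOn_compact isCompact_Icc).mono_set Ioc_subset_Icc_self
    have h1 := integral_im hi
    simp only [RCLike.im_to_complex] at h1
    rw [← h1]
    refine setIntegral_congr_fun measurableSet_Ioc fun x _ => ?_
    rw [Complex.div_im, Complex.ofReal_im, Complex.ofReal_re, Complex.normSq_apply, hre, him]
    ring
  have e2 : ∫ x in (-2 : ℝ)..2, rhoSc x * (s ^ 2 / ((x - 2) ^ 2 + s ^ 4)) = s / Real.pi *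
      ∫ u in Ioi 0, u ^ 2 / (1 + u ^ 4) * Real.sqrt (4 - s ^ 2 * u ^ 2) := by
    rw [integral_edge_subst hs, ← setIntegral_Ioo_eq_Ioi (T := 2 / s)
      (fun u hu => by rw [sqrt_four_sub_eq_zero hs hu, mul_zero]), ← integral_const_mul]
    refine setIntegral_congr_fun measurableSet_Ioo fun u hu => ?_
    rw [rhoSc, sqrt_four_sub_edge_sq hs hu.1,
      show (2 - s ^ 2 * u ^ 2 - 2) ^ 2 + s ^ 4 = s ^ 4 * (1 + u ^ 4) by ring]
    have : 1 + u ^ 4 ≠ 0 := by positivity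
    field_simp
  have h0 : 0 ≤ ∫ u in Ioi 0, u ^ 2 / (1 + u ^ 4) * Real.sqrt (4 - s ^ 2 * u ^ 2) :=
    integral_nonneg fun u => by positivity
  rw [rhoC, e1, e2, abs_of_nonneg (by positivity)]
  field_simp

theorem integrableOn_and_integral_sq_div_one_add_pow_four :
    IntegrableOn (fun u : ℝ => u ^ 2 / (1 + u ^ 4)) (Ioi 0) ∧
      ∫ u in Ioi (0 : ℝ), u ^ 2 / (1 + u ^ 4) = Real.pi / (2 * Real.sqrt 2) := by
  set r := Real.sqrt 2 with hr
  have hr2 : r ^ 2 = 2 := Real.sq_sqrt two_pos.le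
  have hr0 : 0 < r := Real.sqrt_pos.2 two_pos
  have hA : ∀ u : ℝ, 0 < u ^ 2 - r * u + 1 := fun u => by nlinarith [sq_nonneg (u * r - 1)]
  have hB : ∀ u : ℝ, 0 < u ^ 2 + r * u + 1 := fun u => by nlinarith [sq_nonneg (u * r + 1)]
  have hAB : ∀ u : ℝ, 1 + u ^ 4 = (u ^ 2 - r * u + 1) * (u ^ 2 + r * u + 1) := fun u => by
    linear_combination u ^ 2 * hr2
  -- Primitive from partial fractions over 1 + u⁴ = (u² - √2 u + 1)(u² + √2 u + 1).
  set H : ℝ → ℝ := fun u => 1 / (4 * r) * (Real.log (u ^ 2 - r * u + 1) -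
    Real.log (u ^ 2 + r * u + 1)) + 1 / (2 * r) * (Real.arctan (r * u + 1) +
      Real.arctan (r * u - 1)) with hH
  have hd : ∀ u ∈ Ici (0 : ℝ), HasDerivAt H (u ^ 2 / (1 + u ^ 4)) u := fun u _ => by
    have a1 : HasDerivAt (fun u => u ^ 2 - r * u + 1) (2 * u - r) u := by
      refine ((((hasDerivAt_id u).pow 2).sub ((hasDerivAt_id u).const_mul r)).add_const 1).congr_deriv ?_
      simp
    have a2 : HasDerivAt (fun u => u ^ 2 + r * u + 1) (2 * u + r) u := by
      refine ((((hasDerivAt_id u).pow 2).add ((hasDerivAt_id u).const_mul r)).add_const 1).congr_deriv ?_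
      simp
    have a3 := (((hasDerivAt_id u).const_mul r).add_const 1).arctan
    have a4 := (((hasDerivAt_id u).const_mul r).sub_const 1).arctan
    refine ((((a1.log (hA u).ne').sub (a2.log (hB u).ne')).const_mul (1 / (4 * r))).add
      ((a3.add a4).const_mul (1 / (2 * r)))).congr_deriv ?_
    have b1 := (hA u).ne'
    have b2 := (hB u).ne'
    have b3 : u ^ 2 + r * u + 1 = u ^ 2 - r * u + 1 + 2 * r * u := by ring
    simp only [id]
    rw [hAB, show 1 + (r * u + 1) ^ 2 = 2 * (u ^ 2 + r * u + 1) by linear_combination u ^ 2 * hr2,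
      show 1 + (r * u - 1) ^ 2 = 2 * (u ^ 2 - r * u + 1) by linear_combination u ^ 2 * hr2]
    generalize u ^ 2 - r * u + 1 = p at b1 b3 ⊢
    generalize u ^ 2 + r * u + 1 = q at b2 b3 ⊢
    field_simp
    rw [b3]
    ring
  have hp : ∀ u ∈ Ioi (0 : ℝ), 0 ≤ u ^ 2 / (1 + u ^ 4) := fun u _ => by positivity
  have ht : Tendsto H atTop (𝓝 (Real.pi / (2 * r))) := by
    have c1 : Tendsto (fun u : ℝ => r * u) atTop atTop := tendsto_id.const_mul_atTop hr0
    have c2 := (tendsto_nhds_of_tendsto_nhdsWithin Real.tendsto_arctan_atTop).comp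
      (tendsto_atTop_add_const_right atTop 1 c1)
    have c3 := (tendsto_nhds_of_tendsto_nhdsWithin Real.tendsto_arctan_atTop).comp
      (tendsto_atTop_add_const_right atTop (-1) c1)
    have c4 : Tendsto (fun u : ℝ => (1 - r * u⁻¹ + u⁻¹ ^ 2) / (1 + r * u⁻¹ + u⁻¹ ^ 2)) atTop
        (𝓝 ((1 - r * 0 + 0 ^ 2) / (1 + r * 0 + 0 ^ 2))) := by
      have c5 := tendsto_inv_atTop_zero (𝕜 := ℝ)
      exact ((((c5.const_mul r).const_sub 1).add (c5.pow 2)).div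
        (((c5.const_mul r).const_add 1).add (c5.pow 2)) (by norm_num))
    have c6 : Tendsto (fun u : ℝ => Real.log (u ^ 2 - r * u + 1) - Real.log (u ^ 2 + r * u + 1))
        atTop (𝓝 0) := by
      have c7 := (Real.continuousAt_log (x := (1 - r * 0 + 0 ^ 2) / (1 + r * 0 + 0 ^ 2))
        (by norm_num)).tendsto.comp c4
      rw [show Real.log ((1 - r * 0 + 0 ^ 2) / (1 + r * 0 + 0 ^ 2)) = 0 by norm_num] at c7
      refine c7.congr' ?_
      filter_upwards [eventually_gt_atTop 0] with u hu
      simp only [Function.comp_apply]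
      rw [← Real.log_div (hA u).ne' (hB u).ne']
      congr 1
      rw [← mul_div_mul_left (1 - r * u⁻¹ + u⁻¹ ^ 2) _ (pow_ne_zero 2 hu.ne')]
      congr 1 <;> field_simp
    have c8 := (c6.const_mul (1 / (4 * r))).add ((c2.add c3).const_mul (1 / (2 * r)))
    rw [show 1 / (4 * r) * 0 + 1 / (2 * r) * (Real.pi / 2 + Real.pi / 2) = Real.pi / (2 * r) by
      field_simp; ring] at c8
    exact c8
  refine ⟨integrableOn_Ioi_deriv_of_nonneg' hd hp ht, ?_⟩
  rw [integral_Ioi_of_hasDerivAt_of_nonneg' hd hp ht, hH]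
  simp

/-- Closeness of the rescaled inverse density factor to its limit. -/
theorem abs_inv_rhoC_edge_sub_le {s : ℝ} (hs : 0 < s) (hs1 : s ≤ 1) :
    |s / rhoC ((2 : ℝ) + Complex.I * ((s ^ 2 : ℝ) : ℂ)) - Real.sqrt 2 * Real.pi| ≤ 400 * s := by
  obtain ⟨hi, hI⟩ := integrableOn_and_integral_sq_div_one_add_pow_four
  obtain ⟨ji, jI⟩ := integrableOn_and_integral_four_mul_sq_div hs
  set J := ∫ u in Ioi 0, u ^ 2 / (1 + u ^ 4) * Real.sqrt (4 - s ^ 2 * u ^ 2) with hJ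
  have hJi : IntegrableOn (fun u : ℝ => u ^ 2 / (1 + u ^ 4) * Real.sqrt (4 - s ^ 2 * u ^ 2))
      (Ioi 0) := by
    refine (hi.mul_const 2).mono' ?_ (Eventually.of_forall fun u => ?_)
    · exact Measurable.aestronglyMeasurable (by fun_prop)
    · rw [Real.norm_eq_abs, abs_of_nonneg (by positivity)]
      exact mul_le_mul_of_nonneg_left (sqrt_four_sub_le_two _ (by positivity)) (by positivity)
  have h1 : |J - Real.pi / (2 * Real.sqrt 2) * 2| ≤ Real.pi * s := by
    rw [← hI, ← integral_mul_const, hJ, ← integral_sub hJi (hi.mul_const 2), ← jI,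
      ← Real.norm_eq_abs]
    refine norm_integral_le_of_norm_le ji (Eventually.of_forall fun u => ?_)
    rw [← mul_sub, Real.norm_eq_abs, abs_mul, abs_of_nonneg (by positivity : 0 ≤ u ^ 2 / (1 + u ^ 4))]
    have h2 := abs_sqrt_four_sub_sub_two_le' (p := s ^ 2 * u ^ 2) (by positivity)
    calc _ ≤ u ^ 2 / (1 + u ^ 4) * (4 * (s ^ 2 * u ^ 2) / (4 + s ^ 2 * u ^ 2)) := by gcongr
      _ = u ^ 4 / (1 + u ^ 4) * (4 * s ^ 2 / (4 + s ^ 2 * u ^ 2)) := by ring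
      _ ≤ 1 * (4 * s ^ 2 / (4 + s ^ 2 * u ^ 2)) := by
          refine mul_le_mul_of_nonneg_right ?_ (by positivity)
          rw [div_le_one (by positivity)]
          linarith
      _ = _ := one_mul _
  -- On (0, 1] the integrand is at least u²/2; a lower bound on J is what permits dividing by the
  -- density.
  have h2 : 1 / 6 ≤ J := by
    have h3 : ∫ u in Ioc (0 : ℝ) 1, u ^ 2 / 2 ≤ J := by
      have k1 : ∫ u in Ioc (0 : ℝ) 1, u ^ 2 / 2 ≤
          ∫ u in Ioc (0 : ℝ) 1, u ^ 2 / (1 + u ^ 4) * Real.sqrt (4 - s ^ 2 * u ^ 2) := by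
        refine setIntegral_mono_on ?_ (hJi.mono_set Ioc_subset_Ioi_self) measurableSet_Ioc
          fun u hu => ?_
        · exact ((by fun_prop : Continuous fun u : ℝ => u ^ 2 / 2).continuousOn.integrableOn_compact
            isCompact_Icc).mono_set Ioc_subset_Icc_self
        · have q1 : s ^ 2 * u ^ 2 ≤ 1 * 1 :=
            mul_le_mul (pow_le_one₀ hs.le hs1) (pow_le_one₀ hu.1.le hu.2) (by positivity) zero_le_one
          have q2 : 1 ≤ Real.sqrt (4 - s ^ 2 * u ^ 2) := Real.one_le_sqrt.2 (by linarith)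
          have q3 : u ^ 4 ≤ 1 := pow_le_one₀ hu.1.le hu.2
          calc u ^ 2 / 2 ≤ u ^ 2 / (1 + u ^ 4) := by
                apply div_le_div_of_nonneg_left (sq_nonneg _) (by positivity) (by linarith)
            _ ≤ _ := le_mul_of_one_le_right (by positivity) q2
      refine k1.trans (setIntegral_mono_set hJi (Eventually.of_forall fun u => ?_)
        (Eventually.of_forall Ioc_subset_Ioi_self))
      simp only [Pi.zero_apply]
      positivity
    rw [← intervalIntegral.integral_of_le zero_le_one, intervalIntegral.integral_div,
      integral_pow] at h3
    norm_num at h3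
    linarith
  have hJ0 : 0 < J := by linarith
  have hr0 : 0 < Real.sqrt 2 := Real.sqrt_pos.2 two_pos
  have hr2 : Real.sqrt 2 ^ 2 = 2 := Real.sq_sqrt two_pos.le
  have e : s / rhoC ((2 : ℝ) + Complex.I * ((s ^ 2 : ℝ) : ℂ)) - Real.sqrt 2 * Real.pi =
      -(Real.sqrt 2 * Real.pi / J) * (J - Real.pi / (2 * Real.sqrt 2) * 2) := by
    rw [rhoC_edge hs, ← hJ]
    field_simp
    ring
  have hrle : Real.sqrt 2 ≤ 3 / 2 := (Real.sqrt_le_left (by norm_num)).2 (by norm_num)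
  have hpi := Real.pi_lt_d2
  have hpi0 := Real.pi_pos
  rw [e, abs_mul, abs_neg, abs_of_pos (by positivity : 0 < Real.sqrt 2 * Real.pi / J)]
  have h4 : Real.sqrt 2 * Real.pi / J ≤ 3 / 2 * 4 * 6 := by
    rw [div_le_iff₀ hJ0]
    nlinarith
  calc _ ≤ 3 / 2 * 4 * 6 * (4 * s) := by
        refine mul_le_mul h4 (h1.trans (by nlinarith)) (abs_nonneg _) (by norm_num)
    _ ≤ 400 * s := by linarith


/-! ### The first tracial variance at the edge. -/

/-- The squared difference quotient of `g` at `-u²` and `-v²`. -/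
def diffQuotSq (g : ℝ → ℝ) (u v : ℝ) : ℝ := ((g (-u ^ 2) - g (-v ^ 2)) / (u ^ 2 - v ^ 2)) ^ 2

/-- The kernel of the first tracial variance in the edge variables. -/
def edgeKer (s u v : ℝ) : ℝ :=
  4 * (2 * (u ^ 2 + v ^ 2) - s ^ 2 * u ^ 2 * v ^ 2) /
    (Real.sqrt (4 - s ^ 2 * u ^ 2) * Real.sqrt (4 - s ^ 2 * v ^ 2))

theorem diffQuotSq_comm (g : ℝ → ℝ) (u v : ℝ) : diffQuotSq g u v = diffQuotSq g v u := by
  rw [diffQuotSq, diffQuotSq, ← neg_sub (g (-v ^ 2)), ← neg_sub (v ^ 2), neg_div_neg_eq]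

theorem diffQuotSq_nonneg (g : ℝ → ℝ) (u v : ℝ) : 0 ≤ diffQuotSq g u v := sq_nonneg _

theorem edgeKer_comm (s u v : ℝ) : edgeKer s u v = edgeKer s v u := by
  rw [edgeKer, edgeKer, mul_comm (Real.sqrt _), add_comm, mul_right_comm]

theorem Vtr1_edgeFn_eq {s : ℝ} (hs : 0 < s) (g : ℝ → ℝ) :
    Vtr1 (edgeFn g s) = 1 / (4 * Real.pi ^ 2) *
      ∫ u in Ioi 0, ∫ v in Ioi 0, diffQuotSq g u v * edgeKer s u v := by
  -- Beyond 2/s the square root is 0 and division by it gives 0, so `edgeKer` carries its own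
  -- cutoff.
  have h0 : ∀ u v, 2 / s ≤ v → diffQuotSq g u v * edgeKer s u v = 0 := fun u v hv => by
    rw [edgeKer, sqrt_four_sub_eq_zero hs hv]; simp
  have h1 : ∀ u, 2 / s ≤ u → ∫ v in Ioi 0, diffQuotSq g u v * edgeKer s u v = 0 := fun u hu => by
    simp only [edgeKer, sqrt_four_sub_eq_zero hs hu]; simp
  rw [Vtr1, integral_edge_subst hs, ← setIntegral_Ioo_eq_Ioi h1]
  congr 1
  refine setIntegral_congr_fun measurableSet_Ioo fun u hu => ?_
  rw [integral_edge_subst hs, ← setIntegral_Ioo_eq_Ioi (h0 u), ← integral_const_mul]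
  refine setIntegral_congr_fun measurableSet_Ioo fun v hv => ?_
  have hu0 := hu.1
  have hv0 := hv.1
  have e1 : 0 ≤ 4 - (2 - s ^ 2 * v ^ 2) ^ 2 := by
    have := (lt_div_iff₀ hs).1 hv.2
    have h3 : 0 < v * s := mul_pos hv0 hs
    rw [show 4 - (2 - s ^ 2 * v ^ 2) ^ 2 = (v * s) ^ 2 * ((2 - v * s) * (2 + v * s)) by ring]
    exact mul_nonneg (sq_nonneg _) (mul_nonneg (by linarith) (by linarith))
  rw [edgeFn_edge hs, edgeFn_edge hs, Real.sqrt_mul' _ e1, sqrt_four_sub_edge_sq hs hu0,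
    sqrt_four_sub_edge_sq hs hv0,
    show 2 - s ^ 2 * u ^ 2 - (2 - s ^ 2 * v ^ 2) = -(s ^ 2 * (u ^ 2 - v ^ 2)) by ring,
    diffQuotSq, edgeKer, div_pow, div_pow, neg_sq, mul_pow]
  have h5 : ∀ w, 0 < w → w ∈ Ioo 0 (2 / s) → Real.sqrt (4 - s ^ 2 * w ^ 2) ≠ 0 := fun w hw hw2 => by
    have h6 := (lt_div_iff₀ hs).1 hw2.2
    have h7 : 0 < w * s := mul_pos hw hs
    refine (Real.sqrt_pos.2 ?_).ne'
    nlinarith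
  have h6 := h5 u hu0 hu
  have h7 := h5 v hv0 hv
  by_cases h8 : u ^ 2 - v ^ 2 = 0
  · simp [h8]
  · field_simp
    ring

theorem integrableOn_Ioi_inv_one_add_sq :
    IntegrableOn (fun v : ℝ => (1 + v ^ 2)⁻¹) (Ioi 0) :=
  integrable_inv_one_add_sq.integrableOn

/-- Integrability and integral of `1 / √(4 - s²v²)`, extended by zero. -/
theorem integrableOn_and_integral_inv_sqrt {s : ℝ} (hs : 0 < s) :
    IntegrableOn (fun v : ℝ => (Real.sqrt (4 - s ^ 2 * v ^ 2))⁻¹) (Ioi 0) ∧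
      ∫ v in Ioi (0 : ℝ), (Real.sqrt (4 - s ^ 2 * v ^ 2))⁻¹ = Real.pi / (2 * s) := by
  have hT : 0 < 2 / s := by positivity
  have hz : ∀ v, 2 / s ≤ v → (Real.sqrt (4 - s ^ 2 * v ^ 2))⁻¹ = 0 := fun v hv => by
    rw [sqrt_four_sub_eq_zero hs hv, inv_zero]
  have hcont : ContinuousOn (fun v => 1 / s * Real.arcsin (s / 2 * v)) (Icc 0 (2 / s)) :=
    (continuous_const.mul (Real.continuous_arcsin.comp (by fun_prop))).continuousOn
  have hd : ∀ v ∈ Ioo 0 (2 / s), HasDerivAt (fun v => 1 / s * Real.arcsin (s / 2 * v))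
      (Real.sqrt (4 - s ^ 2 * v ^ 2))⁻¹ v := fun v hv => by
    have h1 := (lt_div_iff₀ hs).1 hv.2
    have h2 : 0 < v * s := mul_pos hv.1 hs
    have h3 : HasDerivAt Real.arcsin (1 / Real.sqrt (1 - (s / 2 * v) ^ 2)) (s / 2 * v) :=
      Real.hasDerivAt_arcsin (by linarith) (by linarith)
    refine ((h3.comp v ((hasDerivAt_id v).const_mul (s / 2))).const_mul (1 / s)).congr_deriv ?_
    have h4 : Real.sqrt (4 - s ^ 2 * v ^ 2) = 2 * Real.sqrt (1 - (s / 2 * v) ^ 2) := by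
      rw [show 4 - s ^ 2 * v ^ 2 = 2 ^ 2 * (1 - (s / 2 * v) ^ 2) by ring,
        Real.sqrt_mul (by norm_num), Real.sqrt_sq two_pos.le]
    rw [h4, mul_inv]
    field_simp
  have hi := intervalIntegral.integrableOn_deriv_of_nonneg hcont hd fun v _ => by positivity
  have hi2 : IntegrableOn (fun v : ℝ => (Real.sqrt (4 - s ^ 2 * v ^ 2))⁻¹) (Ioi (2 / s)) :=
    integrableOn_zero.congr_fun (fun v hv => (hz v (le_of_lt hv)).symm) measurableSet_Ioi
  refine ⟨by rw [← Ioc_union_Ioi_eq_Ioi hT.le]; exact hi.union hi2, ?_⟩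
  rw [← setIntegral_Ioo_eq_Ioi hz, ← integral_Ioc_eq_integral_Ioo,
    ← intervalIntegral.integral_of_le hT.le, intervalIntegral.integral_eq_sub_of_hasDerivAt_of_le
      hT.le hcont hd ((intervalIntegrable_iff_integrableOn_Ioc_of_le hT.le).2 hi)]
  rw [show s / 2 * (2 / s) = 1 by field_simp, Real.arcsin_one, mul_zero, Real.arcsin_zero]
  field_simp
  ring

/-- Symmetrization of a product of an indicator and a function of one variable. -/
def symStrip (R : ℝ) (β : ℝ → ℝ) (p : ℝ × ℝ) : ℝ :=
  (Iio R).indicator 1 p.1 * β p.2 + β p.1 * (Iio R).indicator 1 p.2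

theorem integrable_and_integral_symStrip {R : ℝ} (hR : 0 ≤ R) {β : ℝ → ℝ}
    (hβ : IntegrableOn β (Ioi 0)) :
    Integrable (symStrip R β) ((volume.restrict (Ioi 0)).prod (volume.restrict (Ioi 0))) ∧
      ∫ p, symStrip R β p ∂((volume.restrict (Ioi 0)).prod (volume.restrict (Ioi 0))) =
        2 * R * ∫ v in Ioi 0, β v := by
  have h1 : Integrable ((Iio R).indicator (1 : ℝ → ℝ)) (volume.restrict (Ioi 0)) := by
    rw [integrable_indicator_iff measurableSet_Iio, IntegrableOn, Measure.restrict_restrict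
      measurableSet_Iio, Iio_inter_Ioi]
    exact integrableOn_const (by simp)
  have h2 : ∫ u in Ioi 0, (Iio R).indicator (1 : ℝ → ℝ) u = R := by
    rw [setIntegral_indicator measurableSet_Iio, Ioi_inter_Iio]
    simp [hR]
  have h3 := h1.mul_prod hβ
  have h4 := Integrable.mul_prod hβ h1
  refine ⟨h3.add h4, ?_⟩
  unfold symStrip
  rw [integral_add h3 h4, integral_prod_mul, integral_prod_mul, h2]
  ring

namespace IsProfile

variable {g : ℝ → ℝ} {B R s : ℝ}

theorem diffQuotSq_le (h : IsProfile g B R) (u v : ℝ) : diffQuotSq g u v ≤ B ^ 2 := by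
  have hB := h.nonneg
  rw [diffQuotSq, ← sq_abs, abs_div]
  refine pow_le_pow_left₀ (by positivity) (div_le_of_le_mul₀ (abs_nonneg _) hB ?_) 2
  refine (h.lip _ _).trans_eq ?_
  rw [abs_sub_comm]
  congr 2
  ring

theorem diffQuotSq_eq_zero (h : IsProfile g B R) {u v : ℝ} (hu : R ≤ u) (hv : R ≤ v) :
    diffQuotSq g u v = 0 := by
  rw [diffQuotSq, h.comp_neg_sq_eq_zero hu, h.comp_neg_sq_eq_zero hv]; simp

/-- For v < 2R the Lipschitz bound gives 50 = 2·5·5; for v ≥ 2R only g(-u²) remains and the quotient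
decays like v⁻⁴, leaving v⁻² after the weight. -/
theorem two_mul_diffQuotSq_le (h : IsProfile g B R) {u v : ℝ} (hu : 0 < u) (hv : 0 < v)
    (huR : u < R) : diffQuotSq g u v * (2 * (u ^ 2 + v ^ 2)) ≤
      50 * B ^ 2 * R ^ 4 * (1 + v ^ 2)⁻¹ := by
  have hB := h.nonneg
  have hR := h.one_le
  have hR2 : 1 ≤ R ^ 2 := one_le_pow₀ hR
  have hu2 : u ^ 2 ≤ R ^ 2 := pow_le_pow_left₀ hu.le huR.le 2
  rw [← div_eq_mul_inv, le_div_iff₀ (by positivity)]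
  rcases lt_or_ge v (2 * R) with h1 | h1
  · have hv2 : v ^ 2 ≤ (2 * R) ^ 2 := pow_le_pow_left₀ hv.le h1.le 2
    calc diffQuotSq g u v * (2 * (u ^ 2 + v ^ 2)) * (1 + v ^ 2)
        ≤ B ^ 2 * (2 * (R ^ 2 + (2 * R) ^ 2)) * (R ^ 2 + (2 * R) ^ 2) := by
          have := h.diffQuotSq_le u v
          have := diffQuotSq_nonneg g u v
          gcongr
      _ = 50 * B ^ 2 * R ^ 4 := by ring
  · have hv2 : (2 * R) ^ 2 ≤ v ^ 2 := pow_le_pow_left₀ (by linarith) h1 2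
    have h2 : g (-v ^ 2) = 0 := h.comp_neg_sq_eq_zero (by linarith)
    have h3 : |g (-u ^ 2)| ≤ B := h.abs_le _
    have h4 : 3 / 4 * v ^ 2 ≤ v ^ 2 - u ^ 2 := by nlinarith
    have hv0 : 0 < v ^ 2 := pow_pos hv 2
    have h5 : diffQuotSq g u v ≤ (B / (3 / 4 * v ^ 2)) ^ 2 := by
      have h6 : 0 < v ^ 2 - u ^ 2 := by linarith
      rw [diffQuotSq, h2, sub_zero, ← sq_abs, abs_div, abs_sub_comm, abs_of_pos h6]
      exact pow_le_pow_left₀ (div_nonneg (abs_nonneg _) h6.le)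
        (div_le_div₀ hB h3 (by positivity) h4) 2
    have h6 : 2 * (u ^ 2 + v ^ 2) ≤ 5 / 2 * v ^ 2 := by nlinarith
    have h7 : 1 + v ^ 2 ≤ 2 * v ^ 2 := by nlinarith
    calc diffQuotSq g u v * (2 * (u ^ 2 + v ^ 2)) * (1 + v ^ 2)
        ≤ (B / (3 / 4 * v ^ 2)) ^ 2 * (5 / 2 * v ^ 2) * (2 * v ^ 2) := by gcongr
      _ = 80 / 9 * B ^ 2 * 1 := by field_simp; ring
      _ ≤ 50 * B ^ 2 * R ^ 4 := by
          have : 1 ≤ R ^ 4 := one_le_pow₀ hR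
          gcongr
          norm_num

/-- Difference of the kernels at finite and infinite scale. -/
theorem abs_edgeKer_sub_le (hs : 0 < s) (hR : 1 ≤ R) (hsR : s ^ 2 * R ^ 2 ≤ 1) {u v : ℝ} (hu : 0 < u)
    (hv : 0 < v) (huR : u < R) :
    |edgeKer s u v - 2 * (u ^ 2 + v ^ 2)| * (1 + v ^ 2)⁻¹ ≤ (2 * (u ^ 2 + v ^ 2)) *
      (2 * R ^ 2 * s ^ 2 * ((Real.sqrt (4 - s ^ 2 * v ^ 2))⁻¹ + 2 / (4 + s ^ 2 * v ^ 2))) := by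
  have hu2 : u ^ 2 ≤ R ^ 2 := pow_le_pow_left₀ hu.le huR.le 2
  have hR2 : 1 ≤ R ^ 2 := one_le_pow₀ hR
  set D := 2 * (u ^ 2 + v ^ 2) with hD
  have hD0 : 0 < D := by positivity
  set p := s ^ 2 * u ^ 2 with hp
  set w := s ^ 2 * v ^ 2 with hw
  have hp0 : 0 < p := by positivity
  have hw0 : 0 < w := by positivity
  have hp1 : p ≤ 1 := (mul_le_mul_of_nonneg_left hu2 (sq_nonneg s)).trans hsR
  rcases lt_or_ge w 4 with h4 | h4
  · set X := Real.sqrt (4 - p)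
    set Y := Real.sqrt (4 - w)
    have hX1 : 1 ≤ X := Real.one_le_sqrt.2 (by linarith)
    have hY0 : 0 < Y := Real.sqrt_pos.2 (by linarith)
    have hX2 : X ^ 2 = 4 - p := Real.sq_sqrt (by linarith)
    have hY2 : Y ^ 2 = 4 - w := Real.sq_sqrt (by linarith)
    have hX3 : X ≤ 2 := sqrt_four_sub_le_two _ hp0.le
    have hY3 : Y ≤ 2 := sqrt_four_sub_le_two _ hw0.le
    -- From √q ≥ q/2 for 0 ≤ q ≤ 4, applied to each factor.
    have hXY : 4 - (p + w) ≤ X * Y := by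
      have a1 : (4 - p) / 2 ≤ X := by nlinarith
      have a2 : (4 - w) / 2 ≤ Y := by nlinarith
      have a3 : (4 - p) / 2 * ((4 - w) / 2) ≤ X * Y :=
        mul_le_mul a1 a2 (by linarith) (by linarith)
      nlinarith [mul_pos hp0 hw0]
    have hXY4 : X * Y ≤ 4 := by nlinarith
    have hr : s ^ 2 * u ^ 2 * v ^ 2 * 4 ≤ D * (2 * p) := by
      rw [hD, hp]
      have : 0 ≤ s ^ 2 * u ^ 2 * u ^ 2 := by positivity
      nlinarith
    have hr0 : 0 ≤ s ^ 2 * u ^ 2 * v ^ 2 * 4 := by positivity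
    have e : edgeKer s u v - D = (D * (4 - X * Y) - s ^ 2 * u ^ 2 * v ^ 2 * 4) / (X * Y) := by
      rw [edgeKer, eq_div_iff (by positivity), sub_mul, div_mul_cancel₀ _ (by positivity)]
      ring
    have h5 : |D * (4 - X * Y) - s ^ 2 * u ^ 2 * v ^ 2 * 4| ≤ D * (2 * (p + w)) := by
      have b1 : D * (4 - X * Y) ≤ D * (p + w) := mul_le_mul_of_nonneg_left (by linarith) hD0.le
      have b2 : 0 ≤ D * (4 - X * Y) := mul_nonneg hD0.le (by linarith)
      have b3 : 0 ≤ D * (p + w) := by positivity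
      have b4 : D * (2 * p) ≤ D * (2 * (p + w)) := mul_le_mul_of_nonneg_left (by linarith) hD0.le
      rw [_root_.abs_le]
      constructor <;> linarith
    have h6 : (p + w) * (1 + v ^ 2)⁻¹ ≤ R ^ 2 * s ^ 2 := by
      rw [← div_eq_mul_inv, div_le_iff₀ (by positivity), hp, hw]
      have c1 : 0 ≤ s ^ 2 * (R ^ 2 - u ^ 2) := mul_nonneg (sq_nonneg s) (by linarith)
      have c2 : 0 ≤ s ^ 2 * (v ^ 2 * (R ^ 2 - 1)) :=
        mul_nonneg (sq_nonneg s) (mul_nonneg (sq_nonneg v) (by linarith))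
      nlinarith
    have h7 : (X * Y)⁻¹ ≤ Y⁻¹ := inv_anti₀ hY0 (by nlinarith)
    rw [e, abs_div, abs_of_pos (by positivity : 0 < X * Y), div_eq_mul_inv]
    calc _ ≤ D * (2 * (p + w)) * Y⁻¹ * (1 + v ^ 2)⁻¹ := by gcongr
      _ = D * 2 * ((p + w) * (1 + v ^ 2)⁻¹) * Y⁻¹ := by ring
      _ ≤ D * 2 * (R ^ 2 * s ^ 2) * Y⁻¹ := by gcongr
      _ = D * (2 * R ^ 2 * s ^ 2 * (Y⁻¹ + 0)) := by ring
      _ ≤ _ := by gcongr; positivity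
  -- Here `edgeKer` has been cut off and the error is the whole limiting kernel; the term 2/(4 +
  -- s²v²) of the bound is present for this region.
  · have h5 : Real.sqrt (4 - w) = 0 := Real.sqrt_eq_zero_of_nonpos (by linarith)
    have h6 : edgeKer s u v = 0 := by rw [edgeKer, ← hw, h5]; simp
    rw [h6, h5, zero_sub, abs_neg, abs_of_pos hD0, inv_zero, zero_add]
    refine mul_le_mul_of_nonneg_left ?_ hD0.le
    rw [inv_le_iff_one_le_mul₀' (by positivity), mul_div_assoc', mul_div_assoc',
      le_div_iff₀ (by positivity)]
    have c1 : 0 ≤ s ^ 2 * ((R ^ 2 - 1) * (1 + v ^ 2)) :=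
      mul_nonneg (sq_nonneg s) (mul_nonneg (by linarith) (by positivity))
    have c2 : 0 ≤ s ^ 2 * R ^ 2 := by positivity
    nlinarith [sq_nonneg s]

theorem measurable_diffQuotSq (h : IsProfile g B R) :
    Measurable fun p : ℝ × ℝ => diffQuotSq g p.1 p.2 := by
  have := h.continuous.measurable
  unfold diffQuotSq
  fun_prop

/-- A symmetric function that vanishes when both variables exceed R lives on two strips; symmetry
reduces its bound to the strip u < R. -/
theorem indicator_mul_le_symStrip {β : ℝ → ℝ} {F : ℝ → ℝ → ℝ} (hF : ∀ u v, F u v = F v u)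
    (hβ : ∀ v ∈ Ioi (0 : ℝ), 0 ≤ β v) (h0 : ∀ u v, R ≤ u → R ≤ v → F u v = 0)
    (hle : ∀ u v, 0 < u → 0 < v → u < R → F u v ≤ β v) {u v : ℝ} (hu : 0 < u) (hv : 0 < v) :
    F u v ≤ symStrip R β (u, v) := by
  have b1 := hβ u hu
  have b2 := hβ v hv
  rcases lt_or_ge u R with h1 | h1 <;> rcases lt_or_ge v R with h2 | h2
  · have := hle u v hu hv h1
    simp [symStrip, h1, h2]; linarith
  · have := hle u v hu hv h1
    simp [symStrip, h1, not_lt.2 h2]; linarith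
  · have := hle v u hv hu h2
    rw [hF] at this
    simp [symStrip, h2, not_lt.2 h1]; linarith
  · rw [h0 u v h1 h2]
    simp [symStrip, not_lt.2 h1, not_lt.2 h2]

theorem diffQuotSq_mul_le_symStrip (h : IsProfile g B R) {u v : ℝ} (hu : 0 < u) (hv : 0 < v) :
    diffQuotSq g u v * (2 * (u ^ 2 + v ^ 2)) ≤
      symStrip R (fun v => 50 * B ^ 2 * R ^ 4 * (1 + v ^ 2)⁻¹) (u, v) :=
  indicator_mul_le_symStrip (F := fun u v => diffQuotSq g u v * (2 * (u ^ 2 + v ^ 2)))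
    (fun u v => by simp only [diffQuotSq_comm g u v, add_comm]) (fun v _ => by positivity)
    (fun u v h1 h2 => by simp only [h.diffQuotSq_eq_zero h1 h2, zero_mul])
    (fun u v h1 h2 h3 => h.two_mul_diffQuotSq_le h1 h2 h3) hu hv

theorem posProd_ae {p : ℝ × ℝ → Prop} (h : ∀ u v : ℝ, 0 < u → 0 < v → p (u, v)) :
    ∀ᵐ x ∂((volume.restrict (Ioi (0 : ℝ))).prod (volume.restrict (Ioi (0 : ℝ)))), p x := by
  rw [Measure.prod_restrict]
  exact (ae_restrict_iff' (measurableSet_Ioi.prod measurableSet_Ioi)).2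
    (Eventually.of_forall fun x hx => h x.1 x.2 hx.1 hx.2)

theorem integrable_diffQuotSq_mul (h : IsProfile g B R) :
    Integrable (fun p : ℝ × ℝ => diffQuotSq g p.1 p.2 * (2 * (p.1 ^ 2 + p.2 ^ 2)))
      ((volume.restrict (Ioi 0)).prod (volume.restrict (Ioi 0))) := by
  have hq := h.measurable_diffQuotSq
  refine (integrable_and_integral_symStrip (zero_le_one.trans h.one_le)
    (integrableOn_Ioi_inv_one_add_sq.const_mul (50 * B ^ 2 * R ^ 4))).1.mono'
    (Measurable.aestronglyMeasurable (by fun_prop)) (posProd_ae fun u v hu hv => ?_)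
  simp only
  rw [Real.norm_eq_abs, abs_of_nonneg (mul_nonneg (diffQuotSq_nonneg _ _ _) (by positivity))]
  exact h.diffQuotSq_mul_le_symStrip hu hv

theorem integral_diffQuotSq_mul_le (h : IsProfile g B R) :
    ∫ u in Ioi 0, ∫ v in Ioi 0, diffQuotSq g u v * (2 * (u ^ 2 + v ^ 2)) ≤
      50 * B ^ 2 * R ^ 5 * Real.pi := by
  have hR := zero_le_one.trans h.one_le
  obtain ⟨i1, i2⟩ := integrable_and_integral_symStrip hR
    (integrableOn_Ioi_inv_one_add_sq.const_mul (50 * B ^ 2 * R ^ 4))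
  rw [← integral_prod (fun p : ℝ × ℝ => diffQuotSq g p.1 p.2 * (2 * (p.1 ^ 2 + p.2 ^ 2)))
    h.integrable_diffQuotSq_mul]
  refine (integral_mono_ae h.integrable_diffQuotSq_mul i1
    (posProd_ae fun u v hu hv => h.diffQuotSq_mul_le_symStrip hu hv)).trans_eq ?_
  rw [i2, integral_const_mul, integral_Ioi_inv_one_add_sq, Real.arctan_zero]
  ring

/-- The homogeneous `H^{1/2}` norm of an even function as an integral over the quadrant. -/
theorem hHalfNormSq_eq (h : IsProfile g B R) : hHalfNormSq (fun x => g (-x ^ 2)) =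
    2 * ∫ u in Ioi 0, ∫ v in Ioi 0, diffQuotSq g u v * (2 * (u ^ 2 + v ^ 2)) := by
  have hg := h.continuous
  set I : ℝ → ℝ := fun x => ∫ y, ((g (-x ^ 2) - g (-y ^ 2)) / (x - y)) ^ 2 with hI
  have hev : ∀ x, I (-x) = I x := fun x => by
    simp only [hI, neg_sq]
    rw [← integral_neg_eq_self]
    refine integral_congr_ae (Eventually.of_forall fun y => ?_)
    simp only [neg_sq]
    rw [show -x - -y = -(x - y) by ring, div_neg, neg_sq]
  have h1 : hHalfNormSq (fun x => g (-x ^ 2)) = ∫ x, I |x| := by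
    rw [hHalfNormSq]
    refine integral_congr_ae (Eventually.of_forall fun x => ?_)
    rcases abs_choice x with h | h <;> simp only [h, hev] <;> rfl
  rw [h1, integral_comp_abs]
  congr 1
  refine setIntegral_congr_fun measurableSet_Ioi fun x hx => ?_
  have hx0 : 0 < x := hx
  have hbound : IntegrableOn (fun y => symStrip R (fun v => 50 * B ^ 2 * R ^ 4 * (1 + v ^ 2)⁻¹)
      (x, y)) (Ioi 0) := by
    have k1 : IntegrableOn (fun y : ℝ => (Iio R).indicator (1 : ℝ → ℝ) x *
        (50 * B ^ 2 * R ^ 4 * (1 + y ^ 2)⁻¹)) (Ioi 0) :=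
      (integrableOn_Ioi_inv_one_add_sq.const_mul _).const_mul _
    have k2 : IntegrableOn ((Iio R).indicator (1 : ℝ → ℝ)) (Ioi 0) := by
      rw [IntegrableOn, integrable_indicator_iff measurableSet_Iio, IntegrableOn,
        Measure.restrict_restrict measurableSet_Iio, Iio_inter_Ioi]
      exact integrableOn_const (by simp)
    exact k1.add (k2.const_mul (50 * B ^ 2 * R ^ 4 * (1 + x ^ 2)⁻¹))
  -- Folding y ↦ -y uses 1/(x-y)² + 1/(x+y)² = 2(x² + y²)/(x² - y²)². On y = x everything vanishes,
  -- since g(-x²) - g(-y²) = 0.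
  have key : ∀ y, 0 < y → ((g (-x ^ 2) - g (-y ^ 2)) / (x - y)) ^ 2 +
      ((g (-x ^ 2) - g (-y ^ 2)) / (x + y)) ^ 2 = diffQuotSq g x y * (2 * (x ^ 2 + y ^ 2)) :=
    fun y hy => by
      rw [diffQuotSq]
      by_cases hxy : x - y = 0
      · have : x = y := by linarith
        simp [this]
      · have h2 : x + y ≠ 0 := by positivity
        rw [show x ^ 2 - y ^ 2 = (x - y) * (x + y) by ring, div_pow, div_pow, div_pow, mul_pow]
        field_simp
        ring
  have hle : ∀ y, 0 < y → diffQuotSq g x y * (2 * (x ^ 2 + y ^ 2)) ≤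
      symStrip R (fun v => 50 * B ^ 2 * R ^ 4 * (1 + v ^ 2)⁻¹) (x, y) :=
    fun y hy => h.diffQuotSq_mul_le_symStrip hx0 hy
  have j1 : IntegrableOn (fun y => ((g (-x ^ 2) - g (-y ^ 2)) / (x - y)) ^ 2) (Ioi 0) := by
    refine hbound.mono' (Measurable.aestronglyMeasurable (by fun_prop))
      ((ae_restrict_iff' measurableSet_Ioi).2 (Eventually.of_forall fun y hy => ?_))
    rw [Real.norm_eq_abs, abs_of_nonneg (sq_nonneg _)]
    have := key y hy
    have := hle y hy
    have := sq_nonneg ((g (-x ^ 2) - g (-y ^ 2)) / (x + y))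
    linarith
  have j2 : IntegrableOn (fun y => ((g (-x ^ 2) - g (-y ^ 2)) / (x + y)) ^ 2) (Ioi 0) := by
    refine hbound.mono' (Measurable.aestronglyMeasurable (by fun_prop))
      ((ae_restrict_iff' measurableSet_Ioi).2 (Eventually.of_forall fun y hy => ?_))
    rw [Real.norm_eq_abs, abs_of_nonneg (sq_nonneg _)]
    have := key y hy
    have := hle y hy
    have := sq_nonneg ((g (-x ^ 2) - g (-y ^ 2)) / (x - y))
    linarith
  have e2 : ∀ y, ((g (-x ^ 2) - g (-(-y) ^ 2)) / (x - -y)) ^ 2 =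
      ((g (-x ^ 2) - g (-y ^ 2)) / (x + y)) ^ 2 := fun y => by rw [neg_sq, sub_neg_eq_add]
  have j3 : IntegrableOn (fun y => ((g (-x ^ 2) - g (-y ^ 2)) / (x - y)) ^ 2) (Iic 0) := by
    rw [integrableOn_Iic_iff_integrableOn_Iio]
    have := (Measure.measurePreserving_neg (volume : Measure ℝ)).integrableOn_comp_preimage
      (Homeomorph.neg ℝ).measurableEmbedding (s := Iio 0)
      (f := fun y => ((g (-x ^ 2) - g (-y ^ 2)) / (x - y)) ^ 2)
    refine this.1 ?_
    rw [show (Neg.neg ⁻¹' Iio 0 : Set ℝ) = Ioi 0 by ext y; simp]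
    exact j2.congr_fun (fun y _ => (e2 y).symm) measurableSet_Ioi
  have e3 : ∫ y in Iic (0 : ℝ), ((g (-x ^ 2) - g (-y ^ 2)) / (x - y)) ^ 2 =
      ∫ y in Ioi (0 : ℝ), ((g (-x ^ 2) - g (-y ^ 2)) / (x + y)) ^ 2 := by
    have := integral_comp_neg_Ioi (0 : ℝ) fun y => ((g (-x ^ 2) - g (-y ^ 2)) / (x - y)) ^ 2
    simp only [e2, neg_zero] at this
    exact this.symm
  simp only [hI]
  rw [← intervalIntegral.integral_Iic_add_Ioi j3 j1, e3, add_comm, ← integral_add j1 j2]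
  exact setIntegral_congr_fun measurableSet_Ioi fun y hy => key y hy

theorem abs_Vtr1_edgeFn_le (h : IsProfile g B R) (hs : 0 < s) :
    |Vtr1 (edgeFn g s)| ≤ 2 * (B / s ^ 2) ^ 2 := by
  have hF := cosLipschitz_comp (h.edgeFn_lip hs)
  have h1 := abs_integral_integral_le (k := fun θ φ => (edgeFn g s (2 * Real.cos θ) -
    edgeFn g s (2 * Real.cos φ)) ^ 2 * ((1 - Real.cos θ * Real.cos φ) /
        (Real.cos θ - Real.cos φ) ^ 2)) (A := fun _ => 1) (c := (2 * (B / s ^ 2)) ^ 2 * 2)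
    (integrable_const _) fun θ _ φ _ => by
      rw [mul_one, mul_one, sq (edgeFn g s _ - _)]
      refine hF.abs_mul_mul_le hF ?_
      have h2 : |1 - Real.cos θ * Real.cos φ| ≤ 2 := by
        have h3 : |Real.cos θ * Real.cos φ| ≤ 1 * 1 := by
          rw [abs_mul]
          exact mul_le_mul (Real.abs_cos_le_one θ) (Real.abs_cos_le_one φ) (abs_nonneg _) zero_le_one
        have h4 := _root_.abs_le.1 h3
        exact _root_.abs_le.2 ⟨by linarith, by linarith⟩
      rw [abs_div, abs_of_nonneg (sq_nonneg (Real.cos θ - Real.cos φ))]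
      by_cases h3 : (Real.cos θ - Real.cos φ) ^ 2 = 0
      · rw [h3, mul_zero]; norm_num
      · rwa [div_mul_cancel₀ _ h3]
  rw [integral_const_angleMeasure, mul_one] at h1
  rw [Vtr1_eq, abs_mul, abs_of_pos (by positivity : 0 < 1 / (4 * Real.pi ^ 2))]
  calc _ ≤ 1 / (4 * Real.pi ^ 2) * ((2 * (B / s ^ 2)) ^ 2 * 2 * Real.pi ^ 2) := by gcongr
    _ = _ := by field_simp; ring

/-- The kernel error has a factor s², while the integral of 1/√(4 - s²v²) is of order 1/s because of
the other edge v = 2/s; the product is O(s). -/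
theorem abs_integral_edgeKer_sub_le (h : IsProfile g B R) (hs : 0 < s) (hsR : s ^ 2 * R ^ 2 ≤ 1) :
    |(∫ u in Ioi 0, ∫ v in Ioi 0, diffQuotSq g u v * edgeKer s u v) -
      ∫ u in Ioi 0, ∫ v in Ioi 0, diffQuotSq g u v * (2 * (u ^ 2 + v ^ 2))| ≤
      200 * Real.pi * B ^ 2 * R ^ 7 * s := by
  have hR1 := h.one_le
  have hR := zero_le_one.trans h.one_le
  set c := 50 * B ^ 2 * R ^ 4 * (2 * R ^ 2 * s ^ 2) with hc
  have hc0 : 0 ≤ c := by positivity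
  set β : ℝ → ℝ := fun v => c * ((Real.sqrt (4 - s ^ 2 * v ^ 2))⁻¹ + 2 / (4 + s ^ 2 * v ^ 2)) with hβ
  obtain ⟨a1, a2⟩ := integrableOn_and_integral_inv_sqrt hs
  obtain ⟨a3, a4⟩ := integrableOn_and_integral_four_mul_sq_div hs
  have a5 : (fun v : ℝ => 2 / (4 + s ^ 2 * v ^ 2)) = fun v =>
      1 / (2 * s ^ 2) * (4 * s ^ 2 / (4 + s ^ 2 * v ^ 2)) := funext fun v => by
    have : 4 + s ^ 2 * v ^ 2 ≠ 0 := by positivity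
    field_simp
    norm_num
  have a6 : IntegrableOn (fun v : ℝ => 2 / (4 + s ^ 2 * v ^ 2)) (Ioi 0) := by
    rw [a5]; exact a3.const_mul _
  have hβi : IntegrableOn β (Ioi 0) := (a1.add a6).const_mul c
  have hβI : ∫ v in Ioi 0, β v = c * (Real.pi / s) := by
    rw [hβ, integral_const_mul, integral_add a1 a6, a2, a5, integral_const_mul, a4]
    field_simp
    norm_num
  obtain ⟨b1, b2⟩ := integrable_and_integral_symStrip hR hβi
  have hq := h.measurable_diffQuotSq
  have hle : ∀ u v : ℝ, 0 < u → 0 < v → ‖diffQuotSq g u v * edgeKer s u v -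
      diffQuotSq g u v * (2 * (u ^ 2 + v ^ 2))‖ ≤ symStrip R β (u, v) := fun u v hu hv => by
    refine indicator_mul_le_symStrip (F := fun u v => ‖diffQuotSq g u v * edgeKer s u v -
      diffQuotSq g u v * (2 * (u ^ 2 + v ^ 2))‖)
      (fun u v => by simp only [diffQuotSq_comm g u v, edgeKer_comm s u v, add_comm (u ^ 2)])
      (fun v _ => by simp only [hβ]; positivity)
      (fun u v h1 h2 => by simp only [h.diffQuotSq_eq_zero h1 h2, zero_mul, sub_zero, norm_zero])
      (fun u v hu hv huR => ?_) hu hv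
    have k1 := h.two_mul_diffQuotSq_le hu hv huR
    have k2 := abs_edgeKer_sub_le hs hR1 hsR hu hv huR
    have k3 := diffQuotSq_nonneg g u v
    have hv1 : 0 < 1 + v ^ 2 := by positivity
    rw [← mul_sub, norm_mul, Real.norm_eq_abs, Real.norm_eq_abs, abs_of_nonneg k3]
    rw [← div_eq_mul_inv, div_le_iff₀ hv1] at k2
    rw [← div_eq_mul_inv, le_div_iff₀ hv1] at k1
    set Z := (Real.sqrt (4 - s ^ 2 * v ^ 2))⁻¹ + 2 / (4 + s ^ 2 * v ^ 2) with hZ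
    have hZ0 : 0 ≤ Z := by positivity
    calc diffQuotSq g u v * |edgeKer s u v - 2 * (u ^ 2 + v ^ 2)|
        ≤ diffQuotSq g u v * (2 * (u ^ 2 + v ^ 2) * (2 * R ^ 2 * s ^ 2 * Z) * (1 + v ^ 2)) := by
          gcongr
      _ = diffQuotSq g u v * (2 * (u ^ 2 + v ^ 2)) * (1 + v ^ 2) * (2 * R ^ 2 * s ^ 2 * Z) := by ring
      _ ≤ 50 * B ^ 2 * R ^ 4 * (2 * R ^ 2 * s ^ 2 * Z) := by gcongr
      _ = β v := by simp only [hβ, hc, hZ]; ring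
  have hi0 := h.integrable_diffQuotSq_mul
  have hme : Measurable fun p : ℝ × ℝ => diffQuotSq g p.1 p.2 * edgeKer s p.1 p.2 := by
    unfold edgeKer
    fun_prop
  have hi1 : Integrable (fun p : ℝ × ℝ => diffQuotSq g p.1 p.2 * edgeKer s p.1 p.2)
      ((volume.restrict (Ioi 0)).prod (volume.restrict (Ioi 0))) := by
    have : Integrable (fun p : ℝ × ℝ => diffQuotSq g p.1 p.2 * edgeKer s p.1 p.2 -
        diffQuotSq g p.1 p.2 * (2 * (p.1 ^ 2 + p.2 ^ 2)))
        ((volume.restrict (Ioi 0)).prod (volume.restrict (Ioi 0))) :=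
      b1.mono' (Measurable.aestronglyMeasurable (by fun_prop)) (posProd_ae hle)
    refine (this.add hi0).congr (Eventually.of_forall fun p => ?_)
    simp
  rw [← integral_prod (fun p : ℝ × ℝ => diffQuotSq g p.1 p.2 * edgeKer s p.1 p.2) hi1,
    ← integral_prod (fun p : ℝ × ℝ => diffQuotSq g p.1 p.2 * (2 * (p.1 ^ 2 + p.2 ^ 2))) hi0,
    ← integral_sub hi1 hi0, ← Real.norm_eq_abs]
  refine (norm_integral_le_of_norm_le b1 (posProd_ae hle)).trans_eq ?_
  rw [b2, hβI, hc]
  field_simp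
  ring

/-- Asymptotics of the first tracial variance at the edge. -/
theorem abs_Vtr1_edgeFn_sub_le (h : IsProfile g B R) (hs : 0 < s) :
    |Vtr1 (edgeFn g s) - hHalfNormSq (fun x => g (-x ^ 2)) / (8 * Real.pi ^ 2)| ≤
      200 * B ^ 2 * R ^ 7 * s := by
  have hR1 := h.one_le
  have hR := zero_lt_one.trans_le h.one_le
  have hB := h.nonneg
  have hpi := Real.pi_gt_three
  have e : hHalfNormSq (fun x => g (-x ^ 2)) / (8 * Real.pi ^ 2) = 1 / (4 * Real.pi ^ 2) *
      ∫ u in Ioi 0, ∫ v in Ioi 0, diffQuotSq g u v * (2 * (u ^ 2 + v ^ 2)) := by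
    rw [h.hHalfNormSq_eq]
    ring
  have h0 : 1 / (4 * Real.pi ^ 2) * Real.pi ≤ 1 := by
    rw [div_mul_eq_mul_div, one_mul, div_le_one (by positivity)]
    nlinarith
  rcases le_or_gt (s ^ 2 * R ^ 2) 1 with hsR | hsR
  · rw [e, Vtr1_edgeFn_eq hs, ← mul_sub, abs_mul,
      abs_of_pos (by positivity : 0 < 1 / (4 * Real.pi ^ 2))]
    calc _ ≤ 1 / (4 * Real.pi ^ 2) * (200 * Real.pi * B ^ 2 * R ^ 7 * s) := by
          gcongr
          exact h.abs_integral_edgeKer_sub_le hs hsR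
      _ = (1 / (4 * Real.pi ^ 2) * Real.pi) * (200 * B ^ 2 * R ^ 7 * s) := by ring
      _ ≤ _ := mul_le_of_le_one_left (by positivity) h0
  -- For s bounded below there is nothing to compare: both terms are O(1), and 1 ≤ sR turns this
  -- into O(s).
  · have h1s : 1 ≤ s * R := by
      by_contra h2
      have : 0 < s * R := by positivity
      nlinarith
    have h2 : 2 * (B / s ^ 2) ^ 2 ≤ 2 * B ^ 2 * R ^ 5 * s := by
      have h3 : B / s ^ 2 ≤ B * R ^ 2 := by
        rw [div_le_iff₀ (pow_pos hs 2)]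
        nlinarith
      calc 2 * (B / s ^ 2) ^ 2 ≤ 2 * (B * R ^ 2) ^ 2 := by gcongr
        _ = 2 * B ^ 2 * R ^ 4 * 1 := by ring
        _ ≤ 2 * B ^ 2 * R ^ 4 * (s * R) := by gcongr
        _ = _ := by ring
    have h4 : 0 ≤ ∫ u in Ioi 0, ∫ v in Ioi 0, diffQuotSq g u v * (2 * (u ^ 2 + v ^ 2)) :=
      integral_nonneg fun u => integral_nonneg fun v =>
        mul_nonneg (diffQuotSq_nonneg _ _ _) (by positivity)
    have h5 : |hHalfNormSq (fun x => g (-x ^ 2)) / (8 * Real.pi ^ 2)| ≤ 50 * B ^ 2 * R ^ 6 * s := by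
      rw [e, abs_of_nonneg (by positivity)]
      calc _ ≤ 1 / (4 * Real.pi ^ 2) * (50 * B ^ 2 * R ^ 5 * Real.pi) := by
            gcongr
            exact h.integral_diffQuotSq_mul_le
        _ = (1 / (4 * Real.pi ^ 2) * Real.pi) * (50 * B ^ 2 * R ^ 5) := by ring
        _ ≤ 50 * B ^ 2 * R ^ 5 * 1 := by
            rw [mul_one]; exact mul_le_of_le_one_left (by positivity) h0
        _ ≤ 50 * B ^ 2 * R ^ 5 * (s * R) := by gcongr
        _ = _ := by ring
    have p5 : R ^ 5 ≤ R ^ 7 := pow_le_pow_right₀ hR1 (by norm_num)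
    have p6 : R ^ 6 ≤ R ^ 7 := pow_le_pow_right₀ hR1 (by norm_num)
    refine (abs_sub _ _).trans ((add_le_add ((h.abs_Vtr1_edgeFn_le hs).trans h2) h5).trans ?_)
    calc _ ≤ 2 * B ^ 2 * R ^ 7 * s + 50 * B ^ 2 * R ^ 7 * s := by gcongr
      _ = 52 * (B ^ 2 * R ^ 7 * s) := by ring
      _ ≤ 200 * (B ^ 2 * R ^ 7 * s) := by
          have : 0 ≤ B ^ 2 * R ^ 7 * s := by positivity
          linarith
      _ = _ := by ring

end IsProfile

end

/-! ### Endpoint values, and assembly of the estimates in terms of s. -/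

theorem extendByLimit_of_abs_lt {F : ℝ → ℝ} {σ : ℝ} (hσ : |σ| < 1) : extendByLimit F σ = F σ :=
  if_pos hσ

theorem extendByLimit_of_tendsto {F : ℝ → ℝ} {σ l : ℝ} (hσ : σ = 1 ∨ σ = -1)
    (h : Tendsto F (𝓝[Ioo (-1 : ℝ) 1] σ) (𝓝 l)) : extendByLimit F σ = l := by
  have h1 : ¬ |σ| < 1 := by rcases hσ with rfl | rfl <;> simp
  have h2 : (𝓝[Ioo (-1 : ℝ) 1] σ).NeBot := by
    rw [← mem_closure_iff_nhdsWithin_neBot, closure_Ioo (by norm_num)]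
    rcases hσ with rfl | rfl <;> simp
  rw [extendByLimit, if_neg h1]
  exact h.limUnder_eq

/-- The bound passes to the limit at -1. Capping ε at 1 keeps a neighbourhood of -1 in the
hypothesis even when 1 - ε is close to -1. -/
theorem abs_extendByLimit_le {F : ℝ → ℝ} {c ε : ℝ}
    (hF : ∀ σ, |σ| < 1 → σ ≤ 1 - min ε 1 → |F σ| ≤ c)
    (hl : ∃ l, Tendsto F (𝓝[Ioo (-1 : ℝ) 1] (-1)) (𝓝 l)) (hε : 0 < ε) {σ : ℝ}
    (hσ : σ ∈ Icc (-1 : ℝ) (1 - ε)) : |extendByLimit F σ| ≤ c := by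
  rcases hσ.1.eq_or_lt with h | h
  · obtain ⟨l, hl⟩ := hl
    rw [← h, extendByLimit_of_tendsto (Or.inr rfl) hl]
    have h2 : (𝓝[Ioo (-1 : ℝ) 1] (-1)).NeBot := by
      rw [← mem_closure_iff_nhdsWithin_neBot, closure_Ioo (by norm_num)]
      simp
    refine le_of_tendsto hl.abs ?_
    filter_upwards [self_mem_nhdsWithin, mem_nhdsWithin_of_mem_nhds (Iio_mem_nhds
      (show (-1 : ℝ) < 0 by norm_num))] with τ h3 h4
    have h5 : min ε 1 ≤ 1 := min_le_right _ _
    exact hF τ (abs_lt.2 h3) (by linarith [mem_Iio.1 h4])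
  · have h1 : |σ| < 1 := abs_lt.2 ⟨h, by linarith [hσ.2]⟩
    have h5 : min ε 1 ≤ ε := min_le_left _ _
    rw [extendByLimit_of_abs_lt h1]
    exact hF σ h1 (by linarith [hσ.2])

theorem indOne_one : indOne 1 = 1 := by simp [indOne]

theorem indOne_of_ne {σ : ℝ} (h : σ ≠ 1) : indOne σ = 0 := by simp [indOne, h]

namespace IsProfile

variable {g : ℝ → ℝ} {B R s : ℝ}

theorem tendsto_extensions (h : IsProfile g B R) (hs : 0 < s) {σ : ℝ} (hσ : σ = 1 ∨ σ = -1) :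
    Tendsto (Vtr2Formula (edgeFn g s)) (𝓝[Ioo (-1 : ℝ) 1] σ) (𝓝 (Vtr2 (edgeFn g s) σ)) ∧
      Tendsto (Vd2Formula (edgeFn g s)) (𝓝[Ioo (-1 : ℝ) 1] σ) (𝓝 (Vd2 (edgeFn g s) σ)) ∧
      Tendsto (EtrFormula (edgeFn g s)) (𝓝[Ioo (-1 : ℝ) 1] σ) (𝓝 (Etr (edgeFn g s) σ)) := by
  have hl := h.edgeFn_lip hs
  have hK : 0 ≤ B / s ^ 2 := div_nonneg h.nonneg (sq_nonneg s)
  have key : ∀ F : ℝ → ℝ, (∃ l, Tendsto F (𝓝[Ioo (-1 : ℝ) 1] σ) (𝓝 l)) →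
      Tendsto F (𝓝[Ioo (-1 : ℝ) 1] σ) (𝓝 (extendByLimit F σ)) := fun F ⟨l, hF⟩ => by
    rwa [extendByLimit_of_tendsto hσ hF]
  refine ⟨key _ ?_, key _ ?_, key _ ?_⟩
  · rcases hσ with rfl | rfl
    exacts [⟨_, tendsto_Vtr2Formula_one hl⟩, exists_tendsto_Vtr2Formula_neg_one hl]
  · rcases hσ with rfl | rfl
    exacts [⟨_, tendsto_Vd2Formula_one hl⟩, exists_tendsto_Vd2Formula_neg_one hl]
  · rcases hσ with rfl | rfl
    exacts [⟨_, tendsto_EtrFormula_one hK h.edgeFn_continuous hl⟩,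
      exists_tendsto_EtrFormula_neg_one hK h.edgeFn_continuous hl]

theorem Vtr2_edgeFn_one (h : IsProfile g B R) (hs : 0 < s) :
    Vtr2 (edgeFn g s) 1 = Vtr1 (edgeFn g s) :=
  extendByLimit_of_tendsto (Or.inl rfl) (tendsto_Vtr2Formula_one (h.edgeFn_lip hs))

theorem Vd2_edgeFn_one (h : IsProfile g B R) (hs : 0 < s) :
    Vd2 (edgeFn g s) 1 = Vd1 (edgeFn g s) :=
  extendByLimit_of_tendsto (Or.inl rfl) (tendsto_Vd2Formula_one (h.edgeFn_lip hs))

theorem abs_Etr_edgeFn_one_sub_le (h : IsProfile g B R) (hs : 0 < s) :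
    |-(Etr (edgeFn g s) 1) / 2 - g 0 / 4| ≤ 2 * B * R * s := by
  have hB := h.nonneg
  have hR := zero_lt_one.trans_le h.one_le
  have e : Etr (edgeFn g s) 1 = meanInvSc (edgeFn g s) - (edgeFn g s 2 + edgeFn g s (-2)) / 2 :=
    extendByLimit_of_tendsto (Or.inl rfl) (tendsto_EtrFormula_one
      (div_nonneg hB (sq_nonneg s)) h.edgeFn_continuous (h.edgeFn_lip hs))
  have e2 : edgeFn g s 2 = g 0 := by simp [edgeFn]
  have h1 := _root_.abs_le.1 (h.abs_meanInvSc_edgeFn_le hs)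
  -- The value at the opposite edge can be nonzero only if 4 < s²R², and then 1 ≤ Rs.
  have h2 : |edgeFn g s (-2)| ≤ B * R * s := by
    by_cases hz : edgeFn g s (-2) = 0
    · rw [hz, abs_zero]; positivity
    · have h3 := h.two_sub_lt_of_edgeFn_ne_zero hs hz
      have h4 : 1 ≤ R * s := by
        by_contra h5
        have : 0 < R * s := by positivity
        nlinarith
      calc |edgeFn g s (-2)| ≤ B := h.edgeFn_abs_le _
        _ ≤ B * (R * s) := le_mul_of_one_le_right hB h4
        _ = _ := by ring
  have h6 := _root_.abs_le.1 h2
  rw [e, e2, _root_.abs_le]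
  constructor <;> linarith

end IsProfile

theorem sqrt_two_mul_pi_le : Real.sqrt 2 * Real.pi ≤ 5 := by
  have h1 : Real.sqrt 2 ≤ 3 / 2 := (Real.sqrt_le_left (by norm_num)).2 (by norm_num)
  have h2 := Real.pi_lt_d2
  nlinarith [Real.pi_pos, Real.sqrt_nonneg 2]

/-- The edge asymptotics in terms of the scale `s = N^{-a/2}` and `κ = s³ C_N`. -/
theorem exists_edge_bounds {B R ε : ℝ} (hB : 0 ≤ B) (hR : 0 ≤ R) (hε : 0 < ε) :
    ∃ C : ℝ, ∀ g : ℝ → ℝ, IsProfile g B R → ∀ s ∈ Ioc (0 : ℝ) 1, ∀ κ : ℝ,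
      |κ - Real.sqrt 2 * Real.pi| ≤ 400 * s →
      |Vtr1 (edgeFn g s) - hHalfNormSq (fun x => g (-x ^ 2)) / (8 * Real.pi ^ 2)| ≤ C * s ∧
      |κ / s ^ 3 * Vd1 (edgeFn g s) - Real.sqrt 2 * l2NormSq (fun x => g (-x ^ 2) * x)| ≤ C * s ∧
      |1 / s ^ 3 * Vd1 (edgeFn g s) - l2NormSq (fun x => g (-x ^ 2) * x) / Real.pi| ≤ C * s ∧
      ∀ σ : ℝ, (σ ∈ Icc (-1 : ℝ) (1 - ε) ∨ σ = 1) →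
        |Vtr2 (edgeFn g s) σ - indOne σ *
          (hHalfNormSq (fun x => g (-x ^ 2)) / (8 * Real.pi ^ 2))| ≤ C * s ∧
        |κ / s ^ 3 * Vd2 (edgeFn g s) σ - indOne σ *
          (Real.sqrt 2 * l2NormSq (fun x => g (-x ^ 2) * x))| ≤ C * s ∧
        |1 / s ^ 3 * Vd2 (edgeFn g s) σ - indOne σ *
          (l2NormSq (fun x => g (-x ^ 2) * x) / Real.pi)| ≤ C * s ∧
        |-(Etr (edgeFn g s) σ) / 2 - indOne σ * (g 0 / 4)| ≤ C * s := by
  obtain ⟨C₀, hC₀, hb⟩ := IsProfile.exists_bound_of_le B R (lt_min hε one_pos)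
  set C₁ := B ^ 2 * R ^ 5 + 4 * B ^ 2 * R ^ 6 with hC₁
  have hC₁0 : 0 ≤ C₁ := by positivity
  have q1 : 0 ≤ 800 * B ^ 2 * R ^ 3 := by positivity
  have q2 : 0 ≤ 200 * B ^ 2 * R ^ 7 := by positivity
  have q3 : 0 ≤ 2 * B * R := by positivity
  refine ⟨405 * C₀ + 405 * C₁ + 800 * B ^ 2 * R ^ 3 + 200 * B ^ 2 * R ^ 7 + 2 * B * R,
    fun g h s ⟨hs, hs1⟩ κ hκ => ?_⟩
  have hs3 : 0 < s ^ 3 := pow_pos hs 3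
  -- Here 405 = 400 + 5, from s ≤ 1 and √2 π ≤ 5.
  have hκ2 : |κ| ≤ 405 := by
    have h1 := _root_.abs_le.1 hκ
    have h2 := sqrt_two_mul_pi_le
    have h3 : 0 ≤ Real.sqrt 2 * Real.pi := by positivity
    exact _root_.abs_le.2 ⟨by linarith, by linarith⟩
  set l := l2NormSq (fun x => g (-x ^ 2) * x) with hl
  have hl0 : 0 ≤ l := integral_nonneg fun x => sq_nonneg _
  have hl1 : l ≤ 2 * B ^ 2 * R ^ 3 := h.l2NormSq_le
  have a1 := h.abs_Vtr1_edgeFn_sub_le hs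
  have a2 : |1 / s ^ 3 * Vd1 (edgeFn g s) - l / Real.pi| ≤ C₁ * s := by
    have h1 := h.abs_Vd1_edgeFn_sub_le hs hs1
    rw [show 1 / s ^ 3 * Vd1 (edgeFn g s) - l / Real.pi =
      (Vd1 (edgeFn g s) - s ^ 3 * (l / Real.pi)) / s ^ 3 by field_simp, abs_div, abs_of_pos hs3,
      div_le_iff₀ hs3]
    exact h1.trans_eq (by ring)
  have a3 : |κ / s ^ 3 * Vd1 (edgeFn g s) - Real.sqrt 2 * l| ≤
      (405 * C₁ + 800 * B ^ 2 * R ^ 3) * s := by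
    -- The estimate for C_N V_d¹ follows from the N^{3a/2} one by splitting off the error of κ.
    rw [show κ / s ^ 3 * Vd1 (edgeFn g s) - Real.sqrt 2 * l =
      κ * (1 / s ^ 3 * Vd1 (edgeFn g s) - l / Real.pi) +
        (κ - Real.sqrt 2 * Real.pi) * (l / Real.pi) by field_simp; ring]
    have h1 : l / Real.pi ≤ 2 * B ^ 2 * R ^ 3 :=
      (div_le_self hl0 (by linarith [Real.pi_gt_three])).trans hl1
    have h2 : 0 ≤ l / Real.pi := by positivity
    refine (abs_add_le _ _).trans ?_
    rw [abs_mul, abs_mul, abs_of_nonneg h2]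
    calc _ ≤ 405 * (C₁ * s) + 400 * s * (2 * B ^ 2 * R ^ 3) := by gcongr
      _ = _ := by ring
  have up : ∀ {x c : ℝ}, x ≤ c * s →
      c ≤ 405 * C₀ + 405 * C₁ + 800 * B ^ 2 * R ^ 3 + 200 * B ^ 2 * R ^ 7 + 2 * B * R →
      x ≤ (405 * C₀ + 405 * C₁ + 800 * B ^ 2 * R ^ 3 + 200 * B ^ 2 * R ^ 7 + 2 * B * R) * s :=
    fun h1 h2 => h1.trans (mul_le_mul_of_nonneg_right h2 hs.le)
  refine ⟨up a1 (by linarith), up a3 (by linarith), up a2 (by linarith), fun σ hσ => ?_⟩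
  rcases hσ with hσ | rfl
  · have hne : σ ≠ 1 := by have := hσ.2; intro h1; linarith
    obtain ⟨t1, t2, t3⟩ := h.tendsto_extensions hs (Or.inr (rfl : (-1 : ℝ) = -1))
    have b1 : |Vtr2 (edgeFn g s) σ| ≤ C₀ * s :=
      abs_extendByLimit_le (fun τ h1 h2 => (hb g h s ⟨hs, hs1⟩ τ h1 h2).1) ⟨_, t1⟩ hε hσ
    have b2 : |Vd2 (edgeFn g s) σ| ≤ C₀ * s ^ 4 :=
      abs_extendByLimit_le (fun τ h1 h2 => (hb g h s ⟨hs, hs1⟩ τ h1 h2).2.1) ⟨_, t2⟩ hε hσ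
    have b3 : |Etr (edgeFn g s) σ| ≤ C₀ * s :=
      abs_extendByLimit_le (fun τ h1 h2 => (hb g h s ⟨hs, hs1⟩ τ h1 h2).2.2) ⟨_, t3⟩ hε hσ
    have b4 : |1 / s ^ 3 * Vd2 (edgeFn g s) σ| ≤ C₀ * s := by
      rw [one_div, abs_mul, abs_of_pos (inv_pos.2 hs3), inv_mul_le_iff₀ hs3]
      exact b2.trans_eq (by ring)
    have b5 : |κ / s ^ 3 * Vd2 (edgeFn g s) σ| ≤ 405 * C₀ * s := by
      rw [show κ / s ^ 3 * Vd2 (edgeFn g s) σ = κ * (1 / s ^ 3 * Vd2 (edgeFn g s) σ) by ring,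
        abs_mul, mul_assoc]
      exact mul_le_mul hκ2 b4 (abs_nonneg _) (by norm_num)
    simp only [indOne_of_ne hne, zero_mul, sub_zero]
    refine ⟨up b1 (by linarith), up b5 (by linarith), up b4 (by linarith), up ?_ (by linarith :
      C₀ ≤ _)⟩
    rw [abs_div, abs_neg, abs_two]
    linarith [abs_nonneg (Etr (edgeFn g s) σ)]
  · simp only [indOne_one, one_mul]
    rw [h.Vtr2_edgeFn_one hs, h.Vd2_edgeFn_one hs]
    exact ⟨up a1 (by linarith), up a3 (by linarith), up a2 (by linarith),
      up (h.abs_Etr_edgeFn_one_sub_le hs) (by linarith)⟩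

/-! ### Translation between s and powers of N. -/

section Scale

variable {N : ℕ} {a s : ℝ}

theorem rpow_neg_eq_sq (hs : s = (N : ℝ) ^ (-a / 2)) : (N : ℝ) ^ (-a) = s ^ 2 := by
  rw [hs, ← Real.rpow_natCast, ← Real.rpow_mul (Nat.cast_nonneg N)]
  norm_num

theorem rpow_eq_inv_sq (hs : s = (N : ℝ) ^ (-a / 2)) : (N : ℝ) ^ a = (s ^ 2)⁻¹ := by
  rw [← rpow_neg_eq_sq hs, Real.rpow_neg (Nat.cast_nonneg N), inv_inv]

theorem rpow_three_halves_eq (hs : s = (N : ℝ) ^ (-a / 2)) :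
    (N : ℝ) ^ (3 * a / 2) = 1 / s ^ 3 := by
  rw [hs, ← Real.rpow_natCast, ← Real.rpow_mul (Nat.cast_nonneg N), one_div,
    ← Real.rpow_neg (Nat.cast_nonneg N)]
  congr 1
  push_cast
  ring

theorem rescale_eq_edgeFn (hs : s = (N : ℝ) ^ (-a / 2)) (g : ℝ → ℝ) :
    rescale g a 2 N = edgeFn g s := by
  funext x
  rw [rescale, edgeFn, rpow_eq_inv_sq hs, div_eq_inv_mul]

/-- This identifies κ = s³C_N with s/ρ(2 + is²), the quantity compared with √2 π in
`abs_inv_rhoC_edge_sub_le`. -/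
theorem scaleC_eq (ha : 0 < a) (hs : s = (N : ℝ) ^ (-a / 2)) (hs0 : s ≠ 0) :
    scaleC a 2 N = s / rhoC ((2 : ℝ) + Complex.I * ((s ^ 2 : ℝ) : ℂ)) / s ^ 3 := by
  rw [scaleC, rhoN, if_pos ha, rpow_eq_inv_sq hs, rpow_neg_eq_sq hs]
  field_simp

end Scale

end EdgeScaling

theorem mainTheorem7 (a : ℝ) (ha₀ : 0 < a) (ha₁ : a < 2 / 3) (L M ε : ℝ) (hε : 0 < ε) :
    ∃ C : ℝ, ∀ g : ℝ → ℝ, Continuous g → EdgeScaling.MemH2NormLE g M →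
      tsupport g ⊆ Set.Icc (-L) L → ∀ N : ℕ, 1 ≤ N →
        -- the limits that define the extensions to the endpoints exist
        (∀ s : ℝ, (s = 1 ∨ s = -1) →
          Tendsto (EdgeScaling.Vtr2Formula (EdgeScaling.rescale g a 2 N))
            (𝓝[Set.Ioo (-1 : ℝ) 1] s)
            (𝓝 (EdgeScaling.Vtr2 (EdgeScaling.rescale g a 2 N) s)) ∧
          Tendsto (EdgeScaling.Vd2Formula (EdgeScaling.rescale g a 2 N))
            (𝓝[Set.Ioo (-1 : ℝ) 1] s)
            (𝓝 (EdgeScaling.Vd2 (EdgeScaling.rescale g a 2 N) s)) ∧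
          Tendsto (EdgeScaling.EtrFormula (EdgeScaling.rescale g a 2 N))
            (𝓝[Set.Ioo (-1 : ℝ) 1] s)
            (𝓝 (EdgeScaling.Etr (EdgeScaling.rescale g a 2 N) s))) ∧
        -- the two functionals that do not involve `σ`
        |EdgeScaling.Vtr1 (EdgeScaling.rescale g a 2 N)
            - EdgeScaling.hHalfNormSq (fun x => g (-x ^ 2)) / (8 * Real.pi ^ 2)|
          ≤ C * (N : ℝ) ^ (-a / 2) ∧
        |EdgeScaling.scaleC a 2 N * EdgeScaling.Vd1 (EdgeScaling.rescale g a 2 N)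
            - Real.sqrt 2 * EdgeScaling.l2NormSq (fun x => g (-x ^ 2) * x)|
          ≤ C * (N : ℝ) ^ (-a / 2) ∧
        |(N : ℝ) ^ (3 * a / 2) * EdgeScaling.Vd1 (EdgeScaling.rescale g a 2 N)
            - EdgeScaling.l2NormSq (fun x => g (-x ^ 2) * x) / Real.pi|
          ≤ C * (N : ℝ) ^ (-a / 2) ∧
        -- the functionals that involve `σ`, uniformly in `σ ≤ 1 - ε`, and at `σ = 1`
        ∀ σ : ℝ, (σ ∈ Set.Icc (-1 : ℝ) (1 - ε) ∨ σ = 1) →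
          |EdgeScaling.Vtr2 (EdgeScaling.rescale g a 2 N) σ
              - EdgeScaling.indOne σ *
                (EdgeScaling.hHalfNormSq (fun x => g (-x ^ 2)) / (8 * Real.pi ^ 2))|
            ≤ C * (N : ℝ) ^ (-a / 2) ∧
          |EdgeScaling.scaleC a 2 N * EdgeScaling.Vd2 (EdgeScaling.rescale g a 2 N) σ
              - EdgeScaling.indOne σ *
                (Real.sqrt 2 * EdgeScaling.l2NormSq (fun x => g (-x ^ 2) * x))|
            ≤ C * (N : ℝ) ^ (-a / 2) ∧
          |(N : ℝ) ^ (3 * a / 2) * EdgeScaling.Vd2 (EdgeScaling.rescale g a 2 N) σ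
              - EdgeScaling.indOne σ *
                (EdgeScaling.l2NormSq (fun x => g (-x ^ 2) * x) / Real.pi)|
            ≤ C * (N : ℝ) ^ (-a / 2) ∧
          |-(EdgeScaling.Etr (EdgeScaling.rescale g a 2 N) σ) / 2
              - EdgeScaling.indOne σ * (g 0 / 4)|
            ≤ C * (N : ℝ) ^ (-a / 2) := by
  -- B and R are those of `MemH2NormLE.isProfile`; they depend only on L and M, so C is fixed before
  -- g, N and σ.
  obtain ⟨C, hC⟩ := EdgeScaling.exists_edge_bounds
    (B := (1 + 2 * (|L| + 1)) * ((|L| + 1) + M ^ 2 / 2)) (R := |L| + 1) (by positivity)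
    (by positivity) hε
  refine ⟨C, fun g hg hM hL N hN => ?_⟩
  have hP := hM.isProfile hg hL
  obtain ⟨s, hs⟩ : ∃ s : ℝ, s = (N : ℝ) ^ (-a / 2) := ⟨_, rfl⟩
  have hN1 : (1 : ℝ) ≤ N := by exact_mod_cast hN
  have hs0 : 0 < s := by rw [hs]; positivity
  have hs1 : s ≤ 1 := by
    rw [hs]
    exact Real.rpow_le_one_of_one_le_of_nonpos hN1 (by linarith)
  rw [EdgeScaling.rescale_eq_edgeFn hs, EdgeScaling.scaleC_eq ha₀ hs hs0.ne',
    EdgeScaling.rpow_three_halves_eq hs, ← hs]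
  exact ⟨fun σ hσ => hP.tendsto_extensions hs0 hσ,
    hC g hP s ⟨hs0, hs1⟩ _ (EdgeScaling.abs_inv_rhoC_edge_sub_le hs0 hs1)⟩
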